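/- \textbf{Setting.} Let $d\ge 1$. A \emph{tile} is a compact connected subset of $\mathbb{R}^d$ that is the closure of its interior; a \emph{patch} is a collection of tiles with pairwise disjoint interiors, its \emph{support} is the union of its tiles, and a \emph{tiling} is a patch with support $\mathbb{R}^d$. Let $X$ be a translation-invariant set of tilings of $\mathbb{R}^d$ whose tiles are, up to translation, $D_1,\dots,D_l$ (pairwise inequivalent under translation), with finite local complexity: up to translation, only finitely many two-tile patches with connected support occur in tilings of $X$. Let $\mathcal{P}(X)$ be the set of finite patches contained in tilings of $X$. Write $B_r$ for the closed ball of radius $r$ about $0$. For $x,y\in X$ let $d_T(x,y)$ be the infimum of $\{\sqrt2/2\}$ together with all $0<r<\sqrt2/2$ such that there are subpatches $x'\subseteq x$, $y'\subseteq y$ with bounded supports containing $B_{1/r}$, and $\vec t$ with $\|\vec t\|\le r$ and $\vec t+x'=y'$. Sets of tilings carry the Borel $\sigma$-algebra of $d_T$. Let $J$ be a finite nonempty set and let $\mathcal{S}=\{S_i\}_{i\in J}$ be substitutions: $S_i$ maps tiles of $X$ to finite patches in $\mathcal{P}(X)$, there is $\lambda_i>1$ with $\mathrm{supp}\,S_i(D)=\lambda_i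 D$ and $S_i(\vec t+D)=\lambda_i\vec t+S_i(D)$, and $x\mapsto\bigcup_{D\in x}S_i(D)$ maps $\mathcal{P}(X)$ to $\mathcal{P}(X)$ and $X$ to $X$. Let $A_i$ be the $l\times l$ matrix whose $(r,s)$ entry is the number of translates of $D_r$ in $S_i(D_s)$. Put $\Sigma=J^{\mathbb{N}}$, with $d_\Sigma(\bar a,\bar b)=1/L$, where $L\geq 1$ is the least index with $a_L\ne b_L$ (and $d_\Sigma(\bar a,\bar a)=0$). Assume that $\mathcal{S}$ is primitive: for all $\bar a\in\Sigma$ and $n\ge1$ there is $N\ge 0$ such that all entries of $A_{a_n}A_{a_{n+1}}\cdots A_{a_{n+N}}$ are positive. Let $S_{\bar a}^k=S_{a_1}\circ\dots\circ S_{a_k}$ ($S^0_{\bar a}$ is the identity). Fix a tile $D$ of $X$, and let $X_{\bar a}$ be the set of tilings $x\in X$ each of whose finite subpatches has a translate contained in $S_{\bar a}^k(D)$ for some $k\geq 0$. For a patch $P$ and $U\subseteq\mathbb{R}^d$ let $X^{\bar a}_{P,U}=\{x\in X_{\bar a}:\ \vec t+P\subseteq x \text{ for some }\vec t\in U\}$.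 Call $\theta\in(0,1)$ a \emph{tile frequency rate} if for all $\bar a\in\Sigma$ and $i$ the limit $$c_{\bar a}(D_i)=\lim_{n\to\infty}\frac{\#\{\text{translates of }D_i\text{ in }S^n_{\bar a}(D_j)\}}{\mathrm{vol}(\mathrm{supp}\,S^n_{\bar a}(D_j))}$$ exists and does not depend on $j$, and there is $C>0$ such that $|c_{\bar a}(D_i)-c_{\bar b}(D_i)|<C\theta^{1/\delta}$ for all $\delta>0$, all $\bar a,\bar b\in\Sigma$ with $d_\Sigma(\bar a,\bar b)<\delta$, and all $i$. Let $\mathcal{D}$ be the maximum over $i$ of the upper Minkowski dimensions $\inf\{\beta:\ \mathrm{vol}(\{\vec t:\mathrm{dist}(\vec t,\partial D_i)\le r\})=O(r^{d-\beta})\text{ as }r\to0^+\}$, let $\lambda=\min_{i\in J}\lambda_i$, and put $$\theta_0=\theta_0(\theta)=\theta^{\frac{\mathcal{D}-d}{\mathcal{D}-d+\log_\lambda\theta}}.$$ \textbf{Theorem.} A tile frequency rate exists. For every tile frequency rate $\theta$ we have $\theta_0<1$, and for all finite patches $P,Q\in\mathcal{P}(X)$ and all bounded Lebesgue measurable sets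 $U,V\subset\mathbb{R}^d$ there are $C>0$ and $\delta_0>0$ such that, for all $0<\delta<\delta_0$ and all $\bar a,\bar b\in\Sigma$ with $d_\Sigma(\bar a,\bar b)<\delta$, $$\bigl|\mu_{\bar a}(X^{\bar a}_{P,U}\cap X^{\bar a}_{Q,V})-\mu_{\bar b}(X^{\bar b}_{P,U}\cap X^{\bar b}_{Q,V})\bigr|<C\,\theta_0^{1/\delta}$$ whenever $\mu_{\bar a}$ and $\mu_{\bar b}$ are translation-invariant Borel probability measures on $X_{\bar a}$ and $X_{\bar b}$. -/

import Mathlib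

open Set Filter Topology MeasureTheory
open scoped Pointwise

noncomputable section

namespace MultiTiling

/-- `ℝ^d` with the Euclidean norm. -/
abbrev Space (d : ℕ) : Type := EuclideanSpace ℝ (Fin d)

/-- Collections of subsets of `ℝ^d`. Patches and tilings are such collections; for `t : Space d`,
`t +ᵥ D` is the translated set and `t +ᵥ x` is the collection of the translated members of `x`. -/
abbrev Collection (d : ℕ) : Type := Set (Set (Space d))

variable {d : ℕ}

/-! ### Tiles, patches, tilings -/

/-- Compact, connected (hence nonempty), and equal to the closure of its interior. -/
def IsTile (D : Set (Space d)) : Prop :=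
  IsCompact D ∧ IsConnected D ∧ closure (interior D) = D

/-- Tiles with pairwise disjoint interiors. -/
def IsPatch (x : Collection d) : Prop :=
  (∀ D ∈ x, IsTile D) ∧ ∀ D ∈ x, ∀ D' ∈ x, D ≠ D' → Disjoint (interior D) (interior D')

/-- The support of a patch. -/
def supp (x : Collection d) : Set (Space d) := ⋃₀ x

def IsTiling (x : Collection d) : Prop := IsPatch x ∧ supp x = univ

/-- The two patches are translates of each other. -/
def Equivalent (x y : Collection d) : Prop := ∃ t : Space d, y = t +ᵥ x

/-- The tiles occurring in the tilings of `X`. -/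
def tilesOf (X : Set (Collection d)) : Set (Set (Space d)) := {D | ∃ x ∈ X, D ∈ x}

/-- The finite patches occurring in the tilings of `X`. -/
def patchesOf (X : Set (Collection d)) : Set (Collection d) :=
  {p | p.Finite ∧ ∃ x ∈ X, p ⊆ x}

/-- Finite local complexity: up to translation, only finitely many patches consisting of two tiles
and having connected support occur in the tilings of `X`. -/
def FiniteLocalComplexity (X : Set (Collection d)) : Prop :=
  ∃ F : Set (Collection d), F.Finite ∧
    ∀ p ∈ patchesOf X, p.ncard = 2 → IsConnected (supp p) → ∃ q ∈ F, Equivalent q p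

/-! ### The tiling metric and its Borel structure -/

/-- The subpatches of `x` with bounded support whose support contains `K`. -/
def patchesCovering (x : Collection d) (K : Set (Space d)) : Set (Collection d) :=
  {p | p ⊆ x ∧ Bornology.IsBounded (supp p) ∧ K ⊆ supp p}

/-- The tiling metric `d_T`. -/
def tilingDist (x y : Collection d) : ℝ :=
  sInf ({√2 / 2} ∪ {r : ℝ | 0 < r ∧ r < √2 / 2 ∧
    ∃ x' ∈ patchesCovering x (Metric.closedBall 0 (1 / r)),
    ∃ y' ∈ patchesCovering y (Metric.closedBall 0 (1 / r)),
    ∃ t : Space d, ‖t‖ ≤ r ∧ t +ᵥ x' = y'})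

/-- A set `Y` of tilings, as a type. -/
def Points (Y : Set (Collection d)) : Type := {x : Collection d // x ∈ Y}

/-- The topology of the metric `d_T` on `Y`. -/
instance (Y : Set (Collection d)) : TopologicalSpace (Points Y) where
  IsOpen G := ∀ x ∈ G, ∃ ε > 0, ∀ y : Points Y, tilingDist x.1 y.1 < ε → y ∈ G
  isOpen_univ := fun _ _ => ⟨1, one_pos, fun _ _ => trivial⟩
  isOpen_inter := fun G H hG hH x hx => by
    obtain ⟨ε, hε, h⟩ := hG x hx.1
    obtain ⟨ε', hε', h'⟩ := hH x hx.2
    exact ⟨min ε ε', lt_min hε hε', fun y hy =>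
      ⟨h y (hy.trans_le (min_le_left _ _)), h' y (hy.trans_le (min_le_right _ _))⟩⟩
  isOpen_sUnion := fun 𝒢 h𝒢 x ⟨G, hG, hx⟩ => by
    obtain ⟨ε, hε, h⟩ := h𝒢 G hG x hx
    exact ⟨ε, hε, fun y hy => ⟨G, hG, h y hy⟩⟩

instance (Y : Set (Collection d)) : MeasurableSpace (Points Y) := borel (Points Y)

instance (Y : Set (Collection d)) : BorelSpace (Points Y) := ⟨rfl⟩

/-- `μ` is a Borel probability measure on `Y` with `μ (t + B) = μ B` for all translations `t` and
all Borel sets `B` (meant for translation-invariant `Y`). -/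
def IsInvariantProbability {Y : Set (Collection d)} (μ : Measure (Points Y)) : Prop :=
  IsProbabilityMeasure μ ∧
    ∀ (t : Space d) (B : Set (Points Y)), MeasurableSet B →
      μ {x | ∃ y ∈ B, x.1 = t +ᵥ y.1} = μ B

/-- The cylinder set: the tilings in `Y` which contain `t + p` for some `t ∈ U`. -/
def patchCylinder (Y : Set (Collection d)) (p : Collection d) (U : Set (Space d)) : Set (Points Y) :=
  {x | ∃ t ∈ U, t +ᵥ p ⊆ x.1}

/-! ### Substitutions -/

/-- The image `⋃_{D ∈ x} S(D)` of a patch under a map `S` on tiles. -/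
def applySubst (S : Set (Space d) → Collection d) (x : Collection d) : Collection d :=
  ⋃ D ∈ x, S D

/-- `S` is a self-similar substitution with dilatation factor `lam` on the tiles of `X` which
extends to finite patches and to `X`. (Values of `S` outside `tilesOf X` are irrelevant.) -/
structure IsSubstitution (X : Set (Collection d)) (S : Set (Space d) → Collection d)
    (lam : ℝ) : Prop where
  one_lt : 1 < lam
  mem_patchesOf : ∀ D ∈ tilesOf X, S D ∈ patchesOf X
  supp_eq : ∀ D ∈ tilesOf X, supp (S D) = lam • D
  map_translate : ∀ D ∈ tilesOf X, ∀ t : Space d, S (t +ᵥ D) = (lam • t) +ᵥ S D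
  extend_patches : ∀ p ∈ patchesOf X, applySubst S p ∈ patchesOf X
  extend_tilings : ∀ x ∈ X, applySubst S x ∈ X

/-- The number of tiles of `p` that are translates of `D`. -/
def tileCount (D : Set (Space d)) (p : Collection d) : ℕ :=
  {E ∈ p | ∃ t : Space d, E = t +ᵥ D}.ncard

/-- A family, indexed by `J`, of substitutions on a translation-invariant space `X` of tilings of
`ℝ^d` with finite local complexity and with prototiles `proto 0, …, proto (l - 1)`. -/
structure MultiSubstitution (d l : ℕ) (J : Type*) where
  /-- the space of tilings -/
  X : Set (Collection d)
  isTiling : ∀ x ∈ X, IsTiling x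
  translate_mem : ∀ x ∈ X, ∀ t : Space d, t +ᵥ x ∈ X
  flc : FiniteLocalComplexity X
  /-- representatives of the translation classes of tiles -/
  proto : Fin l → Set (Space d)
  proto_mem : ∀ i, proto i ∈ tilesOf X
  proto_inequiv : ∀ i j, i ≠ j → ∀ t : Space d, proto j ≠ t +ᵥ proto i
  exists_proto : ∀ D ∈ tilesOf X, ∃ i, ∃ t : Space d, D = t +ᵥ proto i
  /-- the substitutions -/
  S : J → Set (Space d) → Collection d
  /-- the dilatation factors -/
  lam : J → ℝ
  isSubstitution : ∀ i, IsSubstitution X (S i) (lam i)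

/-- The metric on sequences: `1 / L`, where `L` is the least index, counted from `1`, at which the
sequences differ. -/
def seqDist {J : Type*} (a b : ℕ → J) : ℝ :=
  open Classical in if a = b then 0 else 1 / ((PiNat.firstDiff a b : ℝ) + 1)

/-- The upper Minkowski dimension of `H`. -/
def upperMinkowskiDim (H : Set (Space d)) : ℝ :=
  sInf {β : ℝ | (fun r : ℝ => volume.real (Metric.cthickening r H))
    =O[𝓝[>] 0] (fun r : ℝ => r ^ ((d : ℝ) - β))}

namespace MultiSubstitution

variable {l : ℕ} {J : Type*} (𝒮 : MultiSubstitution d l J)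

/-- The structure matrix of the substitution `S_i`. -/
def structureMatrix (i : J) : Matrix (Fin l) (Fin l) ℕ :=
  Matrix.of fun r s => tileCount (𝒮.proto r) (𝒮.S i (𝒮.proto s))

/-- The product of the structure matrices of the first `n` letters of `a`, in that order. -/
def matrixProd (a : ℕ → J) : ℕ → Matrix (Fin l) (Fin l) ℕ
  | 0 => 1
  | n + 1 => matrixProd a n * 𝒮.structureMatrix (a n)

/-- For every sequence `a` of letters and every `n`, some product
`A_{a_n} A_{a_{n+1}} ⋯ A_{a_{n+N}}` has only positive entries. -/
def IsPrimitive : Prop :=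
  ∀ (a : ℕ → J) (n : ℕ), ∃ N : ℕ, ∀ r s, 0 < 𝒮.matrixProd (fun m => a (n + m)) (N + 1) r s

/-- `S_a^n = S_{a_1} ∘ ⋯ ∘ S_{a_n}`, acting on patches; the letters of `a` are `a 0, a 1, …`. -/
def iter (a : ℕ → J) : ℕ → Collection d → Collection d
  | 0, p => p
  | n + 1, p => iter a n (applySubst (𝒮.S (a n)) p)

/-- The multi-substitution tiling space `X_a`, with initial tile `D`: the tilings in `X` all of
whose finite subpatches occur, up to translation, in some `S_a^k(D)`. -/
def tilingSpace (D : Set (Space d)) (a : ℕ → J) : Set (Collection d) :=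
  {x ∈ 𝒮.X | ∀ p ⊆ x, p.Finite → ∃ (k : ℕ) (t : Space d), t +ᵥ p ⊆ 𝒮.iter a k {D}}

/-- `c` is the frequency of the prototile `i` for the sequence `a`: the limit of
`L_{D_i}(S_a^n(D_j)) / vol(S_a^n(D_j))` as `n → ∞`, for every `j`. -/
def HasTileFreq (a : ℕ → J) (i : Fin l) (c : ℝ) : Prop :=
  ∀ j, Tendsto (fun n => (tileCount (𝒮.proto i) (𝒮.iter a n {𝒮.proto j}) : ℝ) /
    volume.real (supp (𝒮.iter a n {𝒮.proto j}))) atTop (𝓝 c)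

/-- The tile frequencies `c_a(D_i)` exist and depend on `a` with exponential rate `θ`. -/
def IsTileFreqRate (θ : ℝ) : Prop :=
  0 < θ ∧ θ < 1 ∧ ∃ c : (ℕ → J) → Fin l → ℝ,
    (∀ a i, 𝒮.HasTileFreq a i (c a i)) ∧
    ∃ C > 0, ∀ δ > 0, ∀ a b : ℕ → J, seqDist a b < δ → ∀ i, |c a i - c b i| < C * θ ^ (1 / δ)

/-- The largest upper Minkowski dimension of the boundary of a prototile. -/
def boundaryDim : ℝ := ⨆ i, upperMinkowskiDim (frontier (𝒮.proto i))

/-- The smallest dilatation factor. -/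
def minLam : ℝ := ⨅ i, 𝒮.lam i

/-- `θ₀ = θ ^ ((𝒟 - d) / (𝒟 - d + log_λ θ))`, with `𝒟` the boundary dimension and `λ` the smallest
dilatation factor. -/
def theta0 (θ : ℝ) : ℝ :=
  θ ^ ((𝒮.boundaryDim - d) / (𝒮.boundaryDim - d + Real.logb 𝒮.minLam θ))

end MultiSubstitution

end MultiTiling

end

open MultiTiling

/-! Fix `P, Q, U, V`. The positions `t` at which a tiling contains `t + u + P` and `t + v + Q` for
some `u ∈ U`, `v ∈ V` form a local rule `W`, and the cylinder intersection is the event `0 ∈ W x`.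
The density of `W` in the supertiles `S_a^m(D_j)` has a limit `F a` that does not depend on `j`. The
averages of `W` over large balls approach `F a` uniformly over `X_a`, because a large ball is filled
by supertiles up to a thin shell. Integrating such an average against an invariant measure, with
Fubini, shows that every invariant measure gives the event the value `F a` (`measureReal_rule_eq`,
`abs_volume_tiling_sub_le`). It remains to estimate `F a - F b`.

A large supertile is a union of supertiles of level `m`, and the rule crosses from one to another
only in boundary layers of relative volume `O(q ^ m)`, where `q = λ ^ (β - d)` with `β` slightly
above `𝒟`. Hence `F a` lies within `O(q ^ m)` of `approxFreq`, the sum of the level-`m` densities of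
`W` weighted by the tile frequencies of the shifted sequence (`exists_ruleFreq`). For sequences that
agree on `n` letters a single level `m` gives the error `θ ^ (n - m) + q ^ m`, and balancing the two
terms with `q = λ ^ (𝒟 - d)` yields `θ₀`. Here the increments from one level to the next are
compared instead. They have size `q ^ m` and vary like `θ ^ (n - 1 - m)`, so their sum is `O(n * ρ ^
n)` with `ρ = max θ q` (`abs_approxFreq_sub_le`). As `θ₀` is strictly larger than `θ` and `λ ^ (𝒟 -
d)` (`theta0_bounds`), it absorbs both the factor `n` and the excess of `β` over `𝒟`.

Two facts stand behind this. First, `𝒟 < d`: a big supertile contains a tile off its boundary, so at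
each inflation step the boundary layer loses a fixed proportion of volume (`boundaryVol_scale_le`).
Second, a tile frequency rate exists: densities at a higher level are averages of those at a lower
level, and primitivity makes the averaging a uniform contraction (`density_contract`). -/

namespace MultiTiling

/-! ### Euclidean geometry of tiles and patches. -/

section Geometry

variable {d : ℕ}

theorem supp_vadd (t : Space d) (x : Collection d) : supp (t +ᵥ x) = t +ᵥ supp x := by
  ext z
  simp only [supp, mem_sUnion, mem_vadd_set_iff_neg_vadd_mem]
  constructor
  · rintro ⟨E, hE, hz⟩
    exact ⟨-t +ᵥ E, hE, by simpa [mem_vadd_set_iff_neg_vadd_mem] using hz⟩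
  · rintro ⟨E, hE, hz⟩
    exact ⟨t +ᵥ E, by simpa using hE, by simpa [mem_vadd_set_iff_neg_vadd_mem] using hz⟩

theorem frontier_vadd (t : Space d) (E : Set (Space d)) : frontier (t +ᵥ E) = t +ᵥ frontier E := by
  rw [frontier, frontier, Set.vadd_set_sdiff, interior_vadd, closure_vadd]

theorem frontier_smul_pos {c : ℝ} (hc : 0 < c) (E : Set (Space d)) :
    frontier (c • E) = c • frontier E := by
  rw [frontier, frontier, Set.smul_set_sdiff₀ hc.ne', interior_smul₀ hc.ne', closure_smul₀' hc.ne']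

theorem cthickening_vadd (r : ℝ) (t : Space d) (E : Set (Space d)) :
    Metric.cthickening r (t +ᵥ E) = t +ᵥ Metric.cthickening r E := by
  ext z
  rw [mem_vadd_set_iff_neg_vadd_mem, Metric.mem_cthickening_iff, Metric.mem_cthickening_iff]
  conv_lhs => rw [← vadd_neg_vadd t z, Metric.infEDist_vadd]

theorem cthickening_smul_pos {c : ℝ} (hc : 0 < c) (r : ℝ) (E : Set (Space d)) :
    Metric.cthickening (c * r) (c • E) = c • Metric.cthickening r E := by
  ext z
  rw [mem_smul_set_iff_inv_smul_mem₀ hc.ne', Metric.mem_cthickening_iff, Metric.mem_cthickening_iff]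
  conv_lhs => rw [← smul_inv_smul₀ hc.ne' z, infEDist_smul₀ hc.ne']
  rw [ENNReal.ofReal_mul hc.le, ENNReal.smul_def, smul_eq_mul]
  have h1 : ((‖c‖₊ : NNReal) : ENNReal) = ENNReal.ofReal c := by
    rw [← ENNReal.ofReal_coe_nnreal, coe_nnnorm, Real.norm_of_nonneg hc.le]
  rw [h1]
  exact ENNReal.mul_le_mul_iff_right (by simpa using hc) ENNReal.ofReal_ne_top

theorem volume_real_vadd (t : Space d) (E : Set (Space d)) :
    volume.real (t +ᵥ E) = volume.real E := by
  simp only [Measure.real, measure_vadd]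

theorem volume_real_smul {c : ℝ} (hc : 0 < c) (E : Set (Space d)) :
    volume.real (c • E) = c ^ d * volume.real E := by
  simp only [Measure.real, Measure.addHaar_smul, finrank_euclideanSpace, Fintype.card_fin,
    ENNReal.toReal_mul]
  rw [ENNReal.toReal_ofReal (abs_nonneg _), abs_of_pos (by positivity)]

/-- The ball is connected and misses the frontier, so it cannot pass from the interior of `A` to the
complement of its closure. -/
theorem closedBall_subset_interior {A : Set (Space d)} {t : Space d} {R : ℝ} (hR : 0 ≤ R)
    (ht : t ∈ A) (h : t ∉ Metric.cthickening R (frontier A)) :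
    Metric.closedBall t R ⊆ interior A := by
  have hdis : Disjoint (Metric.closedBall t R) (frontier A) := by
    rw [Set.disjoint_left]
    intro z hz hzf
    exact h (Metric.mem_cthickening_of_dist_le t z R _ hzf (by
      rw [dist_comm]; exact Metric.mem_closedBall.1 hz))
  have hc : IsPreconnected (Metric.closedBall t R) := (convex_closedBall t R).isPreconnected
  have htt : t ∈ Metric.closedBall t R := Metric.mem_closedBall_self hR
  have hti : t ∈ interior A := by
    by_contra hn
    exact Set.disjoint_left.1 hdis htt ⟨subset_closure ht, hn⟩
  intro z hz
  by_contra hn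
  obtain ⟨w, hw, hw'⟩ := hc (interior A) (closure A)ᶜ isOpen_interior isClosed_closure.isOpen_compl
    (fun w hw => by
      by_cases hwi : w ∈ interior A
      · exact Or.inl hwi
      · right
        intro hwc
        exact Set.disjoint_left.1 hdis hw ⟨hwc, hwi⟩) ⟨t, htt, hti⟩
    ⟨z, hz, fun hzc => Set.disjoint_left.1 hdis hz ⟨hzc, hn⟩⟩
  exact hw'.2 (subset_closure (interior_subset hw'.1))

/-- At a point of `D` where `⟪t, ·⟫` is maximal, translation by `t` would raise the value by `‖t‖²`.
-/
theorem eq_zero_of_vadd_eq {D : Set (Space d)} (hc : IsCompact D) (hne : D.Nonempty) {t : Space d}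
    (h : t +ᵥ D = D) : t = 0 := by
  obtain ⟨x, hx, hmax⟩ := hc.exists_isMaxOn hne
    (f := fun x => inner ℝ t x)
    (by fun_prop : Continuous fun x : Space d => inner ℝ t x).continuousOn
  have h1 : t +ᵥ x ∈ D := h ▸ vadd_mem_vadd_set hx
  have h2 : inner ℝ t (t +ᵥ x) ≤ inner ℝ t x := hmax h1
  rw [vadd_eq_add, inner_add_right] at h2
  have h3 : inner ℝ t t ≤ 0 := by linarith
  exact real_inner_self_nonpos.1 h3

theorem IsTile.interior_nonempty {E : Set (Space d)} (h : IsTile E) : (interior E).Nonempty := by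
  rw [← closure_nonempty_iff, h.2.2]
  exact h.2.1.nonempty

theorem IsTile.vadd {E : Set (Space d)} (h : IsTile E) (t : Space d) : IsTile (t +ᵥ E) := by
  refine ⟨h.1.vadd t, ?_, ?_⟩
  · rw [← Set.image_vadd]
    exact h.2.1.image _ (continuous_const_vadd t).continuousOn
  · rw [interior_vadd, closure_vadd, h.2.2]

theorem IsTile.measurableSet {E : Set (Space d)} (h : IsTile E) : MeasurableSet E :=
  h.1.isClosed.measurableSet

theorem IsTile.volume_interior_pos {E : Set (Space d)} (h : IsTile E) :
    0 < volume.real (interior E) :=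
  ENNReal.toReal_pos (isOpen_interior.measure_pos _ h.interior_nonempty).ne'
    ((measure_mono interior_subset).trans_lt h.1.measure_lt_top).ne

theorem IsTile.volume_pos {E : Set (Space d)} (h : IsTile E) : 0 < volume.real E :=
  h.volume_interior_pos.trans_le (measureReal_mono interior_subset h.1.measure_lt_top.ne)

theorem IsTile.isCompact_frontier {E : Set (Space d)} (h : IsTile E) : IsCompact (frontier E) :=
  h.1.of_isClosed_subset isClosed_frontier h.1.isClosed.frontier_subset

theorem IsPatch.mono {x p : Collection d} (hx : IsPatch x) (hp : p ⊆ x) : IsPatch p :=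
  ⟨fun E hE => hx.1 E (hp hE), fun E hE F hF => hx.2 E (hp hE) F (hp hF)⟩

/-- A tile is the closure of its interior, so an open set that meets it also meets its interior. -/
theorem IsPatch.eq_of_mem_interior {x : Collection d} (hx : IsPatch x) {E F : Set (Space d)}
    (hE : E ∈ x) (hF : F ∈ x) {z : Space d} (hz : z ∈ interior E) (hz' : z ∈ F) : E = F := by
  by_contra hne
  rw [← (hx.1 F hF).2.2] at hz'
  obtain ⟨w, hw, hw'⟩ := mem_closure_iff.1 hz' _ isOpen_interior hz
  exact Set.disjoint_left.1 (hx.2 E hE F hF hne) hw hw'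

/-- This makes the presence of a given tile a local property: it can be read off any subpatch that
covers the tile. -/
theorem IsPatch.mem_of_subset_supp {x p : Collection d} (hx : IsPatch x) (hp : p ⊆ x)
    {E : Set (Space d)} (hE : E ∈ x) (h : E ⊆ supp p) : E ∈ p := by
  obtain ⟨z, hz⟩ := (hx.1 E hE).interior_nonempty
  obtain ⟨F, hF, hzF⟩ := h (interior_subset hz)
  rwa [hx.eq_of_mem_interior hE (hp hF) hz hzF]

theorem supp_mono {p q : Collection d} (h : p ⊆ q) : supp p ⊆ supp q := sUnion_subset_sUnion h

theorem vadd_subset_iff {t : Space d} {p x : Collection d} : t +ᵥ p ⊆ x ↔ p ⊆ -t +ᵥ x := by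
  constructor
  · intro h E hE
    rw [mem_vadd_set_iff_neg_vadd_mem, neg_neg]
    exact h (vadd_mem_vadd_set hE)
  · intro h E hE
    rw [mem_vadd_set_iff_neg_vadd_mem] at hE
    simpa using vadd_mem_vadd_set (a := t) (h hE)

theorem aedisjoint_of_disjoint_interior {A B : Set (Space d)}
    (hA0 : volume (frontier A) = 0) (hB0 : volume (frontier B) = 0)
    (h : Disjoint (interior A) (interior B)) : AEDisjoint volume A B := by
  refine measure_mono_null (t := frontier A ∪ frontier B) ?_ (measure_union_null hA0 hB0)
  rintro z ⟨hzA, hzB⟩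
  by_cases hz : z ∈ interior A
  · right
    exact ⟨subset_closure hzB, fun hz' => Set.disjoint_left.1 h hz hz'⟩
  · exact Or.inl ⟨subset_closure hzA, hz⟩

theorem volume_inter_biUnion {ι : Type*} (s : Finset ι) (A : ι → Set (Space d))
    (hA : ∀ i ∈ s, IsCompact (A i)) (h0 : ∀ i ∈ s, volume (frontier (A i)) = 0)
    (hd : ∀ i ∈ s, ∀ j ∈ s, i ≠ j → Disjoint (interior (A i)) (interior (A j)))
    {B : Set (Space d)} (hB : MeasurableSet B) :
    volume.real (B ∩ ⋃ i ∈ s, A i) = ∑ i ∈ s, volume.real (B ∩ A i) := by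
  rw [inter_iUnion₂]
  refine measureReal_biUnion_finset₀ ?_ ?_ ?_
  · intro i hi j hj hij
    exact (aedisjoint_of_disjoint_interior (h0 i hi) (h0 j hj)
      (hd i hi j hj hij)).mono inter_subset_right inter_subset_right
  · exact fun i hi => (hB.inter (hA i hi).measurableSet).nullMeasurableSet
  · exact fun i hi => ((measure_mono inter_subset_right).trans_lt (hA i hi).measure_lt_top).ne

end Geometry

end MultiTiling

/-! ### Iterated substitutions, tile counts and matrix products. -/

namespace MultiTiling

namespace MultiSubstitution

/-- The sequence `a` without its first `m` letters. -/
def shift {J : Type*} (m : ℕ) (a : ℕ → J) : ℕ → J := fun k => a (m + k)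

theorem shift_zero {J : Type*} (a : ℕ → J) : shift 0 a = a := by
  funext k
  simp [shift]

theorem shift_shift {J : Type*} (m n : ℕ) (a : ℕ → J) : shift n (shift m a) = shift (m + n) a := by
  funext k
  simp [shift, add_assoc]

variable {d l : ℕ} {J : Type*} (𝒮 : MultiSubstitution d l J)

/-- The dilatation factor of `S_a^n`. -/
noncomputable def scale (a : ℕ → J) (n : ℕ) : ℝ := ∏ k ∈ Finset.range n, 𝒮.lam (a k)

theorem lam_pos (j : J) : 0 < 𝒮.lam j := zero_lt_one.trans (𝒮.isSubstitution j).one_lt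

theorem scale_pos (a : ℕ → J) (n : ℕ) : 0 < 𝒮.scale a n :=
  Finset.prod_pos fun _ _ => 𝒮.lam_pos _

theorem scale_zero (a : ℕ → J) : 𝒮.scale a 0 = 1 := by simp [scale]

theorem scale_succ (a : ℕ → J) (n : ℕ) : 𝒮.scale a (n + 1) = 𝒮.scale a n * 𝒮.lam (a n) :=
  Finset.prod_range_succ _ _

theorem scale_add (a : ℕ → J) (m n : ℕ) :
    𝒮.scale a (m + n) = 𝒮.scale a m * 𝒮.scale (shift m a) n :=
  Finset.prod_range_add _ _ _

theorem scale_congr {a b : ℕ → J} {n : ℕ} (h : ∀ k < n, a k = b k) :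
    𝒮.scale a n = 𝒮.scale b n :=
  Finset.prod_congr rfl fun k hk => by rw [h k (Finset.mem_range.1 hk)]

variable {𝒮}

theorem isPatch_of_mem {p : Collection d} (hp : p ∈ patchesOf 𝒮.X) : IsPatch p := by
  obtain ⟨-, x, hx, hpx⟩ := hp
  exact (𝒮.isTiling x hx).1.mono hpx

theorem mem_tilesOf {p : Collection d} (hp : p ∈ patchesOf 𝒮.X) {E : Set (Space d)} (hE : E ∈ p) :
    E ∈ tilesOf 𝒮.X := by
  obtain ⟨-, x, hx, hpx⟩ := hp
  exact ⟨x, hx, hpx hE⟩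

theorem isTile_of_mem {E : Set (Space d)} (hE : E ∈ tilesOf 𝒮.X) : IsTile E := by
  obtain ⟨x, hx, hEx⟩ := hE
  exact (𝒮.isTiling x hx).1.1 E hEx

theorem isTile_proto (i : Fin l) : IsTile (𝒮.proto i) := isTile_of_mem (𝒮.proto_mem i)

theorem singleton_mem {E : Set (Space d)} (hE : E ∈ tilesOf 𝒮.X) : {E} ∈ patchesOf 𝒮.X := by
  obtain ⟨x, hx, hEx⟩ := hE
  exact ⟨finite_singleton E, x, hx, singleton_subset_iff.2 hEx⟩

theorem mem_patchesOf_mono {p q : Collection d} (hp : p ∈ patchesOf 𝒮.X) (h : q ⊆ p) :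
    q ∈ patchesOf 𝒮.X := by
  obtain ⟨hf, x, hx, hpx⟩ := hp
  exact ⟨hf.subset h, x, hx, h.trans hpx⟩

theorem supp_singleton (E : Set (Space d)) : supp {E} = E := sUnion_singleton E

theorem applySubst_singleton (S : Set (Space d) → Collection d) (E : Set (Space d)) :
    applySubst S {E} = S E := by
  simp [applySubst]

theorem supp_applySubst {p : Collection d} (hp : p ∈ patchesOf 𝒮.X) (j : J) :
    supp (applySubst (𝒮.S j) p) = 𝒮.lam j • supp p := by
  have h : supp (applySubst (𝒮.S j) p) = ⋃ E ∈ p, supp (𝒮.S j E) := by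
    simp only [supp, applySubst, sUnion_iUnion]
  rw [h, supp, sUnion_eq_biUnion, smul_set_iUnion₂]
  exact iUnion₂_congr fun E hE => (𝒮.isSubstitution j).supp_eq E (mem_tilesOf hp hE)

theorem applySubst_vadd {p : Collection d} (hp : p ∈ patchesOf 𝒮.X) (j : J) (t : Space d) :
    applySubst (𝒮.S j) (t +ᵥ p) = (𝒮.lam j • t) +ᵥ applySubst (𝒮.S j) p := by
  rw [applySubst, applySubst, vadd_set_iUnion₂, ← Set.image_vadd, biUnion_image]
  exact iUnion₂_congr fun E hE => (𝒮.isSubstitution j).map_translate E (mem_tilesOf hp hE) t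

theorem disjoint_interior_smul {E F : Set (Space d)} (h : Disjoint (interior E) (interior F))
    {c : ℝ} (hc : 0 < c) : Disjoint (interior (c • E)) (interior (c • F)) := by
  rw [interior_smul₀ hc.ne', interior_smul₀ hc.ne']
  exact (Set.disjoint_image_iff (MulAction.injective₀ hc.ne')).2 h

/-- The inflated supports have disjoint interiors, and a common tile would have its nonempty
interior in both. This makes tile counts additive. -/
theorem disjoint_subst {p : Collection d} (hp : p ∈ patchesOf 𝒮.X) (j : J) {E F : Set (Space d)}
    (hE : E ∈ p) (hF : F ∈ p) (hne : E ≠ F) : Disjoint (𝒮.S j E) (𝒮.S j F) := by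
  rw [Set.disjoint_left]
  intro G hGE hGF
  have h := disjoint_interior_smul ((isPatch_of_mem hp).2 E hE F hF hne) (𝒮.lam_pos j)
  have hS := 𝒮.isSubstitution j
  rw [← hS.supp_eq E (mem_tilesOf hp hE), ← hS.supp_eq F (mem_tilesOf hp hF)] at h
  obtain ⟨z, hz⟩ := (isTile_of_mem (mem_tilesOf (hS.mem_patchesOf E (mem_tilesOf hp hE))
    hGE)).interior_nonempty
  exact Set.disjoint_left.1 h (interior_mono (subset_sUnion_of_mem hGE) hz)
    (interior_mono (subset_sUnion_of_mem hGF) hz)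

theorem iter_mem_patchesOf (a : ℕ → J) (n : ℕ) {p : Collection d} (hp : p ∈ patchesOf 𝒮.X) :
    𝒮.iter a n p ∈ patchesOf 𝒮.X := by
  induction n generalizing p with
  | zero => exact hp
  | succ n ih => exact ih ((𝒮.isSubstitution (a n)).extend_patches p hp)

theorem supp_iter (a : ℕ → J) (n : ℕ) {p : Collection d} (hp : p ∈ patchesOf 𝒮.X) :
    supp (𝒮.iter a n p) = 𝒮.scale a n • supp p := by
  induction n generalizing p with
  | zero => rw [scale_zero, one_smul]; rfl
  | succ n ih =>
    rw [iter, ih ((𝒮.isSubstitution (a n)).extend_patches p hp), supp_applySubst hp, scale_succ,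
      mul_smul]

theorem iter_vadd (a : ℕ → J) (n : ℕ) {p : Collection d} (hp : p ∈ patchesOf 𝒮.X) (t : Space d) :
    𝒮.iter a n (t +ᵥ p) = (𝒮.scale a n • t) +ᵥ 𝒮.iter a n p := by
  induction n generalizing p t with
  | zero => rw [scale_zero, one_smul]; rfl
  | succ n ih =>
    rw [iter, iter, applySubst_vadd hp, ih ((𝒮.isSubstitution (a n)).extend_patches p hp),
      scale_succ, mul_smul]

theorem iter_eq_biUnion (a : ℕ → J) (n : ℕ) (p : Collection d) :
    𝒮.iter a n p = ⋃ E ∈ p, 𝒮.iter a n {E} := by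
  induction n generalizing p with
  | zero => simp [iter]
  | succ n ih =>
    simp only [iter, applySubst_singleton]
    rw [ih, applySubst, biUnion_iUnion]
    refine iUnion_congr fun E => ?_
    rw [biUnion_iUnion]
    exact iUnion_congr fun _ => (ih _).symm

theorem iter_mono (a : ℕ → J) (n : ℕ) {p q : Collection d} (h : p ⊆ q) :
    𝒮.iter a n p ⊆ 𝒮.iter a n q := by
  rw [iter_eq_biUnion a n p, iter_eq_biUnion a n q]
  exact biUnion_subset_biUnion_left h

/-- The first letter acts last. The early letters therefore fix the inside of the supertiles
`S_a^m(E)`, and the later ones only fix how these supertiles are arranged. -/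
theorem iter_add (a : ℕ → J) (m n : ℕ) (p : Collection d) :
    𝒮.iter a (m + n) p = 𝒮.iter a m (𝒮.iter (shift m a) n p) := by
  induction n generalizing p with
  | zero => rfl
  | succ n ih => rw [← add_assoc, iter, iter, ih]; rfl

theorem iter_congr {a b : ℕ → J} {n : ℕ} (h : ∀ k < n, a k = b k) (p : Collection d) :
    𝒮.iter a n p = 𝒮.iter b n p := by
  induction n generalizing p with
  | zero => rfl
  | succ n ih => rw [iter, iter, ih fun k hk => h k (hk.trans n.lt_succ_self), h n n.lt_succ_self]

theorem tileCount_vadd (E : Set (Space d)) (t : Space d) (p : Collection d) :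
    tileCount E (t +ᵥ p) = tileCount E p := by
  have h : {F ∈ t +ᵥ p | ∃ s : Space d, F = s +ᵥ E} = t +ᵥ {F ∈ p | ∃ s : Space d, F = s +ᵥ E} := by
    ext F
    rw [mem_vadd_set_iff_neg_vadd_mem, mem_ofPred_eq, mem_ofPred_eq, mem_vadd_set_iff_neg_vadd_mem]
    refine and_congr_right fun _ => ⟨fun ⟨s, hs⟩ => ⟨-t + s, ?_⟩, fun ⟨s, hs⟩ => ⟨t + s, ?_⟩⟩
    · rw [hs, vadd_vadd]
    · rw [← vadd_vadd, ← hs, vadd_neg_vadd]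
  rw [tileCount, tileCount, h, ← Set.image_vadd]
  exact ncard_image_of_injective _ (AddAction.injective t)

/-- Each tile is a translate of exactly one prototile, so a translation-invariant sum over tiles can
be grouped by type. -/
theorem sum_tiles {M : Type*} [Semiring M] {p : Collection d} (hp : p ∈ patchesOf 𝒮.X)
    (f : Set (Space d) → M) (hf : ∀ i, ∀ t : Space d, f (t +ᵥ 𝒮.proto i) = f (𝒮.proto i)) :
    ∑ E ∈ hp.1.toFinset, f E = ∑ i, (tileCount (𝒮.proto i) p : M) * f (𝒮.proto i) := by
  classical
  have h1 : ∀ E ∈ hp.1.toFinset, f E =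
      ∑ i, if ∃ t : Space d, E = t +ᵥ 𝒮.proto i then f (𝒮.proto i) else 0 := by
    intro E hE
    obtain ⟨i, t, rfl⟩ := 𝒮.exists_proto E (mem_tilesOf hp (hp.1.mem_toFinset.1 hE))
    rw [Finset.sum_eq_single i, if_pos ⟨t, rfl⟩, hf]
    · rintro j - hj
      refine if_neg ?_
      rintro ⟨s, hs⟩
      refine 𝒮.proto_inequiv j i hj (-t + s) ?_
      rw [← vadd_vadd, ← hs, neg_vadd_vadd]
    · simp
  rw [Finset.sum_congr rfl h1, Finset.sum_comm]
  refine Finset.sum_congr rfl fun i _ => ?_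
  rw [← Finset.sum_filter, Finset.sum_const, nsmul_eq_mul]
  congr 2
  rw [tileCount, ← Set.ncard_coe_finset]
  congr 1
  ext E
  simp

theorem tileCount_applySubst {p : Collection d} (hp : p ∈ patchesOf 𝒮.X) (j : J) (i : Fin l) :
    tileCount (𝒮.proto i) (applySubst (𝒮.S j) p) =
      ∑ s, 𝒮.structureMatrix j i s * tileCount (𝒮.proto s) p := by
  have h1 : tileCount (𝒮.proto i) (applySubst (𝒮.S j) p) =
      ∑ E ∈ hp.1.toFinset, tileCount (𝒮.proto i) (𝒮.S j E) := by
    have : {E ∈ applySubst (𝒮.S j) p | ∃ t : Space d, E = t +ᵥ 𝒮.proto i} =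
        ⋃ E ∈ p, {F ∈ 𝒮.S j E | ∃ t : Space d, F = t +ᵥ 𝒮.proto i} := by
      ext F
      simp only [applySubst, mem_iUnion, mem_ofPred_eq]
      tauto
    rw [tileCount, this, hp.1.ncard_biUnion, finsum_mem_eq_finite_toFinset_sum _ hp.1]
    · rfl
    · exact fun E hE => ((𝒮.isSubstitution j).mem_patchesOf E
        (mem_tilesOf hp hE)).1.subset (sep_subset _ _)
    · exact fun E hE F hF hne => (disjoint_subst hp j hE hF hne).mono
        (sep_subset _ _) (sep_subset _ _)
  rw [h1, sum_tiles hp]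
  · refine Finset.sum_congr rfl fun s _ => ?_
    rw [mul_comm]
    rfl
  · intro s t
    rw [(𝒮.isSubstitution j).map_translate _ (𝒮.proto_mem s), tileCount_vadd]

theorem tileCount_iter (a : ℕ → J) (n : ℕ) {p : Collection d} (hp : p ∈ patchesOf 𝒮.X)
    (i : Fin l) : tileCount (𝒮.proto i) (𝒮.iter a n p) =
      ∑ s, 𝒮.matrixProd a n i s * tileCount (𝒮.proto s) p := by
  induction n generalizing p with
  | zero => simp [matrixProd, iter, Matrix.one_apply]
  | succ n ih =>
    rw [iter, ih ((𝒮.isSubstitution (a n)).extend_patches p hp)]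
    simp only [tileCount_applySubst hp, matrixProd, Matrix.mul_apply, Finset.mul_sum,
      Finset.sum_mul]
    rw [Finset.sum_comm]
    simp only [mul_assoc]

theorem tileCount_proto (i s : Fin l) :
    tileCount (𝒮.proto i) {𝒮.proto s} = if i = s then 1 else 0 := by
  rw [tileCount]
  split_ifs with h
  · subst h
    have : {E ∈ ({𝒮.proto i} : Collection d) | ∃ t : Space d, E = t +ᵥ 𝒮.proto i} =
        {𝒮.proto i} := by
      ext E
      simp only [mem_ofPred_eq, mem_singleton_iff, and_iff_left_iff_imp]
      rintro rfl
      exact ⟨0, (zero_vadd _ _).symm⟩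
    rw [this, ncard_singleton]
  · have : {E ∈ ({𝒮.proto s} : Collection d) | ∃ t : Space d, E = t +ᵥ 𝒮.proto i} = ∅ := by
      ext E
      simp only [mem_ofPred_eq, mem_singleton_iff, mem_empty_iff_false, iff_false]
      rintro ⟨rfl, t, ht⟩
      exact 𝒮.proto_inequiv i s h t ht
    rw [this, ncard_empty]

theorem tileCount_iter_proto (a : ℕ → J) (n : ℕ) (i s : Fin l) :
    tileCount (𝒮.proto i) (𝒮.iter a n {𝒮.proto s}) = 𝒮.matrixProd a n i s := by
  rw [tileCount_iter a n (singleton_mem (𝒮.proto_mem s))]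
  simp [tileCount_proto]

theorem matrixProd_add (a : ℕ → J) (m n : ℕ) :
    𝒮.matrixProd a (m + n) = 𝒮.matrixProd a m * 𝒮.matrixProd (shift m a) n := by
  induction n with
  | zero => simp [matrixProd]
  | succ n ih => rw [← add_assoc, matrixProd, matrixProd, ih, Matrix.mul_assoc]; rfl

theorem matrixProd_congr {a b : ℕ → J} {n : ℕ} (h : ∀ k < n, a k = b k) :
    𝒮.matrixProd a n = 𝒮.matrixProd b n := by
  induction n with
  | zero => rfl
  | succ n ih =>
    rw [matrixProd, matrixProd, ih fun k hk => h k (hk.trans n.lt_succ_self), h n n.lt_succ_self]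

end MultiSubstitution

end MultiTiling

/-! ### Volume of boundary layers and the boundary dimension. -/

namespace MultiTiling

variable {d : ℕ}

/-- The volume of the closed `r`-neighbourhood of the boundary of `E`. -/
noncomputable def boundaryVol (r : ℝ) (E : Set (Space d)) : ℝ :=
  volume.real (Metric.cthickening r (frontier E))

theorem boundaryVol_nonneg (r : ℝ) (E : Set (Space d)) : 0 ≤ boundaryVol r E := measureReal_nonneg

theorem boundaryVol_vadd (r : ℝ) (t : Space d) (E : Set (Space d)) :
    boundaryVol r (t +ᵥ E) = boundaryVol r E := by
  rw [boundaryVol, frontier_vadd, cthickening_vadd, volume_real_vadd, boundaryVol]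

theorem boundaryVol_smul {c : ℝ} (hc : 0 < c) (r : ℝ) (E : Set (Space d)) :
    boundaryVol (c * r) (c • E) = c ^ d * boundaryVol r E := by
  rw [boundaryVol, frontier_smul_pos hc, cthickening_smul_pos hc, volume_real_smul hc, boundaryVol]

theorem IsTile.volume_cthickening_ne_top {E : Set (Space d)} (h : IsTile E) (r : ℝ) :
    volume (Metric.cthickening r (frontier E)) ≠ ⊤ :=
  h.isCompact_frontier.cthickening.measure_lt_top.ne

theorem IsTile.boundaryVol_mono {E : Set (Space d)} (h : IsTile E) {r s : ℝ} (hrs : r ≤ s) :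
    boundaryVol r E ≤ boundaryVol s E :=
  measureReal_mono (Metric.cthickening_mono hrs _) (h.volume_cthickening_ne_top s)

theorem volume_interior_vadd (t : Space d) (E : Set (Space d)) :
    volume.real (interior (t +ᵥ E)) = volume.real (interior E) := by
  rw [interior_vadd, volume_real_vadd]

namespace MultiSubstitution

variable {l : ℕ} {J : Type*} {𝒮 : MultiSubstitution d l J}

variable (𝒮) in
theorem exists_dist_bound : ∃ M > 0, ∀ E ∈ tilesOf 𝒮.X, ∀ x ∈ E, ∀ y ∈ E, dist x y ≤ M := by
  have h : ∀ i, ∃ M, ∀ x ∈ 𝒮.proto i, ∀ y ∈ 𝒮.proto i, dist x y ≤ M := fun i =>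
    Metric.isBounded_iff.1 (isTile_proto i).1.isBounded |>.imp fun M hM x hx y hy => hM hx hy
  choose M hM using h
  refine ⟨1 + ∑ i, |M i|, by positivity, fun E hE x hx y hy => ?_⟩
  obtain ⟨i, t, rfl⟩ := 𝒮.exists_proto E hE
  rw [mem_vadd_set_iff_neg_vadd_mem] at hx hy
  have h1 := hM i _ hx _ hy
  rw [dist_vadd_cancel_left] at h1
  have h2 : |M i| ≤ ∑ i, |M i| := Finset.single_le_sum (f := fun i => |M i|)
    (fun i _ => abs_nonneg _) (Finset.mem_univ i)
  linarith [le_abs_self (M i)]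

/-- Once a ball inside `D_i` has been inflated beyond the diameter of all tiles, the tile containing
its centre cannot reach the boundary. -/
theorem exists_interior_tile (j : J) : ∃ N, N ≠ 0 ∧ ∀ i, ∃ E ∈ 𝒮.iter (fun _ => j) N {𝒮.proto i},
    Disjoint E (frontier (𝒮.scale (fun _ => j) N • 𝒮.proto i)) := by
  obtain ⟨M, hM, hdist⟩ := 𝒮.exists_dist_bound
  have h : ∀ i, ∃ x, ∃ ρ > 0, Metric.ball x ρ ⊆ interior (𝒮.proto i) := fun i => by
    obtain ⟨x, hx⟩ := (isTile_proto (𝒮 := 𝒮) i).interior_nonempty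
    exact ⟨x, Metric.isOpen_iff.1 isOpen_interior x hx⟩
  choose x ρ hρ hball using h
  have hN : ∀ i, ∀ᶠ N : ℕ in atTop, M < 𝒮.lam j ^ N * ρ i := fun i =>
    ((tendsto_pow_atTop_atTop_of_one_lt (𝒮.isSubstitution j).one_lt).atTop_mul_const
      (hρ i)).eventually_gt_atTop M
  obtain ⟨N, hN, hN0⟩ := ((eventually_all.2 hN).and (eventually_ne_atTop 0)).exists
  refine ⟨N, hN0, fun i => ?_⟩
  have hs : 𝒮.scale (fun _ => j) N = 𝒮.lam j ^ N := by simp [scale]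
  have hc : 0 < 𝒮.lam j ^ N := pow_pos (𝒮.lam_pos j) N
  rw [hs]
  have hp := singleton_mem (𝒮.proto_mem i)
  have hmem : 𝒮.lam j ^ N • x i ∈ supp (𝒮.iter (fun _ => j) N {𝒮.proto i}) := by
    rw [supp_iter _ _ hp, supp_singleton, hs]
    exact smul_mem_smul_set (interior_subset (hball i (Metric.mem_ball_self (hρ i))))
  obtain ⟨E, hE, hxE⟩ := hmem
  refine ⟨E, hE, ?_⟩
  rw [Set.disjoint_left]
  intro z hz hzf
  refine hzf.2 ?_
  rw [interior_smul₀ hc.ne', mem_smul_set_iff_inv_smul_mem₀ hc.ne']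
  apply hball i
  have h1 := hdist E (mem_tilesOf (iter_mem_patchesOf _ N hp) hE) z hz _ hxE
  have h2 : (𝒮.lam j ^ N)⁻¹ • z - x i = (𝒮.lam j ^ N)⁻¹ • (z - 𝒮.lam j ^ N • x i) := by
    rw [smul_sub, inv_smul_smul₀ hc.ne']
  rw [Metric.mem_ball, dist_eq_norm, h2, norm_smul, norm_inv, Real.norm_of_nonneg hc.le,
    ← dist_eq_norm, inv_mul_lt_iff₀ hc]
  exact h1.trans_lt (hN i)

theorem sum_interior_le {p : Collection d} (hp : p ∈ patchesOf 𝒮.X) :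
    ∑ E ∈ hp.1.toFinset, volume.real (interior E) ≤ volume.real (interior (supp p)) := by
  have hpp := isPatch_of_mem hp
  have hc : ∀ E ∈ hp.1.toFinset, IsCompact E := fun E hE => (hpp.1 E (hp.1.mem_toFinset.1 hE)).1
  rw [← measureReal_biUnion_finset
    (fun E hE F hF hne => hpp.2 E (hp.1.mem_toFinset.1 hE) F (hp.1.mem_toFinset.1 hF) hne)
    (fun E _ => isOpen_interior.measurableSet)
    (fun E hE => ((measure_mono interior_subset).trans_lt (hc E hE).measure_lt_top).ne)]
  · refine measureReal_mono ?_ ?_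
    · refine iUnion₂_subset fun E hE => interior_mono ?_
      exact subset_sUnion_of_mem (hp.1.mem_toFinset.1 hE)
    · refine ((measure_mono interior_subset).trans_lt (IsCompact.measure_lt_top ?_)).ne
      rw [supp, sUnion_eq_biUnion]
      exact hp.1.isCompact_biUnion fun E hE => (hpp.1 E hE).1

theorem frontier_supp_subset {p : Collection d} (hp : p ∈ patchesOf 𝒮.X) :
    ∀ z ∈ frontier (supp p), ∃ E ∈ p, z ∈ frontier E := by
  intro z hz
  have hpp := isPatch_of_mem hp
  have hcl : IsClosed (supp p) := by
    rw [supp, sUnion_eq_biUnion]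
    exact hp.1.isClosed_biUnion fun E hE => (hpp.1 E hE).1.isClosed
  obtain ⟨E, hE, hzE⟩ := hcl.frontier_subset hz
  exact ⟨E, hE, subset_closure hzE, fun hzi => hz.2 (interior_mono (subset_sUnion_of_mem hE) hzi)⟩

/-- The boundary of `L • D_i` is covered by the boundaries of the tiles of the supertile other than
the interior tile `E₀`. Summing the assumed bounds over those tiles saves the share of `E₀`. Volumes
of interiors are used because nullity of the boundaries is deduced from this estimate. -/
theorem boundaryVol_scale_le (j : J) : ∃ L > 1, ∃ κ ∈ Ioo (0 : ℝ) 1, ∀ r ≥ 0, ∀ B ≥ 0,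
    (∀ i, boundaryVol r (𝒮.proto i) ≤ B * volume.real (interior (𝒮.proto i))) →
    ∀ i, boundaryVol (L⁻¹ * r) (𝒮.proto i) ≤ κ * B * volume.real (interior (𝒮.proto i)) := by
  classical
  obtain ⟨N, hN0, hN⟩ := exists_interior_tile (𝒮 := 𝒮) j
  set a : ℕ → J := fun _ => j with ha
  set L := 𝒮.scale a N with hL
  set v : Fin l → ℝ := fun i => volume.real (interior (𝒮.proto i)) with hv
  have hLpos : 0 < L := 𝒮.scale_pos a N
  have hvpos : ∀ i, 0 < v i := fun i => (isTile_proto i).volume_interior_pos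
  rcases isEmpty_or_nonempty (Fin l) with hl | hl
  · exact ⟨2, by norm_num, 1 / 2, by norm_num, fun _ _ _ _ _ i => (hl.false i).elim⟩
  obtain ⟨i₀, hi₀⟩ := Finite.exists_min v
  obtain ⟨i₁, hi₁⟩ := Finite.exists_max v
  have hL1 : 1 < L := by
    have hLN : L = 𝒮.lam j ^ N := by simp [hL, scale, ha]
    rw [hLN]
    exact one_lt_pow₀ (𝒮.isSubstitution j).one_lt hN0
  -- A lower bound for the proportion of the inflated interior occupied by the smallest possible
  -- `E₀`.
  set ε := v i₀ / (L ^ d * v i₁) with hε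
  have hεpos : 0 < ε := div_pos (hvpos _) (mul_pos (pow_pos hLpos d) (hvpos _))
  -- The maximum with `1 / 2` keeps `κ` positive, so that its logarithm can serve as an exponent.
  refine ⟨L, hL1, max (1 / 2) (1 - ε), ⟨by positivity, max_lt (by norm_num) (by linarith)⟩, ?_⟩
  intro r hr B hB h i
  obtain ⟨E₀, hE₀, hdis⟩ := hN i
  have hp0 := singleton_mem (𝒮.proto_mem i)
  have hp := iter_mem_patchesOf a N hp0
  have hsupp : supp (𝒮.iter a N {𝒮.proto i}) = L • 𝒮.proto i := by
    rw [supp_iter a N hp0, supp_singleton]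
  have htile : ∀ E ∈ tilesOf 𝒮.X, boundaryVol r E ≤ B * volume.real (interior E) := by
    intro E hE
    obtain ⟨k, t, rfl⟩ := 𝒮.exists_proto E hE
    rw [boundaryVol_vadd, volume_interior_vadd]
    exact h k
  have hmem : ∀ E ∈ hp.1.toFinset, E ∈ tilesOf 𝒮.X := fun E hE =>
    mem_tilesOf hp (hp.1.mem_toFinset.1 hE)
  have hE₀' : E₀ ∈ hp.1.toFinset := hp.1.mem_toFinset.2 hE₀
  have hsub : Metric.cthickening r (frontier (L • 𝒮.proto i)) ⊆
      ⋃ E ∈ hp.1.toFinset.erase E₀, Metric.cthickening r (frontier E) := by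
    have hcomp : IsCompact (frontier (L • 𝒮.proto i)) := by
      rw [frontier_smul_pos hLpos]
      exact (isTile_proto i).isCompact_frontier.smul L
    rw [hcomp.cthickening_eq_biUnion_closedBall hr]
    refine iUnion₂_subset fun x hx z hz => ?_
    obtain ⟨E, hE, hxE⟩ := frontier_supp_subset hp x (hsupp ▸ hx)
    refine mem_iUnion₂.2 ⟨E, Finset.mem_erase.2 ⟨?_, hp.1.mem_toFinset.2 hE⟩,
      Metric.mem_cthickening_of_dist_le z x r _ hxE hz⟩
    rintro rfl
    exact Set.disjoint_left.1 hdis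
      ((isTile_of_mem (mem_tilesOf hp hE)).1.isClosed.frontier_subset hxE) hx
  have h1 : L ^ d * boundaryVol (L⁻¹ * r) (𝒮.proto i) ≤
      ∑ E ∈ hp.1.toFinset.erase E₀, boundaryVol r E := by
    rw [← boundaryVol_smul hLpos, mul_inv_cancel_left₀ hLpos.ne']
    refine (measureReal_mono hsub ?_).trans (measureReal_biUnion_finset_le _ _)
    refine ((measure_biUnion_finset_le _ _).trans_lt ?_).ne
    exact ENNReal.sum_lt_top.2 fun E hE =>
      ((isTile_of_mem (hmem E (Finset.mem_of_mem_erase hE))).volume_cthickening_ne_top r).lt_top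
  have h2 : ∑ E ∈ hp.1.toFinset.erase E₀, boundaryVol r E ≤ B * (L ^ d * v i - v i₀) := by
    calc _ ≤ ∑ E ∈ hp.1.toFinset.erase E₀, B * volume.real (interior E) :=
          Finset.sum_le_sum fun E hE => htile E (hmem E (Finset.mem_of_mem_erase hE))
      _ = B * (∑ E ∈ hp.1.toFinset, volume.real (interior E) - volume.real (interior E₀)) := by
          rw [← Finset.mul_sum, ← Finset.add_sum_erase _ _ hE₀']
          ring
      _ ≤ _ := by
          refine mul_le_mul_of_nonneg_left (sub_le_sub ?_ ?_) hB
          · refine (sum_interior_le hp).trans_eq ?_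
            rw [hsupp, interior_smul₀ hLpos.ne', volume_real_smul hLpos]
          · obtain ⟨k, t, rfl⟩ := 𝒮.exists_proto E₀ (hmem E₀ hE₀')
            rw [volume_interior_vadd]
            exact hi₀ k
  have h3 : ε * (L ^ d * v i) ≤ v i₀ := by
    rw [hε, div_mul_eq_mul_div, div_le_iff₀ (mul_pos (pow_pos hLpos d) (hvpos _))]
    exact mul_le_mul_of_nonneg_left (mul_le_mul_of_nonneg_left (hi₁ i) (pow_pos hLpos d).le)
      (hvpos _).le
  have h4 : L ^ d * boundaryVol (L⁻¹ * r) (𝒮.proto i) ≤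
      L ^ d * (max (1 / 2) (1 - ε) * B * v i) := by
    have h5 : (1 - ε) * (B * (L ^ d * v i)) ≤ max (1 / 2) (1 - ε) * (B * (L ^ d * v i)) :=
      mul_le_mul_of_nonneg_right (le_max_right _ _)
        (mul_nonneg hB (mul_nonneg (pow_pos hLpos d).le (hvpos i).le))
    have h6 : B * (ε * (L ^ d * v i)) ≤ B * v i₀ := mul_le_mul_of_nonneg_left h3 hB
    nlinarith [h1, h2, h5, h6]
  exact le_of_mul_le_mul_left h4 (pow_pos hLpos d)

/-- Iterating the contraction gives decay `κ ^ n` at radius `L⁻¹ ^ n`, which is a power law with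
exponent `log κ / log L⁻¹`. It yields both null boundaries and `𝒟 < d`. -/
theorem exists_boundaryVol_rpow_le [Nonempty J] : ∃ s > 0, ∃ C, ∀ i, ∀ r ∈ Ioc (0 : ℝ) 1,
    boundaryVol r (𝒮.proto i) ≤ C * r ^ (s : ℝ) := by
  obtain ⟨L, hL, κ, ⟨hκ0, hκ1⟩, h⟩ := boundaryVol_scale_le (𝒮 := 𝒮) (Classical.arbitrary J)
  have hL0 : 0 < L := zero_lt_one.trans hL
  set v : Fin l → ℝ := fun i => volume.real (interior (𝒮.proto i)) with hv
  have hvpos : ∀ i, 0 < v i := fun i => (isTile_proto i).volume_interior_pos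
  set B := ∑ i, boundaryVol 1 (𝒮.proto i) / v i with hB
  have hB0 : 0 ≤ B := Finset.sum_nonneg fun i _ => div_nonneg (boundaryVol_nonneg _ _) (hvpos i).le
  have hiter : ∀ n : ℕ, ∀ i, boundaryVol (L⁻¹ ^ n) (𝒮.proto i) ≤ κ ^ n * B * v i := by
    intro n
    induction n with
    | zero =>
      intro i
      rw [pow_zero, pow_zero, one_mul, ← div_le_iff₀ (hvpos i)]
      exact Finset.single_le_sum (f := fun i => boundaryVol 1 (𝒮.proto i) / v i)
        (fun i _ => div_nonneg (boundaryVol_nonneg _ _) (hvpos i).le) (Finset.mem_univ i)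
    | succ n ih =>
      intro i
      rw [pow_succ', pow_succ', mul_assoc κ]
      exact h _ (by positivity) _ (by positivity) ih i
  have hs : 0 < Real.log κ / Real.log L⁻¹ :=
    div_pos_of_neg_of_neg (Real.log_neg hκ0 hκ1)
      (Real.log_neg (inv_pos.2 hL0) (inv_lt_one_of_one_lt₀ hL))
  refine ⟨_, hs, κ⁻¹ * B * ∑ i, v i, fun i r hr => ?_⟩
  obtain ⟨n, hn1, hn2⟩ := exists_nat_pow_near_of_lt_one hr.1 hr.2 (inv_pos.2 hL0)
    (inv_lt_one_of_one_lt₀ hL)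
  have hpow : κ ^ (n + 1) ≤ r ^ (Real.log κ / Real.log L⁻¹) := by
    have h1 : κ = L⁻¹ ^ (Real.log κ / Real.log L⁻¹) := by
      rw [Real.rpow_def_of_pos (inv_pos.2 hL0), mul_div_cancel₀, Real.exp_log hκ0]
      exact (Real.log_neg (inv_pos.2 hL0) (inv_lt_one_of_one_lt₀ hL)).ne
    calc κ ^ (n + 1) = (L⁻¹ ^ (n + 1)) ^ (Real.log κ / Real.log L⁻¹) := by
          conv_lhs => rw [h1]
          rw [← Real.rpow_natCast, ← Real.rpow_natCast, ← Real.rpow_mul (inv_pos.2 hL0).le,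
            ← Real.rpow_mul (inv_pos.2 hL0).le, mul_comm]
      _ ≤ _ := Real.rpow_le_rpow (by positivity) hn1.le hs.le
  calc boundaryVol r (𝒮.proto i) ≤ boundaryVol (L⁻¹ ^ n) (𝒮.proto i) :=
        (isTile_proto i).boundaryVol_mono hn2
    _ ≤ κ ^ n * B * v i := hiter n i
    _ = κ⁻¹ * B * v i * κ ^ (n + 1) := by field_simp; ring
    _ ≤ κ⁻¹ * B * (∑ i, v i) * r ^ (Real.log κ / Real.log L⁻¹) := by
        have : v i ≤ ∑ i, v i :=
          Finset.single_le_sum (f := v) (fun i _ => (hvpos i).le) (Finset.mem_univ i)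
        gcongr

theorem volume_frontier_proto [Nonempty J] (i : Fin l) : volume (frontier (𝒮.proto i)) = 0 := by
  obtain ⟨s, hs, C, h⟩ := exists_boundaryVol_rpow_le (𝒮 := 𝒮)
  have hne : volume (frontier (𝒮.proto i)) ≠ ⊤ :=
    (isTile_proto i).isCompact_frontier.measure_lt_top.ne
  rw [← measureReal_eq_zero_iff hne]
  have hlim : Tendsto (fun r : ℝ => C * r ^ s) (𝓝[>] 0) (𝓝 (C * 0)) := by
    refine Tendsto.const_mul C ?_
    have := (Real.continuousAt_rpow_const 0 s (Or.inr hs.le)).tendsto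
    rw [Real.zero_rpow hs.ne'] at this
    exact this.mono_left nhdsWithin_le_nhds
  rw [mul_zero] at hlim
  refine le_antisymm (ge_of_tendsto hlim ?_) measureReal_nonneg
  filter_upwards [Ioc_mem_nhdsGT (zero_lt_one (α := ℝ))] with r hr
  exact (measureReal_mono (Metric.self_subset_cthickening _)
    ((isTile_proto i).volume_cthickening_ne_top r)).trans (h i r hr)

theorem volume_frontier [Nonempty J] {E : Set (Space d)} (hE : E ∈ tilesOf 𝒮.X) :
    volume (frontier E) = 0 := by
  obtain ⟨i, t, rfl⟩ := 𝒮.exists_proto E hE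
  rw [frontier_vadd, measure_vadd, volume_frontier_proto]

theorem boundaryDim_lt [Nonempty J] [Nonempty (Fin l)] (hd : 0 < d) : 𝒮.boundaryDim < d := by
  obtain ⟨i, hi⟩ := exists_eq_ciSup_of_finite
    (f := fun i => upperMinkowskiDim (frontier (𝒮.proto i)))
  rw [boundaryDim, ← hi]
  by_cases hb : BddBelow {β : ℝ | (fun r : ℝ => volume.real
      (Metric.cthickening r (frontier (𝒮.proto i)))) =O[𝓝[>] 0] (fun r : ℝ => r ^ ((d : ℝ) - β))}
  · obtain ⟨s, hs, C, h⟩ := exists_boundaryVol_rpow_le (𝒮 := 𝒮)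
    refine (csInf_le hb (a := d - s) ?_).trans_lt (by linarith)
    rw [mem_ofPred_eq, sub_sub_cancel]
    refine Asymptotics.IsBigO.of_bound C ?_
    filter_upwards [Ioc_mem_nhdsGT (zero_lt_one (α := ℝ))] with r hr
    rw [Real.norm_of_nonneg measureReal_nonneg, Real.norm_of_nonneg (Real.rpow_nonneg hr.1.le _)]
    exact h i r hr
  -- The infimum of a set unbounded below is `0` by convention, which is still less than `d`.
  · rw [upperMinkowskiDim, Real.sInf_of_not_bddBelow hb]
    exact_mod_cast hd

theorem boundaryVol_le_rpow [Nonempty J] {β : ℝ} (hβ : 𝒮.boundaryDim < β) (hβd : β < d) (R : ℝ)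
    (hR : 0 < R) : ∃ C, ∀ i, ∀ r ∈ Ioc (0 : ℝ) 1,
      boundaryVol (R * r) (𝒮.proto i) ≤ C * r ^ ((d : ℝ) - β) := by
  suffices h : ∀ i, ∃ C, ∀ r ∈ Ioc (0 : ℝ) 1,
      boundaryVol (R * r) (𝒮.proto i) ≤ C * r ^ ((d : ℝ) - β) by
    choose C hC using h
    refine ⟨∑ i, |C i|, fun i r hr => (hC i r hr).trans ?_⟩
    refine mul_le_mul_of_nonneg_right ((le_abs_self _).trans ?_) (Real.rpow_nonneg hr.1.le _)
    exact Finset.single_le_sum (f := fun i => |C i|) (fun i _ => abs_nonneg _) (Finset.mem_univ i)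
  intro i
  have hle : upperMinkowskiDim (frontier (𝒮.proto i)) < β :=
    (le_ciSup (f := fun i => upperMinkowskiDim (frontier (𝒮.proto i)))
      (finite_range _).bddAbove i).trans_lt hβ
  obtain ⟨s, hs, C', hC'⟩ := exists_boundaryVol_rpow_le (𝒮 := 𝒮)
  have hnonempty : {β : ℝ | (fun r : ℝ => volume.real
      (Metric.cthickening r (frontier (𝒮.proto i)))) =O[𝓝[>] 0]
      (fun r : ℝ => r ^ ((d : ℝ) - β))}.Nonempty := by
    refine ⟨d - s, ?_⟩
    rw [mem_ofPred_eq, sub_sub_cancel]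
    refine Asymptotics.IsBigO.of_bound C' ?_
    filter_upwards [Ioc_mem_nhdsGT (zero_lt_one (α := ℝ))] with r hr
    rw [Real.norm_of_nonneg measureReal_nonneg, Real.norm_of_nonneg (Real.rpow_nonneg hr.1.le _)]
    exact hC' i r hr
  obtain ⟨β', hβ', hlt⟩ := exists_lt_of_csInf_lt hnonempty hle
  obtain ⟨c, hc0, hc⟩ := hβ'.exists_pos
  obtain ⟨ε, hε0, hε⟩ := mem_nhdsGT_iff_exists_Ioo_subset.1 hc.bound
  have hδ : 0 < (d : ℝ) - β := by linarith
  set η := min ε 1 with hη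
  have hη0 : 0 < η := lt_min hε0 one_pos
  -- The asymptotic bound only covers `R * r < η`. Beyond that, the layer volume is at most its
  -- value at radius `R`, and the power is at least `η ^ (d - β)`.
  have hkey : ∀ r ∈ Ioc (0 : ℝ) 1, boundaryVol (R * r) (𝒮.proto i) ≤
      max c (boundaryVol R (𝒮.proto i) / η ^ ((d : ℝ) - β)) * (R * r) ^ ((d : ℝ) - β) := by
    intro r hr
    have hRr : 0 < R * r := mul_pos hR hr.1
    by_cases h : R * r < η
    · have h1 := hε ⟨hRr, h.trans_le (min_le_left _ _)⟩
      rw [mem_ofPred_eq, Real.norm_of_nonneg measureReal_nonneg,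
        Real.norm_of_nonneg (Real.rpow_nonneg hRr.le _)] at h1
      refine h1.trans (mul_le_mul (le_max_left _ _) ?_ (Real.rpow_nonneg hRr.le _)
        (hc0.le.trans (le_max_left _ _)))
      exact Real.rpow_le_rpow_of_exponent_ge hRr (h.le.trans (min_le_right _ _)) (by linarith)
    · have hηδ : 0 < η ^ ((d : ℝ) - β) := Real.rpow_pos_of_pos hη0 _
      calc boundaryVol (R * r) (𝒮.proto i) ≤ boundaryVol R (𝒮.proto i) :=
            (isTile_proto i).boundaryVol_mono (mul_le_of_le_one_right hR.le hr.2)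
        _ = boundaryVol R (𝒮.proto i) / η ^ ((d : ℝ) - β) * η ^ ((d : ℝ) - β) := by
            field_simp
        _ ≤ _ := mul_le_mul (le_max_right _ _)
            (Real.rpow_le_rpow hη0.le (not_lt.1 h) hδ.le) hηδ.le
            (hc0.le.trans (le_max_left _ _))
  refine ⟨max c (boundaryVol R (𝒮.proto i) / η ^ ((d : ℝ) - β)) * R ^ ((d : ℝ) - β),
    fun r hr => ?_⟩
  rw [mul_assoc, ← Real.mul_rpow hR.le hr.1.le]
  exact hkey r hr

end MultiSubstitution

end MultiTiling

/-! ### Tile densities and existence of a tile frequency rate. -/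

namespace MultiTiling

namespace MultiSubstitution

variable {d l : ℕ} {J : Type*} {𝒮 : MultiSubstitution d l J}

variable (𝒮) in
/-- The volume of a prototile. -/
noncomputable def protoVol (i : Fin l) : ℝ := volume.real (𝒮.proto i)

theorem protoVol_pos (i : Fin l) : 0 < 𝒮.protoVol i := (isTile_proto i).volume_pos

theorem isCompact_supp {p : Collection d} (hp : p ∈ patchesOf 𝒮.X) : IsCompact (supp p) := by
  rw [supp, sUnion_eq_biUnion]
  exact hp.1.isCompact_biUnion fun E hE => ((isPatch_of_mem hp).1 E hE).1

theorem volume_supp [Nonempty J] {p : Collection d} (hp : p ∈ patchesOf 𝒮.X) :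
    volume.real (supp p) = ∑ i, (tileCount (𝒮.proto i) p : ℝ) * 𝒮.protoVol i := by
  have h := volume_inter_biUnion hp.1.toFinset id
    (fun E hE => ((isPatch_of_mem hp).1 E (hp.1.mem_toFinset.1 hE)).1)
    (fun E hE => volume_frontier (mem_tilesOf hp (hp.1.mem_toFinset.1 hE)))
    (fun E hE F hF => (isPatch_of_mem hp).2 E (hp.1.mem_toFinset.1 hE) F
      (hp.1.mem_toFinset.1 hF)) MeasurableSet.univ
  simp only [univ_inter, id, Finite.mem_toFinset] at h
  rw [supp, sUnion_eq_biUnion, h]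
  exact sum_tiles hp (fun E => volume.real E) fun i t => volume_real_vadd t _

theorem volume_supp_iter (a : ℕ → J) (n : ℕ) {p : Collection d} (hp : p ∈ patchesOf 𝒮.X) :
    volume.real (supp (𝒮.iter a n p)) = 𝒮.scale a n ^ d * volume.real (supp p) := by
  rw [supp_iter a n hp, volume_real_smul (𝒮.scale_pos a n)]

theorem sum_matrixProd_mul_protoVol [Nonempty J] (a : ℕ → J) (n : ℕ) (j : Fin l) :
    ∑ i, (𝒮.matrixProd a n i j : ℝ) * 𝒮.protoVol i = 𝒮.scale a n ^ d * 𝒮.protoVol j := by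
  have hp := singleton_mem (𝒮.proto_mem j)
  have h := volume_supp (iter_mem_patchesOf a n hp)
  rw [volume_supp_iter a n hp, supp_singleton] at h
  simp only [tileCount_iter_proto] at h
  exact h.symm

variable (𝒮) in
/-- The number of tiles of type `i` in `S_a^n(D_j)` per volume. -/
noncomputable def density (a : ℕ → J) (n : ℕ) (i j : Fin l) : ℝ :=
  (𝒮.matrixProd a n i j : ℝ) / (𝒮.scale a n ^ d * 𝒮.protoVol j)

theorem hasTileFreq_iff {a : ℕ → J} {i : Fin l} {c : ℝ} :
    𝒮.HasTileFreq a i c ↔ ∀ j, Tendsto (fun n => 𝒮.density a n i j) atTop (𝓝 c) := by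
  refine forall_congr' fun j => ?_
  have : ∀ n, (tileCount (𝒮.proto i) (𝒮.iter a n {𝒮.proto j}) : ℝ) /
      volume.real (supp (𝒮.iter a n {𝒮.proto j})) = 𝒮.density a n i j := fun n => by
    rw [tileCount_iter_proto, volume_supp_iter a n (singleton_mem (𝒮.proto_mem j)),
      supp_singleton]
    rfl
  simp only [this]

theorem density_denom_pos (a : ℕ → J) (n : ℕ) (j : Fin l) :
    0 < 𝒮.scale a n ^ d * 𝒮.protoVol j :=
  mul_pos (pow_pos (𝒮.scale_pos a n) d) (protoVol_pos j)

theorem density_nonneg (a : ℕ → J) (n : ℕ) (i j : Fin l) : 0 ≤ 𝒮.density a n i j :=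
  div_nonneg (Nat.cast_nonneg _) (density_denom_pos a n j).le

theorem sum_protoVol_mul_density [Nonempty J] (a : ℕ → J) (n : ℕ) (j : Fin l) :
    ∑ i, 𝒮.protoVol i * 𝒮.density a n i j = 1 := by
  simp only [density, mul_div_assoc']
  rw [← Finset.sum_div, div_eq_one_iff_eq (density_denom_pos a n j).ne',
    ← sum_matrixProd_mul_protoVol]
  exact Finset.sum_congr rfl fun i _ => mul_comm _ _

theorem density_le [Nonempty J] (a : ℕ → J) (n : ℕ) (i j : Fin l) :
    𝒮.density a n i j ≤ (𝒮.protoVol i)⁻¹ := by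
  rw [← one_div, le_div_iff₀ (protoVol_pos i), mul_comm, ← sum_protoVol_mul_density a n j]
  exact Finset.single_le_sum (f := fun i => 𝒮.protoVol i * 𝒮.density a n i j)
    (fun i _ => mul_nonneg (protoVol_pos i).le (density_nonneg a n i j)) (Finset.mem_univ i)

/-- The factors `protoVol s * density (shift m a) n s j` are nonnegative and sum to one over `s`.
The density at level `m + n` is thus an average of the densities at level `m`. -/
theorem density_add (a : ℕ → J) (m n : ℕ) (i j : Fin l) :
    𝒮.density a (m + n) i j =
      ∑ s, 𝒮.density a m i s * (𝒮.protoVol s * 𝒮.density (shift m a) n s j) := by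
  have h1 := (𝒮.scale_pos a m).ne'
  have h2 := (𝒮.scale_pos (shift m a) n).ne'
  have h3 := (protoVol_pos (𝒮 := 𝒮) j).ne'
  rw [density, matrixProd_add, Matrix.mul_apply, scale_add]
  push_cast
  rw [Finset.sum_div]
  refine Finset.sum_congr rfl fun s _ => ?_
  have h4 := (protoVol_pos (𝒮 := 𝒮) s).ne'
  rw [density, density]
  field_simp
  rw [mul_pow]
  ring

theorem density_congr {a b : ℕ → J} {n : ℕ} (h : ∀ k < n, a k = b k) :
    𝒮.density a n = 𝒮.density b n := by
  funext i j
  rw [density, density, matrixProd_congr h, scale_congr 𝒮 h]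

theorem exists_structureMatrix_pos (j : J) (s : Fin l) : ∃ r, 0 < 𝒮.structureMatrix j r s := by
  have hS := 𝒮.isSubstitution j
  have hmem := hS.mem_patchesOf _ (𝒮.proto_mem s)
  have hne : (supp (𝒮.S j (𝒮.proto s))).Nonempty := by
    rw [hS.supp_eq _ (𝒮.proto_mem s)]
    exact (isTile_proto s).2.1.nonempty.smul_set
  obtain ⟨z, E, hE, -⟩ := hne
  obtain ⟨r, t, ht⟩ := 𝒮.exists_proto E (mem_tilesOf hmem hE)
  exact ⟨r, (ncard_pos (hmem.1.subset (sep_subset _ _))).2 ⟨E, hE, t, ht⟩⟩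

/-- No column of a structure matrix vanishes, so multiplying on the right preserves positivity. -/
theorem matrixProd_pos_of_le {a : ℕ → J} {m n : ℕ} (hmn : m ≤ n)
    (h : ∀ r s, 0 < 𝒮.matrixProd a m r s) (r s : Fin l) : 0 < 𝒮.matrixProd a n r s := by
  induction n, hmn using Nat.le_induction generalizing r s with
  | base => exact h r s
  | succ n _ ih =>
    obtain ⟨u, hu⟩ := exists_structureMatrix_pos (𝒮 := 𝒮) (a n) s
    rw [matrixProd, Matrix.mul_apply]
    exact Finset.sum_pos' (fun _ _ => Nat.zero_le _) ⟨u, Finset.mem_univ u, mul_pos (ih r u) hu⟩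

/-- Positivity of a product depends on finitely many letters, hence holds on a cylinder of
sequences; compactness of `J^ℕ` leaves finitely many cylinders. -/
theorem IsPrimitive.exists_uniform [Finite J] (h𝒮 : 𝒮.IsPrimitive) :
    ∃ M ≠ 0, ∀ a r s, 0 < 𝒮.matrixProd a M r s := by
  let _ : TopologicalSpace J := ⊥
  have _ : DiscreteTopology J := ⟨rfl⟩
  choose N hN using fun a => h𝒮 a 0
  obtain ⟨t, -, ht⟩ := isCompact_univ.elim_nhds_subcover
    (fun a : ℕ → J => PiNat.cylinder a (N a + 1))
    (fun a _ => (PiNat.isOpen_cylinder _ a _).mem_nhds (PiNat.self_mem_cylinder a _))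
  refine ⟨t.sup N + 1, Nat.succ_ne_zero _, fun a => ?_⟩
  obtain ⟨b, hb, hab⟩ := mem_iUnion₂.1 (ht (mem_univ a))
  refine matrixProd_pos_of_le (Nat.succ_le_succ (Finset.le_sup hb)) ?_
  rw [matrixProd_congr (b := fun m => b (0 + m)) fun k hk => by
    rw [Nat.zero_add]; exact PiNat.mem_cylinder_iff.1 hab k hk]
  exact hN b

/-- A positive integer entry is at least one, and the denominators are bounded at the fixed level
`M`. -/
theorem exists_weight_lower_bound [Finite J] [Nonempty J] {M : ℕ}
    (hM : ∀ a r s, 0 < 𝒮.matrixProd a M r s) :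
    ∃ ε ∈ Ioo (0 : ℝ) 1, ∀ a s j, ε ≤ 𝒮.protoVol s * 𝒮.density a M s j := by
  rcases isEmpty_or_nonempty (Fin l) with hl | hl
  · exact ⟨1 / 2, by norm_num, fun _ s => (hl.false s).elim⟩
  obtain ⟨i₀, hi₀⟩ := Finite.exists_min 𝒮.protoVol
  obtain ⟨i₁, hi₁⟩ := Finite.exists_max 𝒮.protoVol
  obtain ⟨k, hk⟩ := Finite.exists_max 𝒮.lam
  have hden : 0 < (𝒮.lam k ^ M) ^ d * 𝒮.protoVol i₁ :=
    mul_pos (pow_pos (pow_pos (𝒮.lam_pos k) M) d) (protoVol_pos i₁)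
  have hpos : 0 < 𝒮.protoVol i₀ / ((𝒮.lam k ^ M) ^ d * 𝒮.protoVol i₁) :=
    div_pos (protoVol_pos _) hden
  refine ⟨min (1 / 2) _, ⟨lt_min (by norm_num) hpos,
    (min_le_left _ _).trans_lt (by norm_num)⟩, fun a s j => (min_le_right _ _).trans ?_⟩
  rw [density, mul_div_assoc']
  have hscale : 𝒮.scale a M ≤ 𝒮.lam k ^ M := by
    have h := Finset.prod_le_prod (s := Finset.range M) (f := fun m => 𝒮.lam (a m))
      (g := fun _ => 𝒮.lam k) (fun m _ => (𝒮.lam_pos _).le) (fun m _ => hk _)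
    rwa [Finset.prod_const, Finset.card_range] at h
  have h1 : (1 : ℝ) ≤ 𝒮.matrixProd a M s j := by exact_mod_cast hM a s j
  refine div_le_div₀ (mul_nonneg (protoVol_pos s).le (by positivity)) ?_
    (density_denom_pos a M j) ?_
  · exact (hi₀ s).trans (le_mul_of_one_le_right (protoVol_pos s).le h1)
  · exact mul_le_mul (pow_le_pow_left₀ (𝒮.scale_pos a M).le hscale d) (hi₁ j) (protoVol_pos j).le
      (pow_pos (pow_pos (𝒮.lam_pos k) M) d).le

theorem density_mem_Icc_add [Nonempty J] {a : ℕ → J} {m : ℕ} {i : Fin l} {lo hi : ℝ}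
    (h : ∀ s, 𝒮.density a m i s ∈ Icc lo hi) (n : ℕ) (j : Fin l) :
    𝒮.density a (m + n) i j ∈ Icc lo hi := by
  have hw : ∀ s, 0 ≤ 𝒮.protoVol s * 𝒮.density (shift m a) n s j := fun s =>
    mul_nonneg (protoVol_pos s).le (density_nonneg _ _ _ _)
  have h1 := sum_protoVol_mul_density (𝒮 := 𝒮) (shift m a) n j
  rw [density_add]
  constructor
  · calc lo = ∑ s, lo * (𝒮.protoVol s * 𝒮.density (shift m a) n s j) := by
          rw [← Finset.mul_sum, h1, mul_one]
      _ ≤ _ := Finset.sum_le_sum fun s _ => mul_le_mul_of_nonneg_right (h s).1 (hw s)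
  · calc _ ≤ ∑ s, hi * (𝒮.protoVol s * 𝒮.density (shift m a) n s j) :=
          Finset.sum_le_sum fun s _ => mul_le_mul_of_nonneg_right (h s).2 (hw s)
      _ = hi := by rw [← Finset.mul_sum, h1, mul_one]

/-- This is Doeblin's argument. Every average gives weight at least `ε` to the value at one fixed
type `s₀`, which draws both ends of the interval towards that value by the proportion `ε`. -/
theorem density_contract [Nonempty J] {M : ℕ} {ε : ℝ}
    (hε : ∀ a s j, ε ≤ 𝒮.protoVol s * 𝒮.density a M s j) {a : ℕ → J} {m : ℕ} {i : Fin l}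
    {lo hi : ℝ} (h : ∀ s, 𝒮.density a m i s ∈ Icc lo hi) :
    ∃ lo' hi', hi' - lo' ≤ (1 - ε) * (hi - lo) ∧
      ∀ j, 𝒮.density a (m + M) i j ∈ Icc lo' hi' := by
  rcases isEmpty_or_nonempty (Fin l) with hl | ⟨⟨s₀⟩⟩
  · exact ⟨0, (1 - ε) * (hi - lo), by simp, fun s => (hl.false s).elim⟩
  refine ⟨lo + ε * (𝒮.density a m i s₀ - lo), hi - ε * (hi - 𝒮.density a m i s₀), by linarith,
    fun j => ?_⟩
  have hw : ∀ s, 0 ≤ 𝒮.protoVol s * 𝒮.density (shift m a) M s j := fun s =>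
    mul_nonneg (protoVol_pos s).le (density_nonneg _ _ _ _)
  have h1 := sum_protoVol_mul_density (𝒮 := 𝒮) (shift m a) M j
  rw [density_add]
  constructor
  · have h2 : ∑ s, (𝒮.density a m i s - lo) * (𝒮.protoVol s * 𝒮.density (shift m a) M s j) =
        (∑ s, 𝒮.density a m i s * (𝒮.protoVol s * 𝒮.density (shift m a) M s j)) - lo := by
      simp only [sub_mul, Finset.sum_sub_distrib, ← Finset.mul_sum, h1, mul_one]
    have h3 : (𝒮.density a m i s₀ - lo) * (𝒮.protoVol s₀ * 𝒮.density (shift m a) M s₀ j) ≤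
        ∑ s, (𝒮.density a m i s - lo) * (𝒮.protoVol s * 𝒮.density (shift m a) M s j) :=
      Finset.single_le_sum (f := fun s => (𝒮.density a m i s - lo) *
        (𝒮.protoVol s * 𝒮.density (shift m a) M s j))
        (fun s _ => mul_nonneg (sub_nonneg.2 (h s).1) (hw s)) (Finset.mem_univ s₀)
    have h4 := mul_le_mul_of_nonneg_left (hε (shift m a) s₀ j) (sub_nonneg.2 (h s₀).1)
    linarith
  · have h2 : ∑ s, (hi - 𝒮.density a m i s) * (𝒮.protoVol s * 𝒮.density (shift m a) M s j) =
        hi - ∑ s, 𝒮.density a m i s * (𝒮.protoVol s * 𝒮.density (shift m a) M s j) := by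
      simp only [sub_mul, Finset.sum_sub_distrib, ← Finset.mul_sum, h1, mul_one]
    have h3 : (hi - 𝒮.density a m i s₀) * (𝒮.protoVol s₀ * 𝒮.density (shift m a) M s₀ j) ≤
        ∑ s, (hi - 𝒮.density a m i s) * (𝒮.protoVol s * 𝒮.density (shift m a) M s j) :=
      Finset.single_le_sum (f := fun s => (hi - 𝒮.density a m i s) *
        (𝒮.protoVol s * 𝒮.density (shift m a) M s j))
        (fun s _ => mul_nonneg (sub_nonneg.2 (h s).2) (hw s)) (Finset.mem_univ s₀)
    have h4 := mul_le_mul_of_nonneg_left (hε (shift m a) s₀ j) (sub_nonneg.2 (h s₀).2)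
    linarith

theorem exists_density_Icc [Nonempty J] {M : ℕ} {ε : ℝ} (hε1 : ε < 1)
    (hε : ∀ a s j, ε ≤ 𝒮.protoVol s * 𝒮.density a M s j) (a : ℕ → J) (i : Fin l) (k : ℕ) :
    ∃ lo hi, hi - lo ≤ (1 - ε) ^ k * (𝒮.protoVol i)⁻¹ ∧
      ∀ n ≥ k * M, ∀ j, 𝒮.density a n i j ∈ Icc lo hi := by
  suffices h : ∃ lo hi, hi - lo ≤ (1 - ε) ^ k * (𝒮.protoVol i)⁻¹ ∧
      ∀ j, 𝒮.density a (k * M) i j ∈ Icc lo hi by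
    obtain ⟨lo, hi, h1, h2⟩ := h
    refine ⟨lo, hi, h1, fun n hn => ?_⟩
    obtain ⟨m, rfl⟩ := Nat.exists_eq_add_of_le hn
    exact density_mem_Icc_add h2 m
  induction k with
  | zero =>
    exact ⟨0, (𝒮.protoVol i)⁻¹, by simp, fun j => ⟨density_nonneg _ _ _ _, density_le _ _ _ _⟩⟩
  | succ k ih =>
    obtain ⟨lo, hi, h1, h2⟩ := ih
    obtain ⟨lo', hi', h3, h4⟩ := density_contract hε h2
    refine ⟨lo', hi', h3.trans ?_, ?_⟩
    · rw [pow_succ', mul_assoc]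
      exact mul_le_mul_of_nonneg_left h1 (by linarith)
    · rwa [Nat.succ_mul]

theorem exists_tileFreq [Nonempty J] [Nonempty (Fin l)] {M : ℕ} {ε : ℝ}
    (hε0 : 0 < ε) (hε1 : ε < 1) (hε : ∀ a s j, ε ≤ 𝒮.protoVol s * 𝒮.density a M s j)
    (a : ℕ → J) (i : Fin l) : ∃ c, 𝒮.HasTileFreq a i c ∧
      ∀ k, ∀ n ≥ k * M, ∀ j, |𝒮.density a n i j - c| ≤ (1 - ε) ^ k * (𝒮.protoVol i)⁻¹ := by
  have h := exists_density_Icc hε1 hε a i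
  have hdist : ∀ k, ∀ n ≥ k * M, ∀ m ≥ k * M, ∀ j j',
      |𝒮.density a n i j - 𝒮.density a m i j'| ≤ (1 - ε) ^ k * (𝒮.protoVol i)⁻¹ := by
    intro k n hn m hm j j'
    obtain ⟨lo, hi, h1, h2⟩ := h k
    have hn' := h2 n hn j
    have hm' := h2 m hm j'
    rw [abs_le]
    constructor <;> linarith [hn'.1, hn'.2, hm'.1, hm'.2]
  have hlim : Tendsto (fun k : ℕ => (1 - ε) ^ k * (𝒮.protoVol i)⁻¹) atTop (𝓝 0) := by
    have := (tendsto_pow_atTop_nhds_zero_of_lt_one (by linarith : 0 ≤ 1 - ε)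
      (by linarith)).mul_const (𝒮.protoVol i)⁻¹
    rwa [zero_mul] at this
  obtain ⟨j₀⟩ := ‹Nonempty (Fin l)›
  have hcauchy : CauchySeq fun n => 𝒮.density a n i j₀ := by
    rw [Metric.cauchySeq_iff']
    intro δ hδ
    obtain ⟨k, hk⟩ := (hlim.eventually_lt_const hδ).exists
    exact ⟨k * M, fun n hn => (hdist k n hn _ le_rfl j₀ j₀).trans_lt hk⟩
  obtain ⟨c, hc⟩ := cauchySeq_tendsto_of_complete hcauchy
  have hbound : ∀ k, ∀ n ≥ k * M, ∀ j,
      |𝒮.density a n i j - c| ≤ (1 - ε) ^ k * (𝒮.protoVol i)⁻¹ := by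
    intro k n hn j
    refine le_of_tendsto ((tendsto_const_nhds.sub hc).abs) ?_
    filter_upwards [eventually_ge_atTop (k * M)] with m hm
    exact hdist k n hn m hm j j₀
  refine ⟨c, hasTileFreq_iff.2 fun j => ?_, hbound⟩
  rw [Metric.tendsto_atTop]
  intro δ hδ
  obtain ⟨k, hk⟩ := (hlim.eventually_lt_const hδ).exists
  exact ⟨k * M, fun n hn => (hbound k n hn j).trans_lt hk⟩

theorem eq_of_lt_firstDiff {a b : ℕ → J} {k : ℕ} (h : k < PiNat.firstDiff a b) : a k = b k :=
  PiNat.apply_eq_of_lt_firstDiff h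

theorem exists_isTileFreqRate [Finite J] [Nonempty J] [Nonempty (Fin l)] (h𝒮 : 𝒮.IsPrimitive) :
    ∃ θ, 𝒮.IsTileFreqRate θ := by
  obtain ⟨M, hM0, hM⟩ := h𝒮.exists_uniform
  obtain ⟨ε, ⟨hε0, hε1⟩, hε⟩ := exists_weight_lower_bound hM
  choose c hfreq hc using exists_tileFreq (𝒮 := 𝒮) hε0 hε1 hε
  have hMpos : (0 : ℝ) < M := by exact_mod_cast Nat.pos_of_ne_zero hM0
  set κ := 1 - ε with hκ
  have hκ0 : 0 < κ := by linarith
  have hκ1 : κ < 1 := by linarith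
  set V := ∑ i, (𝒮.protoVol i)⁻¹ with hV
  have hVi : ∀ i, (𝒮.protoVol i)⁻¹ ≤ V := fun i =>
    Finset.single_le_sum (f := fun i => (𝒮.protoVol i)⁻¹)
      (fun i _ => (inv_pos.2 (protoVol_pos i)).le) (Finset.mem_univ i)
  have hVpos : 0 < V := (inv_pos.2 (protoVol_pos (Classical.arbitrary _))).trans_le
    (hVi (Classical.arbitrary _))
  have hθ0 : 0 < κ ^ (1 / (M : ℝ)) := Real.rpow_pos_of_pos hκ0 _
  have hθ1 : κ ^ (1 / (M : ℝ)) < 1 := Real.rpow_lt_one hκ0.le hκ1 (by positivity)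
  -- One contraction by `κ` happens every `M` letters. In the constant, `2` counts the two
  -- sequences, `V` bounds the initial oscillation, and `κ⁻¹` pays for rounding the level down to a
  -- multiple of `M`.
  refine ⟨κ ^ (1 / (M : ℝ)), hθ0, hθ1, c, hfreq, 2 * V * κ⁻¹,
    by positivity, fun δ hδ a b hab i => ?_⟩
  by_cases hne : a = b
  · rw [hne, sub_self, abs_zero]
    positivity
  rw [seqDist, if_neg hne] at hab
  set n := PiNat.firstDiff a b with hn
  have hδn : 1 / δ < (n : ℝ) + 1 := by
    rwa [one_div_lt hδ (by positivity)]
  have h1 : 𝒮.density a n = 𝒮.density b n := density_congr fun k hk => eq_of_lt_firstDiff hk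
  have h2 : n / M * M ≤ n := Nat.div_mul_le_self n M
  have h3 := hc a i (n / M) n h2 (Classical.arbitrary _)
  have h4 := hc b i (n / M) n h2 (Classical.arbitrary _)
  rw [h1] at h3
  have h5 : |c a i - c b i| ≤ 2 * (κ ^ (n / M) * (𝒮.protoVol i)⁻¹) := by
    rw [abs_le] at h3 h4 ⊢
    constructor <;> linarith [h3.1, h3.2, h4.1, h4.2]
  have h6 : κ ^ (n / M) ≤ κ⁻¹ * (κ ^ (1 / (M : ℝ))) ^ ((n : ℝ) + 1) := by
    rw [← Real.rpow_mul hκ0.le, ← Real.rpow_natCast, ← Real.rpow_neg_one κ, ← Real.rpow_add hκ0]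
    refine Real.rpow_le_rpow_of_exponent_ge hκ0 hκ1.le ?_
    have h7 : n + 1 ≤ M * (n / M + 1) := Nat.lt_mul_div_succ n (Nat.pos_of_ne_zero hM0)
    have h8 : (n : ℝ) + 1 ≤ M * (((n / M : ℕ) : ℝ) + 1) := by exact_mod_cast h7
    have h9 : 1 / (M : ℝ) * ((n : ℝ) + 1) ≤ ((n / M : ℕ) : ℝ) + 1 := by
      rw [one_div, inv_mul_le_iff₀ hMpos]
      exact h8
    linarith
  calc |c a i - c b i| ≤ 2 * (κ ^ (n / M) * (𝒮.protoVol i)⁻¹) := h5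
    _ ≤ 2 * (κ⁻¹ * (κ ^ (1 / (M : ℝ))) ^ ((n : ℝ) + 1) * V) := by
        have := hVi i
        have := (inv_pos.2 (protoVol_pos (𝒮 := 𝒮) i)).le
        gcongr
    _ = 2 * V * κ⁻¹ * (κ ^ (1 / (M : ℝ))) ^ ((n : ℝ) + 1) := by ring
    _ < _ := by
        refine mul_lt_mul_of_pos_left ?_ (by positivity)
        exact Real.rpow_lt_rpow_of_exponent_gt hθ0 hθ1 hδn

/-! ### The smallest dilatation factor and the size of `θ₀`. -/

theorem one_lt_minLam [Finite J] [Nonempty J] : 1 < 𝒮.minLam := by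
  obtain ⟨j, hj⟩ := exists_eq_ciInf_of_finite (f := 𝒮.lam)
  rw [minLam, ← hj]
  exact (𝒮.isSubstitution j).one_lt

theorem minLam_pow_le_scale [Finite J] [Nonempty J] (a : ℕ → J) (n : ℕ) :
    𝒮.minLam ^ n ≤ 𝒮.scale a n := by
  have h := Finset.prod_le_prod (s := Finset.range n) (f := fun _ => 𝒮.minLam)
    (g := fun k => 𝒮.lam (a k)) (fun _ _ => (zero_lt_one.trans one_lt_minLam).le)
    (fun k _ => ciInf_le (finite_range _).bddBelow (a k))
  rwa [Finset.prod_const, Finset.card_range] at h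

section Theta

variable [Finite J] [Nonempty J] [Nonempty (Fin l)] {θ : ℝ}

/-- With `x = 𝒟 - d` and `y = log_λ θ`, both negative, `θ₀` equals `θ ^ (x / (x + y))` and also `λ ^
(x * y / (x + y))`; the fractions `x / (x + y)` and `y / (x + y)` lie in `(0, 1)`. The strict
inequalities provide the room used later. -/
theorem theta0_bounds (hd : 0 < d) (h0 : 0 < θ) (h1 : θ < 1) :
    𝒮.theta0 θ < 1 ∧ θ < 𝒮.theta0 θ ∧ 𝒮.minLam ^ (𝒮.boundaryDim - d) < 𝒮.theta0 θ := by
  have hD : 𝒮.boundaryDim - d < 0 := sub_neg.2 (boundaryDim_lt hd)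
  have hlam := one_lt_minLam (𝒮 := 𝒮)
  have hlog : Real.logb 𝒮.minLam θ < 0 := Real.logb_neg hlam h0 h1
  set x := 𝒮.boundaryDim - d with hx
  set y := Real.logb 𝒮.minLam θ with hy
  have hxy : x + y < 0 := by linarith
  refine ⟨Real.rpow_lt_one h0.le h1 (div_pos_of_neg_of_neg hD hxy), ?_, ?_⟩
  · conv_lhs => rw [← Real.rpow_one θ]
    refine Real.rpow_lt_rpow_of_exponent_gt h0 h1 ?_
    rw [← hx, ← hy, div_lt_one_of_neg hxy]
    linarith
  · rw [theta0, ← hx, ← hy]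
    have hθ : θ = 𝒮.minLam ^ y :=
      (Real.rpow_logb (zero_lt_one.trans hlam) hlam.ne' h0).symm
    rw [hθ, ← Real.rpow_mul (zero_lt_one.trans hlam).le]
    refine Real.rpow_lt_rpow_of_exponent_lt hlam ?_
    have : y / (x + y) < 1 := by
      rw [div_lt_one_of_neg hxy]
      linarith
    calc x = x * 1 := (mul_one x).symm
      _ < x * (y / (x + y)) := mul_lt_mul_of_neg_left this hD
      _ = y * (x / (x + y)) := by ring

theorem exists_exponent (hd : 0 < d) (h0 : 0 < θ) (h1 : θ < 1) :
    ∃ β, 𝒮.boundaryDim < β ∧ β < d ∧ 𝒮.minLam ^ (β - d) < 𝒮.theta0 θ := by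
  have hlam := zero_lt_one.trans (one_lt_minLam (𝒮 := 𝒮))
  have hcont : Tendsto (fun β : ℝ => 𝒮.minLam ^ (β - d)) (𝓝[>] 𝒮.boundaryDim)
      (𝓝 (𝒮.minLam ^ (𝒮.boundaryDim - d))) := by
    have : Continuous fun β : ℝ => 𝒮.minLam ^ (β - d) :=
      (Real.continuous_const_rpow hlam.ne').comp (continuous_sub_right (d : ℝ))
    exact (this.tendsto _).mono_left nhdsWithin_le_nhds
  obtain ⟨β, h, hβ⟩ := ((hcont.eventually_lt_const (theta0_bounds hd h0 h1).2.2).and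
    (Ioo_mem_nhdsGT (boundaryDim_lt hd))).exists
  exact ⟨β, hβ.1, hβ.2, h⟩

end Theta

end MultiSubstitution

end MultiTiling

/-! ### Frequencies of local rules and their dependence on the sequence. -/

namespace MultiTiling

variable {d : ℕ}

/-- `W` assigns to each collection a set of positions, equivariantly under translations, such that
`t ∈ W x` depends only on the part of `x` near `t`, in the closed ball of radius `R`. -/
structure IsLocalRule (X : Set (Collection d)) (R : ℝ) (W : Collection d → Set (Space d)) :
    Prop where
  vadd : ∀ (t : Space d) (p : Collection d), W (t +ᵥ p) = t +ᵥ W p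
  measurableSet : ∀ p ∈ patchesOf X, MeasurableSet (W p)
  mem_iff : ∀ y p : Collection d, IsPatch y → p ⊆ y → ∀ t : Space d,
    Metric.closedBall t R ⊆ supp p → (t ∈ W y ↔ t ∈ W p)

theorem smul_vadd_set (c : ℝ) (t : Space d) (E : Set (Space d)) :
    c • (t +ᵥ E) = (c • t) +ᵥ c • E := by
  simp only [← Set.image_smul, ← Set.image_vadd, image_image, vadd_eq_add, smul_add]

theorem abs_volume_sub_le {A B N : Set (Space d)} (hA : volume A ≠ ⊤) (hB : volume B ≠ ⊤)
    (hN : volume N ≠ ⊤) (hAB : A ⊆ B ∪ N) (hBA : B ⊆ A ∪ N) :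
    |volume.real A - volume.real B| ≤ volume.real N := by
  have h1 := (measureReal_mono hAB (measure_union_ne_top hB hN)).trans (measureReal_union_le B N)
  have h2 := (measureReal_mono hBA (measure_union_ne_top hA hN)).trans (measureReal_union_le A N)
  rw [abs_le]
  constructor <;> linarith

namespace MultiSubstitution

variable {l : ℕ} {J : Type*} {𝒮 : MultiSubstitution d l J}
  {W : Collection d → Set (Space d)} {R : ℝ}

variable (𝒮 W) in
/-- The volume of the positions chosen by `W` in the supertile `S_a^m(D_i)`. -/
noncomputable def ruleVol (a : ℕ → J) (m : ℕ) (i : Fin l) : ℝ :=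
  volume.real (W (𝒮.iter a m {𝒮.proto i}) ∩ supp (𝒮.iter a m {𝒮.proto i}))

/-- Farther than `R` from the boundary of a supertile, the rule sees that supertile alone, so the
discrepancy is confined to the boundary layers. The larger patch `p` matters because later `q`
consists only of the supertiles that meet a ball. -/
theorem abs_volume_rule_sub_le [Nonempty J] (hR : 0 < R) (hW : IsLocalRule 𝒮.X R W) (a : ℕ → J)
    (m : ℕ) {p q : Collection d} (hp : p ∈ patchesOf 𝒮.X) (hq : q ⊆ p) :
    |volume.real (W (𝒮.iter a m p) ∩ supp (𝒮.iter a m q)) -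
      ∑ i, (tileCount (𝒮.proto i) q : ℝ) * 𝒮.ruleVol W a m i| ≤
    ∑ i, (tileCount (𝒮.proto i) q : ℝ) * boundaryVol R (𝒮.scale a m • 𝒮.proto i) := by
  have hq' := mem_patchesOf_mono hp hq
  have hc := 𝒮.scale_pos a m
  have htile : ∀ E ∈ hq'.1.toFinset, E ∈ tilesOf 𝒮.X := fun E hE =>
    mem_tilesOf hq' (hq'.1.mem_toFinset.1 hE)
  have hmeas := hW.measurableSet _ (iter_mem_patchesOf a m hp)
  have h1 : volume.real (W (𝒮.iter a m p) ∩ supp (𝒮.iter a m q)) =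
      ∑ E ∈ hq'.1.toFinset, volume.real (W (𝒮.iter a m p) ∩ 𝒮.scale a m • E) := by
    rw [supp_iter a m hq', supp, sUnion_eq_biUnion, smul_set_iUnion₂,
      ← volume_inter_biUnion _ _ _ _ _ hmeas]
    · simp only [Finite.mem_toFinset]
    · exact fun E hE => (isTile_of_mem (htile E hE)).1.smul _
    · intro E hE
      rw [frontier_smul_pos hc, Measure.addHaar_smul, volume_frontier (htile E hE), mul_zero]
    · exact fun E hE F hF hne => disjoint_interior_smul ((isPatch_of_mem hq').2 E
        (hq'.1.mem_toFinset.1 hE) F (hq'.1.mem_toFinset.1 hF) hne) hc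
  have hsupp : ∀ E ∈ tilesOf 𝒮.X, supp (𝒮.iter a m {E}) = 𝒮.scale a m • E := fun E hE => by
    rw [supp_iter a m (singleton_mem hE), supp_singleton]
  have h2 : ∑ E ∈ hq'.1.toFinset, volume.real (W (𝒮.iter a m {E}) ∩ 𝒮.scale a m • E) =
      ∑ i, (tileCount (𝒮.proto i) q : ℝ) * 𝒮.ruleVol W a m i := by
    rw [sum_tiles hq']
    · refine Finset.sum_congr rfl fun i _ => ?_
      rw [ruleVol, hsupp _ (𝒮.proto_mem i)]
    · intro i t
      have h := iter_vadd a m (singleton_mem (𝒮.proto_mem i)) t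
      rw [vadd_set_singleton] at h
      rw [h, hW.vadd, smul_vadd_set, ← vadd_set_inter, volume_real_vadd]
  have h3 : ∑ E ∈ hq'.1.toFinset, boundaryVol R (𝒮.scale a m • E) =
      ∑ i, (tileCount (𝒮.proto i) q : ℝ) * boundaryVol R (𝒮.scale a m • 𝒮.proto i) := by
    refine sum_tiles hq' (fun E => boundaryVol R (𝒮.scale a m • E)) fun i t => ?_
    rw [smul_vadd_set, boundaryVol_vadd]
  rw [h1, ← h2, ← h3, ← Finset.sum_sub_distrib]
  refine (Finset.abs_sum_le_sum_abs _ _).trans (Finset.sum_le_sum fun E hE => ?_)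
  have hE' := htile E hE
  have hEc : IsCompact (𝒮.scale a m • E) := (isTile_of_mem hE').1.smul _
  have hfin : ∀ B : Set (Space d), volume (B ∩ 𝒮.scale a m • E) ≠ ⊤ := fun B =>
    ((measure_mono inter_subset_right).trans_lt hEc.measure_lt_top).ne
  have hsub : 𝒮.iter a m {E} ⊆ 𝒮.iter a m p :=
    iter_mono a m (singleton_subset_iff.2 (hq (hq'.1.mem_toFinset.1 hE)))
  have hmem : ∀ t ∈ 𝒮.scale a m • E, t ∉ Metric.cthickening R (frontier (𝒮.scale a m • E)) →
      (t ∈ W (𝒮.iter a m p) ↔ t ∈ W (𝒮.iter a m {E})) := fun t ht htn =>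
    hW.mem_iff _ _ (isPatch_of_mem (iter_mem_patchesOf a m hp)) hsub t (by
      rw [hsupp E hE']
      exact (closedBall_subset_interior hR.le ht htn).trans interior_subset)
  refine abs_volume_sub_le (hfin _) (hfin _) ?_ ?_ ?_
  · exact (hEc.of_isClosed_subset isClosed_frontier
      hEc.isClosed.frontier_subset).cthickening.measure_lt_top.ne
  · rintro t ⟨ht, htE⟩
    by_cases htn : t ∈ Metric.cthickening R (frontier (𝒮.scale a m • E))
    · exact Or.inr htn
    · exact Or.inl ⟨(hmem t htE htn).1 ht, htE⟩
  · rintro t ⟨ht, htE⟩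
    by_cases htn : t ∈ Metric.cthickening R (frontier (𝒮.scale a m • E))
    · exact Or.inr htn
    · exact Or.inl ⟨(hmem t htE htn).2 ht, htE⟩

variable (𝒮 R) in
/-- The boundary layers of width `R` of the supertiles of level `m` have relative volume at most
`K * q ^ m`. -/
def BoundaryDecay (K q : ℝ) : Prop :=
  ∀ (a : ℕ → J) (m : ℕ) (i : Fin l), boundaryVol R (𝒮.scale a m • 𝒮.proto i) ≤
    K * q ^ m * (𝒮.scale a m ^ d * 𝒮.protoVol i)

/-- Rescaling turns a layer of width `R` about a supertile into one of width `R / scale` about a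
prototile, where the power law for exponent `d - β` applies. -/
theorem exists_boundaryDecay [Finite J] [Nonempty J] {β : ℝ} (hβ : 𝒮.boundaryDim < β)
    (hβd : β < d) (hR : 0 < R) : ∃ K ≥ 0, 𝒮.BoundaryDecay R K (𝒮.minLam ^ (β - d)) := by
  obtain ⟨C, hC⟩ := boundaryVol_le_rpow hβ hβd R hR
  refine ⟨∑ i, |C| / 𝒮.protoVol i,
    Finset.sum_nonneg fun i _ => div_nonneg (abs_nonneg _) (protoVol_pos i).le, fun a m i => ?_⟩
  have hlam := zero_lt_one.trans (one_lt_minLam (𝒮 := 𝒮))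
  have hs := 𝒮.scale_pos a m
  have hle := minLam_pow_le_scale (𝒮 := 𝒮) a m
  have h1 : 1 ≤ 𝒮.scale a m := (one_le_pow₀ one_lt_minLam.le).trans hle
  have h2 : ((𝒮.scale a m)⁻¹) ^ ((d : ℝ) - β) ≤ (𝒮.minLam ^ (β - d)) ^ m := by
    calc ((𝒮.scale a m)⁻¹) ^ ((d : ℝ) - β) ≤ ((𝒮.minLam ^ m)⁻¹) ^ ((d : ℝ) - β) :=
          Real.rpow_le_rpow (inv_pos.2 hs).le (inv_anti₀ (pow_pos hlam m) hle) (by linarith)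
      _ = _ := by
          rw [← Real.rpow_natCast, ← Real.rpow_natCast, ← Real.rpow_neg hlam.le,
            ← Real.rpow_mul hlam.le, ← Real.rpow_mul hlam.le]
          congr 1
          ring
  have h3 := hC i (𝒮.scale a m)⁻¹ ⟨inv_pos.2 hs, inv_le_one_of_one_le₀ h1⟩
  have h4 : boundaryVol R (𝒮.scale a m • 𝒮.proto i) =
      𝒮.scale a m ^ d * boundaryVol (R * (𝒮.scale a m)⁻¹) (𝒮.proto i) := by
    rw [← boundaryVol_smul hs, mul_comm R, mul_inv_cancel_left₀ hs.ne']
  have h5 : |C| / 𝒮.protoVol i ≤ ∑ i, |C| / 𝒮.protoVol i :=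
    Finset.single_le_sum (f := fun i => |C| / 𝒮.protoVol i)
      (fun i _ => div_nonneg (abs_nonneg _) (protoVol_pos i).le) (Finset.mem_univ i)
  have h6 : (0 : ℝ) ≤ (𝒮.minLam ^ (β - d)) ^ m := pow_nonneg (Real.rpow_nonneg hlam.le _) m
  have hv := protoVol_pos (𝒮 := 𝒮) i
  rw [h4]
  calc 𝒮.scale a m ^ d * boundaryVol (R * (𝒮.scale a m)⁻¹) (𝒮.proto i)
      ≤ 𝒮.scale a m ^ d * (|C| * (𝒮.minLam ^ (β - d)) ^ m) := by
        refine mul_le_mul_of_nonneg_left (h3.trans ?_) (pow_pos hs d).le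
        exact mul_le_mul (le_abs_self C) h2 (Real.rpow_nonneg (inv_pos.2 hs).le _) (abs_nonneg C)
    _ = |C| / 𝒮.protoVol i * (𝒮.minLam ^ (β - d)) ^ m * (𝒮.scale a m ^ d * 𝒮.protoVol i) := by
        field_simp
    _ ≤ _ := by gcongr

section Rule

variable {K q : ℝ} (hR : 0 < R) (hW : IsLocalRule 𝒮.X R W)
  (hB : 𝒮.BoundaryDecay R K q)

include hR hW hB in
theorem abs_volume_rule_sub_le_decay [Nonempty J] (a : ℕ → J) (m : ℕ) {p r : Collection d}
    (hp : p ∈ patchesOf 𝒮.X) (hr : r ⊆ p) :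
    |volume.real (W (𝒮.iter a m p) ∩ supp (𝒮.iter a m r)) -
      ∑ i, (tileCount (𝒮.proto i) r : ℝ) * 𝒮.ruleVol W a m i| ≤
    K * q ^ m * (𝒮.scale a m ^ d * volume.real (supp r)) := by
  refine (abs_volume_rule_sub_le hR hW a m hp hr).trans ?_
  rw [volume_supp (mem_patchesOf_mono hp hr), Finset.mul_sum, Finset.mul_sum]
  refine Finset.sum_le_sum fun i _ => ?_
  refine (mul_le_mul_of_nonneg_left (hB a m i) (Nat.cast_nonneg _)).trans_eq ?_
  ring

variable (𝒮 W) in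
/-- The proportion of the supertile `S_a^m(D_j)` covered by the positions chosen by `W`. -/
noncomputable def ruleDensity (a : ℕ → J) (m : ℕ) (j : Fin l) : ℝ :=
  𝒮.ruleVol W a m j / (𝒮.scale a m ^ d * 𝒮.protoVol j)

theorem ruleVol_eq (a : ℕ → J) (m : ℕ) (j : Fin l) :
    𝒮.ruleVol W a m j = 𝒮.scale a m ^ d * (𝒮.protoVol j * 𝒮.ruleDensity W a m j) := by
  have := (density_denom_pos (𝒮 := 𝒮) a m j).ne'
  rw [ruleDensity, ← mul_assoc, mul_div_cancel₀ _ this]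

theorem ruleDensity_mem_Icc (a : ℕ → J) (m : ℕ) (j : Fin l) :
    𝒮.ruleDensity W a m j ∈ Icc (0 : ℝ) 1 := by
  refine ⟨div_nonneg measureReal_nonneg (density_denom_pos a m j).le, ?_⟩
  have hp := singleton_mem (𝒮.proto_mem j)
  refine div_le_one_of_le₀ ?_ (density_denom_pos a m j).le
  refine (measureReal_mono inter_subset_right
    (isCompact_supp (iter_mem_patchesOf a m hp)).measure_lt_top.ne).trans_eq ?_
  rw [volume_supp_iter a m hp, supp_singleton, protoVol]

theorem ruleDensity_congr {a b : ℕ → J} {m : ℕ} (h : ∀ k < m, a k = b k) :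
    𝒮.ruleDensity W a m = 𝒮.ruleDensity W b m := by
  funext j
  rw [ruleDensity, ruleDensity, ruleVol, ruleVol, iter_congr h, scale_congr 𝒮 h]

include hR hW hB in
theorem abs_ruleDensity_sub_le [Nonempty J] (a : ℕ → J) (m n : ℕ) (j : Fin l) :
    |𝒮.ruleDensity W a (m + n) j - ∑ i, 𝒮.density (shift m a) n i j *
      (𝒮.protoVol i * 𝒮.ruleDensity W a m i)| ≤ K * q ^ m := by
  have hp0 := singleton_mem (𝒮.proto_mem j)
  have hp := iter_mem_patchesOf (shift m a) n hp0
  have h := abs_volume_rule_sub_le_decay hR hW hB a m hp subset_rfl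
  have hden := density_denom_pos (𝒮 := 𝒮) a (m + n) j
  rw [← iter_add, volume_supp_iter _ _ hp0, supp_singleton] at h
  have h1 : 𝒮.scale a m ^ d * (𝒮.scale (shift m a) n ^ d * volume.real (𝒮.proto j)) =
      𝒮.scale a (m + n) ^ d * 𝒮.protoVol j := by
    rw [scale_add, mul_pow, mul_assoc, protoVol]
  rw [h1, ← div_le_iff₀ hden] at h
  refine le_trans (le_of_eq ?_) h
  conv_rhs => rw [← abs_of_pos hden, ← abs_div, sub_div]
  congr 2
  rw [Finset.sum_div]
  refine Finset.sum_congr rfl fun i _ => ?_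
  rw [tileCount_iter_proto, ruleVol_eq, density, ← h1, ← protoVol]
  have h2 := (𝒮.scale_pos a m).ne'
  have h3 := (𝒮.scale_pos (shift m a) n).ne'
  have h4 := (protoVol_pos (𝒮 := 𝒮) j).ne'
  field_simp

/-- The approximation of level `m` to the frequency of `W`. -/
noncomputable def approxFreq (𝒮 : MultiSubstitution d l J) (W : Collection d → Set (Space d))
    (c : (ℕ → J) → Fin l → ℝ) (a : ℕ → J) (m : ℕ) : ℝ :=
  ∑ i, c (shift m a) i * (𝒮.protoVol i * 𝒮.ruleDensity W a m i)

variable {c : (ℕ → J) → Fin l → ℝ} (hc : ∀ a i, 𝒮.HasTileFreq a i (c a i))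

-- With `m` fixed and `n → ∞`, the tile densities of the shifted sequence converge to `c`. The rule
-- densities are thus eventually within about `K * q ^ m` of `approxFreq`, for every `j`; letting
-- `m` grow makes them Cauchy with a common limit.
include hR hW hB hc in
theorem exists_ruleFreq [Nonempty J] [Nonempty (Fin l)] (a : ℕ → J) (hq : 0 ≤ q) (hq1 : q < 1) :
    ∃ F, (∀ j, Tendsto (fun k => 𝒮.ruleDensity W a k j) atTop (𝓝 F)) ∧
      ∀ m, |F - approxFreq 𝒮 W c a m| ≤ K * q ^ m := by
  have hev : ∀ m j, ∀ δ > 0, ∀ᶠ k in atTop,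
      |𝒮.ruleDensity W a k j - approxFreq 𝒮 W c a m| ≤ K * q ^ m + δ := by
    intro m j δ hδ
    have hlim : Tendsto (fun n => ∑ i, 𝒮.density (shift m a) n i j *
        (𝒮.protoVol i * 𝒮.ruleDensity W a m i)) atTop (𝓝 (approxFreq 𝒮 W c a m)) :=
      tendsto_finsetSum _ fun i _ => (hasTileFreq_iff.1 (hc (shift m a) i) j).mul_const _
    obtain ⟨N, hN⟩ := (Metric.tendsto_atTop.1 hlim) δ hδ
    filter_upwards [eventually_ge_atTop (m + N)] with k hk
    obtain ⟨n, rfl⟩ := Nat.exists_eq_add_of_le (le_of_add_le_left hk)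
    have h1 := abs_ruleDensity_sub_le hR hW hB a m n j
    have h2 := hN n (by omega)
    rw [Real.dist_eq] at h2
    exact (abs_sub_le _ _ _).trans (add_le_add h1 h2.le)
  have hKq : Tendsto (fun m : ℕ => K * q ^ m) atTop (𝓝 0) := by
    have := (tendsto_pow_atTop_nhds_zero_of_lt_one hq hq1).const_mul K
    rwa [mul_zero] at this
  obtain ⟨j₀⟩ := ‹Nonempty (Fin l)›
  have hcauchy : CauchySeq fun k => 𝒮.ruleDensity W a k j₀ := by
    rw [Metric.cauchySeq_iff']
    intro ε hε
    obtain ⟨m, hm⟩ := (hKq.eventually_lt_const (by positivity : 0 < ε / 4)).exists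
    obtain ⟨N, hN⟩ := eventually_atTop.1 (hev m j₀ (ε / 8) (by positivity))
    refine ⟨N, fun n hn => ?_⟩
    have h1 := hN n hn
    have h2 := hN N le_rfl
    rw [Real.dist_eq]
    rw [abs_sub_comm] at h2
    linarith [abs_sub_le (𝒮.ruleDensity W a n j₀) (approxFreq 𝒮 W c a m) (𝒮.ruleDensity W a N j₀)]
  obtain ⟨F, hF⟩ := cauchySeq_tendsto_of_complete hcauchy
  have hFm : ∀ m, |F - approxFreq 𝒮 W c a m| ≤ K * q ^ m := by
    intro m
    refine le_of_forall_pos_le_add fun δ hδ => ?_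
    exact le_of_tendsto ((hF.sub_const _).abs) (hev m j₀ δ hδ)
  refine ⟨F, fun j => ?_, hFm⟩
  rw [Metric.tendsto_atTop]
  intro ε hε
  obtain ⟨m, hm⟩ := (hKq.eventually_lt_const (by positivity : 0 < ε / 4)).exists
  obtain ⟨N, hN⟩ := eventually_atTop.1 (hev m j (ε / 8) (by positivity))
  refine ⟨N, fun n hn => ?_⟩
  have h1 := hN n hn
  have h2 := hFm m
  rw [abs_sub_comm] at h2
  rw [Real.dist_eq]
  linarith [abs_sub_le (𝒮.ruleDensity W a n j) (approxFreq 𝒮 W c a m) F]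

include hc in
theorem tileFreq_eq_sum [Nonempty (Fin l)] (a : ℕ → J) (m : ℕ) (i : Fin l) :
    c a i = ∑ s, 𝒮.density a m i s * (𝒮.protoVol s * c (shift m a) s) := by
  have j := Classical.arbitrary (Fin l)
  have h1 : Tendsto (fun n => 𝒮.density a (m + n) i j) atTop (𝓝 (c a i)) := by
    simp only [add_comm m]
    exact (tendsto_add_atTop_iff_nat m).2 (hasTileFreq_iff.1 (hc a i) j)
  refine tendsto_nhds_unique h1 ?_
  simp only [density_add]
  exact tendsto_finsetSum _ fun s _ => (((hasTileFreq_iff.1 (hc (shift m a) s) j).const_mul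
    _).const_mul _)

-- The frequencies at level `m` are averages of those at level `m + 1`. The increment therefore
-- weights, by frequencies, the defects of additivity of `W`, each of size at most `K * q ^ m`.
include hc in
theorem approxFreq_succ_sub [Nonempty (Fin l)] (a : ℕ → J) (m : ℕ) :
    approxFreq 𝒮 W c a (m + 1) - approxFreq 𝒮 W c a m = ∑ j, c (shift (m + 1) a) j *
      (𝒮.protoVol j * (𝒮.ruleDensity W a (m + 1) j - ∑ i, 𝒮.density (shift m a) 1 i j *
        (𝒮.protoVol i * 𝒮.ruleDensity W a m i))) := by
  have h : approxFreq 𝒮 W c a m = ∑ j, c (shift (m + 1) a) j *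
      (𝒮.protoVol j * ∑ i, 𝒮.density (shift m a) 1 i j *
        (𝒮.protoVol i * 𝒮.ruleDensity W a m i)) := by
    rw [approxFreq]
    simp only [fun i => tileFreq_eq_sum hc (shift m a) 1 i, shift_shift, Finset.mul_sum,
      Finset.sum_mul]
    rw [Finset.sum_comm]
    refine Finset.sum_congr rfl fun j _ => Finset.sum_congr rfl fun i _ => ?_
    ring
  rw [h, approxFreq, ← Finset.sum_sub_distrib]
  exact Finset.sum_congr rfl fun j _ => by ring

-- While `a` and `b` agree, their defects coincide, and the increments differ only through the
-- frequencies of the shifted sequences. Step `m` contributes a multiple of `θ ^ (n - 1 - m) * q ^ m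
-- ≤ ρ ^ (n - 1)`, so `m` steps cost only the factor `1 + m * K`.
include hR hW hB hc in
theorem abs_approxFreq_sub_le [Nonempty J] [Nonempty (Fin l)] {C θ ρ : ℝ} (hK : 0 ≤ K) (hq : 0 ≤ q)
    (hC : 0 ≤ C) (hθ : 0 ≤ θ) (hθρ : θ ≤ ρ) (hqρ : q ≤ ρ) (hρ : ρ ≤ 1)
    (hrate : ∀ (n : ℕ) (a b : ℕ → J), (∀ k < n, a k = b k) → ∀ i, |c a i - c b i| ≤ C * θ ^ n)
    {n : ℕ} {a b : ℕ → J} (hab : ∀ k < n, a k = b k) (m : ℕ) (hm : m ≤ n) :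
    |approxFreq 𝒮 W c a m - approxFreq 𝒮 W c b m| ≤
      (∑ i, 𝒮.protoVol i) * C * (1 + m * K) * ρ ^ (n - 1) := by
  have hρ0 : 0 ≤ ρ := hq.trans hqρ
  induction m with
  | zero =>
    have h0 : 𝒮.ruleDensity W a 0 = 𝒮.ruleDensity W b 0 :=
      ruleDensity_congr fun k hk => absurd hk (Nat.not_lt_zero k)
    rw [approxFreq, approxFreq, ← Finset.sum_sub_distrib, shift_zero, shift_zero, h0]
    simp only [← sub_mul, Nat.cast_zero, zero_mul, add_zero, mul_one]
    refine (Finset.abs_sum_le_sum_abs _ _).trans ?_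
    rw [Finset.sum_mul, Finset.sum_mul]
    refine Finset.sum_le_sum fun i _ => ?_
    have hg := ruleDensity_mem_Icc (𝒮 := 𝒮) (W := W) b 0 i
    have hv := (protoVol_pos (𝒮 := 𝒮) i).le
    rw [abs_mul, abs_of_nonneg (mul_nonneg hv hg.1)]
    have h1 : |c a i - c b i| ≤ C * ρ ^ (n - 1) := by
      refine (hrate n a b hab i).trans (mul_le_mul_of_nonneg_left ?_ hC)
      exact (pow_le_pow_left₀ hθ hθρ n).trans (pow_le_pow_of_le_one hρ0 hρ (Nat.sub_le n 1))
    calc |c a i - c b i| * (𝒮.protoVol i * 𝒮.ruleDensity W b 0 i)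
        ≤ C * ρ ^ (n - 1) * (𝒮.protoVol i * 1) :=
          mul_le_mul h1 (mul_le_mul_of_nonneg_left hg.2 hv) (mul_nonneg hv hg.1) (by positivity)
      _ = _ := by ring
  | succ m ih =>
    have hab' : ∀ k < m, a k = b k := fun k hk => hab k (by omega)
    have hab'' : ∀ k < m + 1, a k = b k := fun k hk => hab k (by omega)
    have hshift : ∀ k < 1, shift m a k = shift m b k := fun k hk => hab (m + k) (by omega)
    have h1 := approxFreq_succ_sub (W := W) hc a m
    have h2 := approxFreq_succ_sub (W := W) hc b m
    rw [ruleDensity_congr hab', ruleDensity_congr hab'', density_congr hshift] at h1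
    have h3 : approxFreq 𝒮 W c a (m + 1) - approxFreq 𝒮 W c b (m + 1) =
        (approxFreq 𝒮 W c a m - approxFreq 𝒮 W c b m) +
        ∑ j, (c (shift (m + 1) a) j - c (shift (m + 1) b) j) *
          (𝒮.protoVol j * (𝒮.ruleDensity W b (m + 1) j - ∑ i, 𝒮.density (shift m b) 1 i j *
            (𝒮.protoVol i * 𝒮.ruleDensity W b m i))) := by
      simp only [sub_mul, Finset.sum_sub_distrib] at h1 h2 ⊢
      linarith
    have h4 : |∑ j, (c (shift (m + 1) a) j - c (shift (m + 1) b) j) *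
          (𝒮.protoVol j * (𝒮.ruleDensity W b (m + 1) j - ∑ i, 𝒮.density (shift m b) 1 i j *
            (𝒮.protoVol i * 𝒮.ruleDensity W b m i)))| ≤
        (∑ i, 𝒮.protoVol i) * C * K * ρ ^ (n - 1) := by
      refine (Finset.abs_sum_le_sum_abs _ _).trans ?_
      rw [Finset.sum_mul, Finset.sum_mul, Finset.sum_mul]
      refine Finset.sum_le_sum fun j _ => ?_
      have hv := (protoVol_pos (𝒮 := 𝒮) j).le
      rw [abs_mul, abs_mul, abs_of_nonneg hv]
      -- Removing `m + 1` letters leaves agreement on `n - 1 - m` letters, which is the source of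
      -- the exponent `n - 1`.
      have h5 := hrate (n - 1 - m) (shift (m + 1) a) (shift (m + 1) b)
        (fun k hk => hab (m + 1 + k) (by omega)) j
      have h6 := abs_ruleDensity_sub_le hR hW hB b m 1 j
      have h7 : θ ^ (n - 1 - m) * q ^ m ≤ ρ ^ (n - 1) := by
        calc θ ^ (n - 1 - m) * q ^ m ≤ ρ ^ (n - 1 - m) * ρ ^ m := by gcongr
          _ = ρ ^ (n - 1) := by rw [← pow_add]; congr 1; omega
      calc _ ≤ C * θ ^ (n - 1 - m) * (𝒮.protoVol j * (K * q ^ m)) := by gcongr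
        _ = 𝒮.protoVol j * C * K * (θ ^ (n - 1 - m) * q ^ m) := by ring
        _ ≤ _ := by gcongr
    rw [h3]
    refine (abs_add_le _ _).trans ((add_le_add (ih (by omega)) h4).trans_eq ?_)
    push_cast
    ring

end Rule

theorem IsTileFreqRate.exists_rate {θ : ℝ} (h : 𝒮.IsTileFreqRate θ) :
    ∃ c : (ℕ → J) → Fin l → ℝ, (∀ a i, 𝒮.HasTileFreq a i (c a i)) ∧
    ∃ C ≥ 0, ∀ (n : ℕ) (a b : ℕ → J), (∀ k < n, a k = b k) → ∀ i, |c a i - c b i| ≤ C * θ ^ n := by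
  obtain ⟨h0, h1, c, hc, C, hC, hrate⟩ := h
  refine ⟨c, hc, C, hC.le, fun n a b hab i => ?_⟩
  by_cases hne : a = b
  · rw [hne, sub_self, abs_zero]
    positivity
  have hle : n ≤ PiNat.firstDiff a b := by
    by_contra hlt
    exact PiNat.apply_firstDiff_ne hne (hab _ (not_le.1 hlt))
  have hseq : seqDist a b = 1 / ((PiNat.firstDiff a b : ℝ) + 1) := by rw [seqDist, if_neg hne]
  -- Agreement on `n` letters means distance below `1 / n`. For `n = 0` that bound is meaningless,
  -- and `δ = 2` exceeds every distance.
  rcases Nat.eq_zero_or_pos n with rfl | hn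
  · have hlt : seqDist a b < 2 := by
      rw [hseq]
      refine (div_le_one_of_le₀ ?_ (by positivity)).trans_lt one_lt_two
      linarith [(Nat.cast_nonneg (PiNat.firstDiff a b) : (0 : ℝ) ≤ _)]
    refine (hrate 2 two_pos a b hlt i).le.trans ?_
    rw [pow_zero]
    exact mul_le_mul_of_nonneg_left (Real.rpow_le_one h0.le h1.le (by norm_num)) hC.le
  · have hn' : (0 : ℝ) < n := by exact_mod_cast hn
    have hlt : seqDist a b < 1 / n := by
      rw [hseq]
      refine one_div_lt_one_div_of_lt hn' ?_
      have : (n : ℝ) ≤ PiNat.firstDiff a b := by exact_mod_cast hle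
      linarith
    have := (hrate (1 / n) (by positivity) a b hlt i).le
    rwa [one_div_one_div, Real.rpow_natCast] at this

theorem exists_mul_pow_le {ρ τ : ℝ} (hρ : 0 ≤ ρ) (h : ρ < τ) :
    ∃ C ≥ 0, ∀ n : ℕ, ((n : ℝ) + 1) * ρ ^ n ≤ C * τ ^ n := by
  have hτ : 0 < τ := hρ.trans_lt h
  have hx0 : 0 ≤ ρ / τ := div_nonneg hρ hτ.le
  have hx1 : ρ / τ < 1 := (div_lt_one hτ).2 h
  have hlim : Tendsto (fun n : ℕ => ((n : ℝ) + 1) * (ρ / τ) ^ n) atTop (𝓝 0) := by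
    have := (tendsto_self_mul_const_pow_of_lt_one hx0 hx1).add
      (tendsto_pow_atTop_nhds_zero_of_lt_one hx0 hx1)
    simpa [add_mul] using this
  obtain ⟨C, hC⟩ := hlim.bddAbove_range
  refine ⟨C, ?_, fun n => ?_⟩
  · exact le_trans (by positivity) (hC ⟨0, rfl⟩)
  · have := hC ⟨n, rfl⟩
    simp only [div_pow] at this
    rwa [mul_div_assoc', div_le_iff₀ (pow_pos hτ n)] at this

theorem exists_ruleFreq_rate [Finite J] [Nonempty J] [Nonempty (Fin l)] (hd : 0 < d) {θ : ℝ}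
    (hθ : 𝒮.IsTileFreqRate θ) (hR : 0 < R) (hW : IsLocalRule 𝒮.X R W) :
    ∃ F : (ℕ → J) → ℝ, ∃ K ≥ 0, ∃ q ∈ Ico (0 : ℝ) 1, 𝒮.BoundaryDecay R K q ∧
      (∀ a j, Tendsto (fun k => 𝒮.ruleDensity W a k j) atTop (𝓝 (F a))) ∧
      ∃ C ≥ 0, ∀ (n : ℕ) (a b : ℕ → J), (∀ k < n, a k = b k) →
        |F a - F b| ≤ C * 𝒮.theta0 θ ^ n := by
  have hθ0 := hθ.1
  have hθ1 := hθ.2.1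
  obtain ⟨c, hc, C, hC, hrate⟩ := hθ.exists_rate
  obtain ⟨ht1, ht2, -⟩ := theta0_bounds (𝒮 := 𝒮) hd hθ0 hθ1
  obtain ⟨β, hβ, hβd, hq⟩ := exists_exponent (𝒮 := 𝒮) hd hθ0 hθ1
  obtain ⟨K, hK, hB⟩ := exists_boundaryDecay hβ hβd hR
  set q := 𝒮.minLam ^ (β - d) with hqdef
  have hq0 : 0 < q := Real.rpow_pos_of_pos (zero_lt_one.trans one_lt_minLam) _
  choose F hF hFm using fun a => exists_ruleFreq hR hW hB hc a hq0.le (hq.trans ht1)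
  refine ⟨F, K, hK, q, ⟨hq0.le, hq.trans ht1⟩, hB, hF, ?_⟩
  set ρ := max θ q with hρ
  have hρ0 : 0 < ρ := hθ0.trans_le (le_max_left _ _)
  have hρt : ρ < 𝒮.theta0 θ := max_lt ht2 hq
  have hρ1 : ρ ≤ 1 := (hρt.trans ht1).le
  obtain ⟨C', hC', hpow⟩ := exists_mul_pow_le hρ0.le hρt
  set V := ∑ i, 𝒮.protoVol i with hV
  have hV0 : 0 ≤ V := Finset.sum_nonneg fun i _ => (protoVol_pos i).le
  refine ⟨(2 * K + V * C * (1 + K) * ρ⁻¹) * C', by positivity, fun n a b hab => ?_⟩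
  -- The level is taken equal to `n`, so the truncation error is `K * q ^ n` for each sequence.
  have h1 := abs_approxFreq_sub_le hR hW hB hc hK hq0.le hC hθ0.le (le_max_left θ q)
    (le_max_right θ q) hρ1 hrate hab n le_rfl
  have h2 := hFm a n
  have h3 := hFm b n
  have h4 : q ^ n ≤ ρ ^ n := pow_le_pow_left₀ hq0.le (le_max_right _ _) n
  -- At `n = 0` the truncated subtraction gives `ρ ^ 0`, and the bound holds because `ρ ≤ 1`.
  have h5 : ρ ^ (n - 1) ≤ ρ⁻¹ * ρ ^ n := by
    rcases Nat.eq_zero_or_pos n with rfl | hn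
    · simpa using (one_le_inv₀ hρ0).2 hρ1
    · rw [← Nat.sub_add_cancel hn, pow_succ, Nat.add_sub_cancel]
      field_simp
      exact le_rfl
  have hn0 : (0 : ℝ) ≤ n := Nat.cast_nonneg n
  have hρn : 0 ≤ ρ ^ n := by positivity
  have h6 : V * C * (1 + n * K) * ρ ^ (n - 1) ≤
      V * C * ((1 + K) * ((n : ℝ) + 1)) * (ρ⁻¹ * ρ ^ n) := by
    gcongr
    nlinarith
  have h7 : |F a - F b| ≤ 2 * (K * q ^ n) + V * C * (1 + n * K) * ρ ^ (n - 1) := by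
    rw [abs_le] at h1 h2 h3 ⊢
    constructor <;> linarith [h1.1, h1.2, h2.1, h2.2, h3.1, h3.2]
  calc |F a - F b| ≤ 2 * (K * q ^ n) + V * C * (1 + n * K) * ρ ^ (n - 1) := h7
    _ ≤ 2 * (K * (((n : ℝ) + 1) * ρ ^ n)) +
        V * C * ((1 + K) * ((n : ℝ) + 1)) * (ρ⁻¹ * ρ ^ n) := by
        refine add_le_add ?_ h6
        have : q ^ n ≤ ((n : ℝ) + 1) * ρ ^ n := h4.trans (le_mul_of_one_le_left hρn (by linarith))
        gcongr
    _ = (2 * K + V * C * (1 + K) * ρ⁻¹) * (((n : ℝ) + 1) * ρ ^ n) := by ring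
    _ ≤ (2 * K + V * C * (1 + K) * ρ⁻¹) * (C' * 𝒮.theta0 θ ^ n) :=
        mul_le_mul_of_nonneg_left (hpow n) (by positivity)
    _ = _ := by ring

end MultiSubstitution

end MultiTiling

/-! ### Averages of a local rule over large balls. -/

namespace MultiTiling

variable {d : ℕ}

namespace MultiSubstitution

variable {l : ℕ} {J : Type*} {𝒮 : MultiSubstitution d l J}
  {W : Collection d → Set (Space d)} {R : ℝ}

-- Packing: the tiles meeting the ball lie in a ball larger by their diameter, and their disjoint
-- interiors have volumes bounded below.
variable (𝒮) in
theorem exists_card_bound (r : ℝ) : ∃ N : ℕ, ∀ x ∈ 𝒮.X,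
    {E ∈ x | (E ∩ Metric.closedBall 0 r).Nonempty}.Finite ∧
      {E ∈ x | (E ∩ Metric.closedBall 0 r).Nonempty}.ncard ≤ N := by
  obtain ⟨M, hM, hdist⟩ := 𝒮.exists_dist_bound
  rcases isEmpty_or_nonempty (Fin l) with hl | hl
  · refine ⟨0, fun x hx => ?_⟩
    have : {E ∈ x | (E ∩ Metric.closedBall 0 r).Nonempty} = ∅ := by
      refine eq_empty_of_forall_notMem fun E hE => ?_
      obtain ⟨i, -⟩ := 𝒮.exists_proto E ⟨x, hx, hE.1⟩
      exact hl.false i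
    rw [this]
    simp
  obtain ⟨i₀, hi₀⟩ := Finite.exists_min fun i => volume.real (interior (𝒮.proto i))
  have hv0 : 0 < volume.real (interior (𝒮.proto i₀)) := (isTile_proto i₀).volume_interior_pos
  obtain ⟨N, hN⟩ := exists_nat_gt
    (volume.real (Metric.closedBall (0 : Space d) (r + M)) / volume.real (interior (𝒮.proto i₀)))
  rw [div_lt_iff₀ hv0] at hN
  refine ⟨N, fun x hx => ?_⟩
  have hcard : ∀ T : Finset (Set (Space d)),
      (T : Set (Set (Space d))) ⊆ {E ∈ x | (E ∩ Metric.closedBall 0 r).Nonempty} → T.card < N := by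
    intro T hT
    have hp : (T : Collection d) ∈ patchesOf 𝒮.X :=
      ⟨T.finite_toSet, x, hx, fun E hE => (hT hE).1⟩
    have hle := sum_interior_le hp
    have h1 : (T.card : ℝ) * volume.real (interior (𝒮.proto i₀)) ≤
        ∑ E ∈ hp.1.toFinset, volume.real (interior E) := by
      have h2 : ∀ E ∈ hp.1.toFinset,
          volume.real (interior (𝒮.proto i₀)) ≤ volume.real (interior E) := by
        intro E hE
        obtain ⟨i, t, rfl⟩ := 𝒮.exists_proto E (mem_tilesOf hp (hp.1.mem_toFinset.1 hE))
        rw [volume_interior_vadd]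
        exact hi₀ i
      have h3 := Finset.card_nsmul_le_sum _ _ _ h2
      have hT' : hp.1.toFinset.card = T.card := by rw [Finset.finite_toSet_toFinset]
      rwa [nsmul_eq_mul, hT'] at h3
    have h4 : interior (supp (T : Collection d)) ⊆ Metric.closedBall 0 (r + M) := by
      refine interior_subset.trans (sUnion_subset fun E hE z hz => ?_)
      obtain ⟨hEx, w, hwE, hw⟩ := hT hE
      have := hdist E ⟨x, hx, hEx⟩ z hz w hwE
      rw [Metric.mem_closedBall] at hw ⊢
      linarith [dist_triangle z w 0]
    have h5 := measureReal_mono (μ := volume) h4 Metric.isBounded_closedBall.measure_lt_top.ne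
    have h6 := lt_of_mul_lt_mul_right ((h1.trans (hle.trans h5)).trans_lt hN) hv0.le
    exact_mod_cast h6
  have hfin : {E ∈ x | (E ∩ Metric.closedBall 0 r).Nonempty}.Finite := by
    by_contra hinf
    obtain ⟨T, hT, hTc⟩ := Set.Infinite.exists_subset_card_eq hinf N
    exact (hcard T hT).ne hTc
  refine ⟨hfin, ?_⟩
  rw [ncard_eq_toFinset_card _ hfin]
  exact (hcard _ (by simp)).le

theorem closedBall_subset_supp {x : Collection d} (hx : x ∈ 𝒮.X) (r : ℝ) :
    Metric.closedBall 0 r ⊆ supp {E ∈ x | (E ∩ Metric.closedBall 0 r).Nonempty} := by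
  intro z hz
  obtain ⟨E, hE, hzE⟩ : z ∈ supp x := by
    rw [(𝒮.isTiling x hx).2]
    trivial
  exact ⟨E, ⟨hE, z, hzE, hz⟩, hzE⟩

theorem vadd_mem_tilingSpace {D : Set (Space d)} {a : ℕ → J} {x : Collection d}
    (hx : x ∈ 𝒮.tilingSpace D a) (t : Space d) : t +ᵥ x ∈ 𝒮.tilingSpace D a := by
  refine ⟨𝒮.translate_mem x hx.1 t, fun p hp hfin => ?_⟩
  have hp' : -t +ᵥ p ⊆ x := by rwa [vadd_subset_iff, neg_neg]
  obtain ⟨k, s, hs⟩ := hx.2 (-t +ᵥ p) hp' (by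
    rw [← Set.image_vadd]
    exact hfin.image _)
  exact ⟨k, s + -t, by rwa [← vadd_vadd]⟩

/-- The tiles within reach of the rule on the ball form a finite patch, which by definition of `X_a`
recurs in some `S_a^k(D)`; the rule reads the same there. -/
theorem exists_iter_volume_eq (hW : IsLocalRule 𝒮.X R W) {D : Set (Space d)}
    (hD : D ∈ tilesOf 𝒮.X) {a : ℕ → J} {x : Collection d} (hx : x ∈ 𝒮.tilingSpace D a)
    (hR : 0 < R) (r : ℝ) :
    ∃ (k : ℕ) (s : Space d), Metric.closedBall s r ⊆ supp (𝒮.iter a k {D}) ∧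
      volume.real (W x ∩ Metric.closedBall 0 r) =
        volume.real (W (𝒮.iter a k {D}) ∩ Metric.closedBall s r) := by
  obtain ⟨N, hN⟩ := 𝒮.exists_card_bound (r + R)
  obtain ⟨k, s, hs⟩ := hx.2 _ (sep_subset x _) (hN x hx.1).1
  set p := {E ∈ x | (E ∩ Metric.closedBall 0 (r + R)).Nonempty} with hp
  have hsub := closedBall_subset_supp hx.1 (r + R)
  have hball : s +ᵥ Metric.closedBall (0 : Space d) r = Metric.closedBall s r := by
    rw [Metric.vadd_closedBall, vadd_eq_add, add_zero]
  refine ⟨k, s, ?_, ?_⟩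
  · rw [← hball]
    refine subset_trans ?_ (supp_mono hs)
    rw [supp_vadd]
    exact vadd_set_mono ((Metric.closedBall_subset_closedBall (by linarith)).trans hsub)
  · rw [← volume_real_vadd s, vadd_set_inter, hball]
    congr 1
    have hloc : ∀ t ∈ Metric.closedBall (0 : Space d) r, Metric.closedBall t R ⊆ supp p := by
      intro t ht
      refine (Metric.closedBall_subset_closedBall' ?_).trans hsub
      rw [Metric.mem_closedBall] at ht
      linarith
    ext z
    rw [mem_inter_iff, mem_inter_iff]
    refine and_congr_left fun hz => ?_
    rw [← hball, mem_vadd_set_iff_neg_vadd_mem] at hz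
    rw [mem_vadd_set_iff_neg_vadd_mem,
      hW.mem_iff x p (𝒮.isTiling x hx.1).1 (sep_subset x _) _ (hloc _ hz),
      hW.mem_iff _ _ (isPatch_of_mem (iter_mem_patchesOf a k (singleton_mem hD))) hs z ?_,
      hW.vadd, mem_vadd_set_iff_neg_vadd_mem]
    rw [supp_vadd]
    have := vadd_set_mono (a := s) (hloc _ hz)
    rwa [Metric.vadd_closedBall, vadd_neg_vadd] at this

/-- The level-`m` supertiles meeting the ball have union `Y`, which contains the ball and lies in
the ball enlarged by a supertile diameter. On `Y` the rule has density within `ε` of `F`; what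
remains is bounded by the shell between the two balls. -/
theorem abs_volume_iter_sub_le [Nonempty J] (hR : 0 < R) (hW : IsLocalRule 𝒮.X R W) {K q : ℝ}
    (hB : 𝒮.BoundaryDecay R K q) {M : ℝ}
    (hM : ∀ E ∈ tilesOf 𝒮.X, ∀ x ∈ E, ∀ y ∈ E, dist x y ≤ M) {F : ℝ} (hF : F ∈ Icc (0 : ℝ) 1)
    (a : ℕ → J) (m : ℕ) {ε : ℝ} (hε : 0 ≤ ε) (hKq : K * q ^ m ≤ ε / 2)
    (hm : ∀ i, |𝒮.ruleDensity W a m i - F| ≤ ε / 2) {p : Collection d} (hp : p ∈ patchesOf 𝒮.X)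
    {s : Space d} {r : ℝ} (hs : Metric.closedBall s r ⊆ supp (𝒮.iter a m p)) :
    |volume.real (W (𝒮.iter a m p) ∩ Metric.closedBall s r) -
      F * volume.real (Metric.closedBall s r)| ≤
    ε * volume.real (Metric.closedBall s (r + 𝒮.scale a m * M)) +
      2 * (volume.real (Metric.closedBall s (r + 𝒮.scale a m * M)) -
        volume.real (Metric.closedBall s r)) := by
  have hc := 𝒮.scale_pos a m
  set B := Metric.closedBall s r with hBdef
  set B' := Metric.closedBall s (r + 𝒮.scale a m * M) with hB'def
  set G : Collection d := {E ∈ p | (𝒮.scale a m • E ∩ B).Nonempty} with hG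
  have hGp : G ⊆ p := sep_subset _ _
  have hG' := mem_patchesOf_mono hp hGp
  set Y := supp (𝒮.iter a m G) with hY
  have hYeq : Y = 𝒮.scale a m • supp G := supp_iter a m hG'
  have hBY : B ⊆ Y := by
    intro z hz
    have h1 := hs hz
    rw [supp_iter a m hp, mem_smul_set_iff_inv_smul_mem₀ hc.ne'] at h1
    obtain ⟨E, hE, hzE⟩ := h1
    rw [hYeq, mem_smul_set_iff_inv_smul_mem₀ hc.ne']
    exact ⟨E, ⟨hE, z, (mem_smul_set_iff_inv_smul_mem₀ hc.ne' _ _).2 hzE, hz⟩, hzE⟩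
  have hYB' : Y ⊆ B' := by
    intro z hz
    rw [hYeq, mem_smul_set_iff_inv_smul_mem₀ hc.ne'] at hz
    obtain ⟨E, ⟨hE, w, hwE, hw⟩, hzE⟩ := hz
    rw [mem_smul_set_iff_inv_smul_mem₀ hc.ne'] at hwE
    have h1 := hM E (mem_tilesOf hp hE) _ hzE _ hwE
    rw [dist_smul₀, norm_inv, Real.norm_of_nonneg hc.le, inv_mul_le_iff₀ hc] at h1
    rw [hBdef, Metric.mem_closedBall] at hw
    rw [hB'def, Metric.mem_closedBall]
    linarith [dist_triangle z w s]
  have hYc : IsCompact Y := isCompact_supp (iter_mem_patchesOf a m hG')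
  have hYtop : volume Y ≠ ⊤ := hYc.measure_lt_top.ne
  have hvolY : volume.real Y = 𝒮.scale a m ^ d * volume.real (supp G) := volume_supp_iter a m hG'
  have hBYle : volume.real B ≤ volume.real Y := measureReal_mono hBY hYtop
  have hYB'le : volume.real Y ≤ volume.real B' :=
    measureReal_mono hYB' Metric.isBounded_closedBall.measure_lt_top.ne
  have h1 : |volume.real (W (𝒮.iter a m p) ∩ Y) - F * volume.real Y| ≤ ε * volume.real Y := by
    have h2 := abs_volume_rule_sub_le_decay hR hW hB a m hp hGp
    rw [← hvolY] at h2
    have h3 : |∑ i, (tileCount (𝒮.proto i) G : ℝ) * 𝒮.ruleVol W a m i - F * volume.real Y| ≤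
        ε / 2 * volume.real Y := by
      rw [hvolY, volume_supp hG', Finset.mul_sum, Finset.mul_sum, Finset.mul_sum,
        ← Finset.sum_sub_distrib]
      refine (Finset.abs_sum_le_sum_abs _ _).trans (Finset.sum_le_sum fun i _ => ?_)
      have h4 : (tileCount (𝒮.proto i) G : ℝ) * 𝒮.ruleVol W a m i -
          F * (𝒮.scale a m ^ d * ((tileCount (𝒮.proto i) G : ℝ) * 𝒮.protoVol i)) =
          (𝒮.ruleDensity W a m i - F) *
            (𝒮.scale a m ^ d * ((tileCount (𝒮.proto i) G : ℝ) * 𝒮.protoVol i)) := by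
        rw [ruleVol_eq]
        ring
      have h5 : 0 ≤ 𝒮.scale a m ^ d * ((tileCount (𝒮.proto i) G : ℝ) * 𝒮.protoVol i) :=
        mul_nonneg (pow_pos hc d).le (mul_nonneg (Nat.cast_nonneg _) (protoVol_pos i).le)
      rw [h4, abs_mul, abs_of_nonneg h5]
      exact mul_le_mul_of_nonneg_right (hm i) h5
    have h6 : K * q ^ m * volume.real Y ≤ ε / 2 * volume.real Y :=
      mul_le_mul_of_nonneg_right hKq measureReal_nonneg
    linarith [abs_sub_le (volume.real (W (𝒮.iter a m p) ∩ Y))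
      (∑ i, (tileCount (𝒮.proto i) G : ℝ) * 𝒮.ruleVol W a m i) (F * volume.real Y)]
  have h7 : volume.real (W (𝒮.iter a m p) ∩ B) ≤ volume.real (W (𝒮.iter a m p) ∩ Y) :=
    measureReal_mono (inter_subset_inter_right _ hBY)
      ((measure_mono inter_subset_right).trans_lt hYc.measure_lt_top).ne
  have h8 : volume.real (W (𝒮.iter a m p) ∩ Y) ≤
      volume.real (W (𝒮.iter a m p) ∩ B) + (volume.real Y - volume.real B) := by
    rw [← measureReal_sdiff hBY Metric.isClosed_closedBall.measurableSet hYtop]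
    refine (measureReal_mono ?_ ?_).trans (measureReal_union_le _ _)
    · rintro z ⟨hz, hzY⟩
      by_cases hzB : z ∈ B
      · exact Or.inl ⟨hz, hzB⟩
      · exact Or.inr ⟨hzY, hzB⟩
    · refine ((measure_mono ?_).trans_lt hYc.measure_lt_top).ne
      exact union_subset (inter_subset_right.trans hBY) sdiff_subset
  have h9 : ε * volume.real Y ≤ ε * volume.real B' := mul_le_mul_of_nonneg_left hYB'le hε
  have h10 : F * (volume.real Y - volume.real B) ≤ 1 * (volume.real Y - volume.real B) :=
    mul_le_mul_of_nonneg_right hF.2 (sub_nonneg.2 hBYle)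
  have h11 : 0 ≤ F * (volume.real Y - volume.real B) :=
    mul_nonneg hF.1 (sub_nonneg.2 hBYle)
  rw [abs_le] at h1 ⊢
  constructor <;> linarith [h1.1, h1.2]

theorem volume_closedBall_eq (s : Space d) {r : ℝ} (hr : 0 ≤ r) :
    volume.real (Metric.closedBall s r) = r ^ d * volume.real (Metric.ball (0 : Space d) 1) := by
  rw [Measure.addHaar_real_closedBall _ _ hr, finrank_euclideanSpace, Fintype.card_fin]

theorem volume_ball_one_pos : 0 < volume.real (Metric.ball (0 : Space d) 1) :=
  ENNReal.toReal_pos (Metric.measure_ball_pos _ _ one_pos).ne'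
    Metric.isBounded_ball.measure_lt_top.ne

theorem tendsto_ball_ratio (d : ℕ) (Δ : ℝ) :
    Tendsto (fun r : ℝ => ((r + Δ) / r) ^ d) atTop (𝓝 1) := by
  have h : Tendsto (fun r : ℝ => 1 + Δ / r) atTop (𝓝 (1 + 0)) :=
    tendsto_const_nhds.add (tendsto_const_nhds.div_atTop tendsto_id)
  have h2 := h.pow d
  rw [add_zero, one_pow] at h2
  refine h2.congr' ?_
  filter_upwards [eventually_ne_atTop 0] with r hr
  rw [add_div, div_self hr]

theorem scale_mono (a : ℕ → J) : Monotone (𝒮.scale a) := by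
  refine monotone_nat_of_le_succ fun n => ?_
  rw [scale_succ]
  exact le_mul_of_one_le_right (𝒮.scale_pos a n).le (𝒮.isSubstitution _).one_lt.le

theorem abs_volume_tiling_sub_le [Nonempty J] [Nonempty (Fin l)] (hd : 0 < d) (hR : 0 < R)
    (hW : IsLocalRule 𝒮.X R W)
    {K q : ℝ} (hq : q ∈ Ico (0 : ℝ) 1) (hB : 𝒮.BoundaryDecay R K q) {D : Set (Space d)}
    (hD : D ∈ tilesOf 𝒮.X) {a : ℕ → J} {F : ℝ}
    (hF : ∀ j, Tendsto (fun k => 𝒮.ruleDensity W a k j) atTop (𝓝 F)) {ε : ℝ} (hε : 0 < ε) :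
    ∃ r > 0, ∀ x ∈ 𝒮.tilingSpace D a,
      |volume.real (W x ∩ Metric.closedBall 0 r) -
        F * volume.real (Metric.closedBall (0 : Space d) r)| ≤
      ε * volume.real (Metric.closedBall (0 : Space d) r) := by
  obtain ⟨M, hM0, hM⟩ := 𝒮.exists_dist_bound
  have hF01 : F ∈ Icc (0 : ℝ) 1 := isClosed_Icc.mem_of_tendsto
    (hF (Classical.arbitrary _)) (Eventually.of_forall fun k => ruleDensity_mem_Icc a k _)
  -- Since `η ≤ 1`, the final error `η * (1 + η) + 2 * η` is at most `4 * η ≤ ε`.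
  set η := min (ε / 6) 1 with hη
  have hη0 : 0 < η := lt_min (by positivity) one_pos
  have hKq : Tendsto (fun m : ℕ => K * q ^ m) atTop (𝓝 0) := by
    have := (tendsto_pow_atTop_nhds_zero_of_lt_one hq.1 hq.2).const_mul K
    rwa [mul_zero] at this
  have hev : ∀ᶠ m in atTop, ∀ i, |𝒮.ruleDensity W a m i - F| ≤ η / 2 := by
    refine eventually_all.2 fun i => ?_
    have := (Metric.tendsto_atTop.1 (hF i)) (η / 2) (by positivity)
    obtain ⟨N, hN⟩ := this
    filter_upwards [eventually_ge_atTop N] with m hm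
    exact (hN m hm).le
  obtain ⟨m, hm1, hm2⟩ := (hev.and (hKq.eventually_le_const (by positivity : 0 < η / 2))).exists
  obtain ⟨ρ, hρ⟩ := ((isTile_of_mem hD).1.isBounded.subset_closedBall (0 : Space d))
  have hlim := (tendsto_ball_ratio d (𝒮.scale a m * M)).eventually_le_const
    (by linarith : (1 : ℝ) < 1 + η)
  obtain ⟨r, hr1, hr2, hr3⟩ := (hlim.and ((eventually_gt_atTop 0).and
    (eventually_gt_atTop (𝒮.scale a m * max ρ 0)))).exists
  refine ⟨r, hr2, fun x hx => ?_⟩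
  obtain ⟨k, s, hs, hvol⟩ := exists_iter_volume_eq hW hD hx hR r
  have hω := volume_ball_one_pos (d := d)
  -- The radius `r` was chosen so large that the ball does not fit into any supertile of `D` of
  -- level below `m`. Hence `S_a^k(D)` splits into supertiles of level `m`.
  have hmk : m ≤ k := by
    by_contra hlt
    have h1 : Metric.closedBall s r ⊆ Metric.closedBall 0 (𝒮.scale a m * max ρ 0) := by
      refine hs.trans ?_
      rw [supp_iter a k (singleton_mem hD), supp_singleton]
      rintro _ ⟨z, hz, rfl⟩
      have h2 := hρ hz
      rw [mem_closedBall_zero_iff] at h2 ⊢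
      rw [norm_smul, Real.norm_of_nonneg (𝒮.scale_pos a k).le]
      exact mul_le_mul (scale_mono a (not_le.1 hlt).le) (h2.trans (le_max_left _ _))
        (norm_nonneg _) (𝒮.scale_pos a m).le
    have h3 := measureReal_mono (μ := volume) h1 Metric.isBounded_closedBall.measure_lt_top.ne
    have h0 : 0 ≤ 𝒮.scale a m * max ρ 0 := mul_nonneg (𝒮.scale_pos a m).le (le_max_right _ _)
    rw [volume_closedBall_eq s hr2.le, volume_closedBall_eq 0 h0] at h3
    exact absurd (le_of_mul_le_mul_right h3 hω) (not_le.2 (pow_lt_pow_left₀ hr3 h0 hd.ne'))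
  obtain ⟨n, rfl⟩ := Nat.exists_eq_add_of_le hmk
  have hp := iter_mem_patchesOf (shift m a) n (singleton_mem hD)
  rw [iter_add] at hs hvol
  have h1 := abs_volume_iter_sub_le hR hW hB hM hF01 a m hη0.le hm2 hm1 hp hs
  have hΔ : 0 ≤ r + 𝒮.scale a m * M := add_nonneg hr2.le (mul_nonneg (𝒮.scale_pos a m).le hM0.le)
  rw [div_pow, div_le_iff₀ (pow_pos hr2 d)] at hr1
  have h4 : volume.real (Metric.closedBall s (r + 𝒮.scale a m * M)) ≤
      (1 + η) * volume.real (Metric.closedBall (0 : Space d) r) := by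
    rw [volume_closedBall_eq s hΔ, volume_closedBall_eq 0 hr2.le, ← mul_assoc]
    exact mul_le_mul_of_nonneg_right hr1 hω.le
  have h5 : volume.real (Metric.closedBall s r) =
      volume.real (Metric.closedBall (0 : Space d) r) := by
    rw [volume_closedBall_eq s hr2.le, volume_closedBall_eq 0 hr2.le]
  rw [hvol, ← h5]
  rw [← h5] at h4
  refine h1.trans ?_
  have hV : 0 ≤ volume.real (Metric.closedBall s r) := measureReal_nonneg
  have h6 : η * volume.real (Metric.closedBall s (r + 𝒮.scale a m * M)) ≤
      η * ((1 + η) * volume.real (Metric.closedBall s r)) := mul_le_mul_of_nonneg_left h4 hη0.le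
  have h7 : η * (1 + η) + 2 * η ≤ ε := by
    have h8 : η ≤ ε / 6 := min_le_left _ _
    have h9 : η ≤ 1 := min_le_right _ _
    nlinarith
  have h10 := mul_le_mul_of_nonneg_right h7 hV
  linarith

end MultiSubstitution

end MultiTiling

/-! ### Cylinder sets as local rules, their measurability, and averaging over invariant measures. -/

namespace MultiTiling

variable {d : ℕ}

/-- The positions `t` such that `x` contains `t + u + P` for some `u ∈ U`. -/
def hits (P : Collection d) (U : Set (Space d)) (x : Collection d) : Set (Space d) :=
  {t | ∃ u ∈ U, (t + u) +ᵥ P ⊆ x}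

theorem hits_vadd (P : Collection d) (U : Set (Space d)) (s : Space d) (x : Collection d) :
    hits P U (s +ᵥ x) = s +ᵥ hits P U x := by
  ext t
  rw [mem_vadd_set_iff_neg_vadd_mem]
  refine exists_congr fun u => and_congr_right fun _ => ?_
  rw [vadd_subset_iff, vadd_subset_iff, vadd_vadd]
  have : -(t + u) + s = -((-s +ᵥ t) + u) := by rw [vadd_eq_add]; abel
  rw [this]

theorem hits_iUnion (P : Collection d) (K : ℕ → Set (Space d)) (x : Collection d) :
    hits P (⋃ n, K n) x = ⋃ n, hits P (K n) x := by
  ext t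
  simp only [hits, mem_iUnion, mem_ofPred_eq]
  constructor
  · rintro ⟨u, ⟨n, hn⟩, h⟩
    exact ⟨n, u, hn, h⟩
  · rintro ⟨n, u, hn, h⟩
    exact ⟨u, ⟨n, hn⟩, h⟩

theorem mem_patchCylinder_iff {Y : Set (Collection d)} {P : Collection d} {U : Set (Space d)}
    {x : Points Y} : x ∈ patchCylinder Y P U ↔ 0 ∈ hits P U x.1 := by
  simp [patchCylinder, hits]

theorem IsLocalRule.inter {X : Set (Collection d)} {R R' : ℝ} {W W' : Collection d → Set (Space d)}
    (hW : IsLocalRule X R W) (hW' : IsLocalRule X R' W') :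
    IsLocalRule X (max R R') fun x => W x ∩ W' x where
  vadd t p := by rw [hW.vadd, hW'.vadd, vadd_set_inter]
  measurableSet p hp := (hW.measurableSet p hp).inter (hW'.measurableSet p hp)
  mem_iff y p hy hp t ht := and_congr
    (hW.mem_iff y p hy hp t ((Metric.closedBall_subset_closedBall (le_max_left _ _)).trans ht))
    (hW'.mem_iff y p hy hp t ((Metric.closedBall_subset_closedBall (le_max_right _ _)).trans ht))

namespace MultiSubstitution

variable {l : ℕ} {J : Type*} {𝒮 : MultiSubstitution d l J} {P : Collection d}

theorem exists_norm_bound (hP : P ∈ patchesOf 𝒮.X) : ∃ ρ, ∀ E ∈ P, ∀ z ∈ E, ‖z‖ ≤ ρ := by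
  obtain ⟨ρ, hρ⟩ := (isCompact_supp hP).isBounded.subset_closedBall 0
  exact ⟨ρ, fun E hE z hz => mem_closedBall_zero_iff.1 (hρ ⟨E, hE, hz⟩)⟩

theorem vadd_injective {E : Set (Space d)} (hE : E ∈ tilesOf 𝒮.X) :
    Function.Injective fun w : Space d => w +ᵥ E := by
  intro w w' h
  have hT := isTile_of_mem hE
  have h1 : (-w' + w) +ᵥ E = E := by
    rw [← vadd_vadd, show w +ᵥ E = w' +ᵥ E from h, neg_vadd_vadd]
  have h2 := eq_zero_of_vadd_eq hT.1 hT.2.1.nonempty h1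
  rwa [neg_add_eq_zero, eq_comm] at h2

theorem exists_positions_bound (hP : P ∈ patchesOf 𝒮.X) (hne : P.Nonempty) (ρ : ℝ) :
    ∃ N : ℕ, ∀ x ∈ 𝒮.X, {w : Space d | ‖w‖ ≤ ρ ∧ w +ᵥ P ⊆ x}.Finite ∧
      {w : Space d | ‖w‖ ≤ ρ ∧ w +ᵥ P ⊆ x}.ncard ≤ N := by
  obtain ⟨E, hE⟩ := hne
  have hET := mem_tilesOf hP hE
  obtain ⟨z, hz⟩ := (isTile_of_mem hET).2.1.nonempty
  obtain ⟨N, hN⟩ := 𝒮.exists_card_bound (ρ + ‖z‖)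
  refine ⟨N, fun x hx => ?_⟩
  have hmaps : ∀ w ∈ {w : Space d | ‖w‖ ≤ ρ ∧ w +ᵥ P ⊆ x},
      w +ᵥ E ∈ {E ∈ x | (E ∩ Metric.closedBall 0 (ρ + ‖z‖)).Nonempty} := by
    rintro w ⟨hw, hwP⟩
    refine ⟨hwP (vadd_mem_vadd_set hE), w +ᵥ z, vadd_mem_vadd_set hz, ?_⟩
    rw [mem_closedBall_zero_iff, vadd_eq_add]
    exact (norm_add_le _ _).trans (by linarith)
  have hinj := (vadd_injective hET).injOn (s := {w : Space d | ‖w‖ ≤ ρ ∧ w +ᵥ P ⊆ x})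
  exact ⟨((hN x hx).1.subset (image_subset_iff.2 hmaps)).of_finite_image hinj,
    (ncard_le_ncard_of_injOn _ hmaps hinj (hN x hx).1).trans (hN x hx).2⟩

theorem isLocalRule_hits (hP : P ∈ patchesOf 𝒮.X) (hne : P.Nonempty) {U : Set (Space d)}
    (hU : MeasurableSet U) (hUb : Bornology.IsBounded U) :
    ∃ R > 0, IsLocalRule 𝒮.X R (hits P U) := by
  obtain ⟨ρ, hρ⟩ := exists_norm_bound hP
  obtain ⟨ρ', hρ'⟩ := hUb.subset_closedBall 0
  -- For `u ∈ U`, each tile of `t + u + P` stays within `|ρ| + |ρ'|` of `t`.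
  refine ⟨|ρ| + |ρ'| + 1, by positivity, fun t p => hits_vadd P U t p, fun p hp => ?_, ?_⟩
  · have hfin : {w : Space d | w +ᵥ P ⊆ p}.Finite := by
      obtain ⟨E, hE⟩ := hne
      refine (hp.1.subset (image_subset_iff.2 ?_)).of_finite_image
        ((vadd_injective (mem_tilesOf hP hE)).injOn (s := {w : Space d | w +ᵥ P ⊆ p}))
      exact fun w hw => hw (vadd_mem_vadd_set hE)
    -- As `P` is nonempty, it has finitely many placements `w` in the finite patch `p`, and each
    -- contributes a reflected translate of `U`.
    have heq : hits P U p = ⋃ w ∈ {w : Space d | w +ᵥ P ⊆ p}, (fun t => w - t) ⁻¹' U := by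
      ext t
      simp only [hits, mem_ofPred_eq, mem_iUnion, mem_preimage, exists_prop]
      constructor
      · rintro ⟨u, hu, h⟩
        exact ⟨t + u, h, by simpa using hu⟩
      · rintro ⟨w, hw, h⟩
        exact ⟨w - t, h, by simpa using hw⟩
    rw [heq]
    exact hfin.measurableSet_biUnion fun w _ => hU.preimage (measurable_const_sub w)
  · intro y p hy hpy t ht
    refine exists_congr fun u => and_congr_right fun hu =>
      ⟨fun h => ?_, fun h => h.trans hpy⟩
    rintro _ ⟨E, hE, rfl⟩
    refine hy.mem_of_subset_supp hpy (h (vadd_mem_vadd_set hE)) (subset_trans ?_ ht)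
    rintro _ ⟨z, hz, rfl⟩
    have h1 := hρ E hE z hz
    have h2 := mem_closedBall_zero_iff.1 (hρ' hu)
    simp only [vadd_eq_add, Metric.mem_closedBall, dist_eq_norm]
    have h3 : t + u + z - t = u + z := by abel
    rw [h3]
    exact (norm_add_le _ _).trans (by linarith [le_abs_self ρ, le_abs_self ρ'])

/-- Near the compact set `K` there are only finitely many placements of `P` in `x`, so they keep a
positive distance from it. -/
theorem exists_disjoint_margin (hP : P ∈ patchesOf 𝒮.X) (hne : P.Nonempty) {K : Set (Space d)}
    (hK : IsCompact K) {x : Collection d} (hx : x ∈ 𝒮.X) (h : ∀ u ∈ K, ¬ u +ᵥ P ⊆ x) :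
    ∃ δ > 0, ∀ u ∈ K, ∀ w : Space d, dist w u ≤ δ → ¬ w +ᵥ P ⊆ x := by
  obtain ⟨ρ, hρ⟩ := hK.isBounded.subset_closedBall 0
  obtain ⟨N, hN⟩ := exists_positions_bound hP hne (ρ + 1)
  have hdis : Disjoint K {w : Space d | ‖w‖ ≤ ρ + 1 ∧ w +ᵥ P ⊆ x} :=
    Set.disjoint_left.2 fun u hu hu' => h u hu hu'.2
  obtain ⟨δ, hδ, hδdis⟩ := hdis.exists_cthickenings hK (hN x hx).1.isClosed
  refine ⟨min δ 1, lt_min hδ one_pos, fun u hu w hwu hw => ?_⟩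
  refine Set.disjoint_left.1 hδdis
    (Metric.mem_cthickening_of_dist_le w u δ _ hu (hwu.trans (min_le_left _ _)))
    (Metric.self_subset_cthickening _ ⟨?_, hw⟩)
  have h1 := mem_closedBall_zero_iff.1 (hρ hu)
  have h2 : ‖w‖ ≤ ‖u‖ + dist w u := by
    rw [dist_eq_norm]
    exact norm_le_norm_add_norm_sub' w u
  linarith [hwu.trans (min_le_right _ _)]

theorem isClosed_patchCylinder {Y : Set (Collection d)} (hY : Y ⊆ 𝒮.X) (hP : P ∈ patchesOf 𝒮.X)
    (hne : P.Nonempty) {K : Set (Space d)} (hK : IsCompact K) :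
    IsClosed (patchCylinder Y P K) := by
  rw [← isOpen_compl_iff]
  intro x hx
  have hx' : ∀ u ∈ K, ¬ u +ᵥ P ⊆ x.1 := fun u hu h => hx ⟨u, hu, h⟩
  obtain ⟨δ, hδ, hdis⟩ := exists_disjoint_margin hP hne hK (hY x.2) hx'
  obtain ⟨ρ, hρ⟩ := exists_norm_bound hP
  obtain ⟨ρ', hρ'⟩ := hK.isBounded.subset_closedBall 0
  have hρ0 : 0 < |ρ| + |ρ'| + 1 := by positivity
  -- Below `δ`, the translation carrying `x` to `y` stays within the margin; below the reciprocal,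
  -- the matched region contains every `u + P` with `u ∈ K`. The bound `√2 / 2` excludes the default
  -- element of the infimum, so an actual matching exists.
  refine ⟨min (min δ (1 / (|ρ| + |ρ'| + 1))) (√2 / 2),
    lt_min (lt_min hδ (by positivity)) (by positivity), fun y hy hyK => ?_⟩
  obtain ⟨u, hu, huP⟩ := hyK
  obtain ⟨r, hr, hrlt⟩ := exists_lt_of_csInf_lt ⟨√2 / 2, Or.inl rfl⟩ hy
  rcases hr with hr | ⟨hr0, -, x', hx', y', hy', t, ht, rfl⟩
  · exact absurd hrlt (not_lt.2 (by rw [mem_singleton_iff.1 hr]; exact min_le_right _ _))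
  have hr1 : r < δ := hrlt.trans_le ((min_le_left _ _).trans (min_le_left _ _))
  have hr2 : r < 1 / (|ρ| + |ρ'| + 1) :=
    hrlt.trans_le ((min_le_left _ _).trans (min_le_right _ _))
  have hr3 : |ρ| + |ρ'| + 1 ≤ 1 / r := ((lt_one_div hr0 hρ0).1 hr2).le
  refine hdis u hu (-t + u) ?_ ?_
  · rw [dist_eq_norm, show -t + u - u = -t by abel, norm_neg]
    exact ht.trans hr1.le
  · rw [← vadd_vadd, vadd_subset_iff, neg_neg]
    refine subset_trans ?_ (vadd_set_mono hx'.1)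
    rintro _ ⟨E, hE, rfl⟩
    refine (𝒮.isTiling y.1 (hY y.2)).1.mem_of_subset_supp hy'.1 (huP (vadd_mem_vadd_set hE))
      (subset_trans ?_ hy'.2.2)
    rintro _ ⟨z, hz, rfl⟩
    have h1 := hρ E hE z hz
    have h2 := mem_closedBall_zero_iff.1 (hρ' hu)
    simp only [vadd_eq_add]
    rw [mem_closedBall_zero_iff]
    exact (norm_add_le _ _).trans (by linarith [le_abs_self ρ, le_abs_self ρ'])

/-- Joint closedness gives the joint measurability that Fubini needs. If `y` has no placement in
`closedBall t δ + K`, then no `s` within `δ` of `t` is a hit for `y`. -/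
theorem isClosed_setOf_mem_hits {Y : Set (Collection d)} (hY : Y ⊆ 𝒮.X) (hP : P ∈ patchesOf 𝒮.X)
    (hne : P.Nonempty) {K : Set (Space d)} (hK : IsCompact K) :
    IsClosed {z : Space d × Points Y | z.1 ∈ hits P K z.2.1} := by
  rw [← isOpen_compl_iff, isOpen_prod_iff]
  intro t x htx
  have htx' : ∀ u ∈ t +ᵥ K, ¬ u +ᵥ P ⊆ x.1 := by
    rintro _ ⟨u, hu, rfl⟩ h
    exact htx ⟨u, hu, h⟩
  obtain ⟨δ, hδ, hdis⟩ := exists_disjoint_margin hP hne (hK.vadd t) (hY x.2) htx'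
  refine ⟨Metric.ball t δ, (patchCylinder Y P (Metric.closedBall t δ + K))ᶜ, Metric.isOpen_ball,
    (isClosed_patchCylinder hY hP hne ((isCompact_closedBall t δ).add hK)).isOpen_compl,
    Metric.mem_ball_self hδ, ?_, ?_⟩
  · rintro ⟨_, ⟨s, hs, u, hu, rfl⟩, h⟩
    refine hdis _ (vadd_mem_vadd_set hu) (s + u) ?_ h
    rw [vadd_eq_add, dist_add_right]
    exact hs
  · rintro ⟨s, y⟩ ⟨hs, hy⟩ ⟨u, hu, h⟩
    exact hy ⟨s + u, add_mem_add (Metric.ball_subset_closedBall hs) hu, h⟩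

theorem measurableSet_setOf_mem_hits {Y : Set (Collection d)} (hY : Y ⊆ 𝒮.X)
    (hP : P ∈ patchesOf 𝒮.X) (hne : P.Nonempty) {U : Set (Space d)} (hU : IsSigmaCompact U) :
    MeasurableSet {z : Space d × Points Y | z.1 ∈ hits P U z.2.1} := by
  obtain ⟨K, hK, rfl⟩ := hU
  have : {z : Space d × Points Y | z.1 ∈ hits P (⋃ n, K n) z.2.1} =
      ⋃ n, {z : Space d × Points Y | z.1 ∈ hits P (K n) z.2.1} := by
    ext z
    simp only [mem_ofPred_eq, hits_iUnion, mem_iUnion]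
  rw [this]
  exact MeasurableSet.iUnion fun n => (isClosed_setOf_mem_hits hY hP hne (hK n)).measurableSet

end MultiSubstitution

/-- By equivariance and invariance the event `t ∈ W x` has the same measure for every `t`, so
exchanging the integrals over `t ∈ B` and `x` gives the product. -/
theorem lintegral_volume_rule {Y : Set (Collection d)} (hYv : ∀ x ∈ Y, ∀ t : Space d, t +ᵥ x ∈ Y)
    {W : Collection d → Set (Space d)}
    (hWv : ∀ (t : Space d) (p : Collection d), W (t +ᵥ p) = t +ᵥ W p)
    (hmeas : MeasurableSet {z : Space d × Points Y | z.1 ∈ W z.2.1})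
    {μ : Measure (Points Y)} (hμ : IsInvariantProbability μ) {B : Set (Space d)}
    (hB : MeasurableSet B) :
    ∫⁻ x : Points Y, volume (W x.1 ∩ B) ∂μ = μ {x : Points Y | 0 ∈ W x.1} * volume B := by
  have := hμ.1
  have hslice : ∀ t : Space d, μ (Prod.mk t ⁻¹' {z : Space d × Points Y | z.1 ∈ W z.2.1}) =
      μ {x : Points Y | 0 ∈ W x.1} := by
    intro t
    have h0 : MeasurableSet {x : Points Y | 0 ∈ W x.1} := measurable_prodMk_left hmeas
    rw [← hμ.2 t _ h0]
    congr 1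
    ext x
    simp only [mem_preimage, mem_ofPred_eq]
    constructor
    · intro hx
      refine ⟨⟨-t +ᵥ x.1, hYv _ x.2 _⟩, ?_, (vadd_neg_vadd t x.1).symm⟩
      rw [hWv, mem_vadd_set_iff_neg_vadd_mem, neg_neg, vadd_eq_add, add_zero]
      exact hx
    · rintro ⟨y, hy, hxy⟩
      rw [hxy, hWv, mem_vadd_set_iff_neg_vadd_mem, vadd_eq_add, neg_add_cancel]
      exact hy
  have h1 := Measure.prod_apply (μ := volume.restrict B) (ν := μ) hmeas
  have h2 := Measure.prod_apply_symm (μ := volume.restrict B) (ν := μ) hmeas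
  simp only [hslice, lintegral_const, Measure.restrict_apply_univ] at h1
  rw [← h1, h2]
  refine lintegral_congr fun x => ?_
  rw [Measure.restrict_apply' hB]
  rfl

/-- The ball average is uniformly close to `F`, and its mean under `μ` is exactly the measure of `0
∈ W x`. Uniformity replaces any ergodic theorem and forces the same value for all invariant
measures. -/
theorem measureReal_rule_eq {Y : Set (Collection d)} (hYv : ∀ x ∈ Y, ∀ t : Space d, t +ᵥ x ∈ Y)
    {W : Collection d → Set (Space d)}
    (hWv : ∀ (t : Space d) (p : Collection d), W (t +ᵥ p) = t +ᵥ W p)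
    (hmeas : MeasurableSet {z : Space d × Points Y | z.1 ∈ W z.2.1})
    {μ : Measure (Points Y)} (hμ : IsInvariantProbability μ) {F : ℝ} (hF : 0 ≤ F)
    (h : ∀ ε > 0, ∃ r > 0, ∀ x ∈ Y, |volume.real (W x ∩ Metric.closedBall 0 r) -
        F * volume.real (Metric.closedBall (0 : Space d) r)| ≤
      ε * volume.real (Metric.closedBall (0 : Space d) r)) :
    μ.real {x : Points Y | 0 ∈ W x.1} = F := by
  have := hμ.1
  refine eq_of_abs_sub_le_all fun ε hε => ?_
  obtain ⟨r, hr, hx⟩ := h ε hε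
  set B := Metric.closedBall (0 : Space d) r with hB
  have hBtop : volume B ≠ ⊤ := Metric.isBounded_closedBall.measure_lt_top.ne
  have hV : 0 < volume.real B := ENNReal.toReal_pos (Metric.measure_closedBall_pos _ _ hr).ne' hBtop
  have hint := lintegral_volume_rule hYv hWv hmeas hμ (B := B)
    Metric.isClosed_closedBall.measurableSet
  have hreal : ∀ x : Points Y, volume (W x.1 ∩ B) = ENNReal.ofReal (volume.real (W x.1 ∩ B)) :=
    fun x => (ofReal_measureReal ((measure_mono inter_subset_right).trans_lt hBtop.lt_top).ne).symm
  have hup : μ {x : Points Y | 0 ∈ W x.1} * volume B ≤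
      ENNReal.ofReal ((F + ε) * volume.real B) := by
    rw [← hint]
    refine (lintegral_mono (g := fun _ => ENNReal.ofReal ((F + ε) * volume.real B))
      fun x => ?_).trans_eq ?_
    · simp only
      rw [hreal x]
      refine ENNReal.ofReal_le_ofReal ?_
      linarith [(abs_le.1 (hx x.1 x.2)).2]
    · rw [lintegral_const, measure_univ, mul_one]
  have hlow : ENNReal.ofReal ((F - ε) * volume.real B) ≤
      μ {x : Points Y | 0 ∈ W x.1} * volume B := by
    rw [← hint]
    refine le_trans (le_of_eq ?_)
      (lintegral_mono (f := fun _ => ENNReal.ofReal ((F - ε) * volume.real B)) fun x => ?_)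
    · rw [lintegral_const, measure_univ, mul_one]
    · simp only
      rw [hreal x]
      refine ENNReal.ofReal_le_ofReal ?_
      linarith [(abs_le.1 (hx x.1 x.2)).1]
  have hprodtop : μ {x : Points Y | 0 ∈ W x.1} * volume B ≠ ⊤ :=
    ENNReal.mul_ne_top (measure_ne_top _ _) hBtop
  have htoReal : (μ {x : Points Y | 0 ∈ W x.1} * volume B).toReal =
      μ.real {x : Points Y | 0 ∈ W x.1} * volume.real B := ENNReal.toReal_mul
  have h1 := ENNReal.toReal_le_of_le_ofReal (mul_nonneg (by linarith) hV.le) hup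
  have h2 := (ENNReal.ofReal_le_iff_le_toReal hprodtop).1 hlow
  rw [htoReal] at h1 h2
  have h3 := le_of_mul_le_mul_right h1 hV
  have h4 := le_of_mul_le_mul_right h2 hV
  rw [abs_le]
  constructor <;> linarith

theorem isSigmaCompact_of_isOpen {O : Set (Space d)} (hO : IsOpen O)
    (hb : Bornology.IsBounded O) : IsSigmaCompact O := by
  obtain ⟨K, hK, hKO, hU, -⟩ := hO.exists_iUnion_isClosed
  exact ⟨K, fun n => Metric.isCompact_of_isClosed_isBounded (hK n) (hb.subset (hKO n)), hU⟩

theorem measurableSet_of_isSigmaCompact {U : Set (Space d)} (hU : IsSigmaCompact U) :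
    MeasurableSet U := by
  obtain ⟨K, hK, rfl⟩ := hU
  exact MeasurableSet.iUnion fun n => (hK n).measurableSet

/-- Inner regularity reduces arbitrary `U` to countable unions of compact sets, whose cylinders are
countable unions of closed sets. -/
theorem exists_isSigmaCompact_null_diff {U : Set (Space d)} (hU : NullMeasurableSet U volume)
    (hb : Bornology.IsBounded U) : ∃ U' ⊆ U, IsSigmaCompact U' ∧ volume (U \ U') = 0 := by
  obtain ⟨A, hAU, hA, hAe⟩ := hU.exists_measurable_subset_ae_eq
  have hAtop : volume A ≠ ⊤ := (hb.subset hAU).measure_lt_top.ne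
  have h : ∀ n : ℕ, ∃ K ⊆ A, IsCompact K ∧ volume (A \ K) < ((n : ENNReal) + 1)⁻¹ := fun n =>
    hA.exists_isCompact_sdiff_lt hAtop (by simp)
  choose K hKA hK hlt using h
  refine ⟨⋃ n, K n, iUnion_subset fun n => (hKA n).trans hAU, ⟨K, hK, rfl⟩, ?_⟩
  have h1 : volume (A \ ⋃ n, K n) = 0 := by
    refine le_antisymm (ge_of_tendsto' (x := atTop) (f := fun n : ℕ => ((n : ENNReal) + 1)⁻¹) ?_
      fun n => (measure_mono (sdiff_subset_sdiff_right (subset_iUnion K n))).trans (hlt n).le)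
      zero_le
    have := (tendsto_add_atTop_iff_nat 1).2 ENNReal.tendsto_inv_nat_nhds_zero
    simpa using this
  have h2 : volume (U \ A) = 0 := (ae_le_set.1 hAe.symm.le)
  refine measure_mono_null ?_ (measure_union_null h2 h1)
  rintro z ⟨hzU, hz⟩
  by_cases hzA : z ∈ A
  · exact Or.inr ⟨hzA, hz⟩
  · exact Or.inl ⟨hzU, hzA⟩

namespace MultiSubstitution

variable {l : ℕ} {J : Type*} {𝒮 : MultiSubstitution d l J} {P : Collection d}
  {Y : Set (Collection d)}

/-- `N` lies in a bounded open set of volume below `δ`. A tiling has at most `n` placements of `P`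
in the relevant ball, so the hits in the unit ball have volume at most `n * δ`; averaging transfers
this bound to `μ`. -/
theorem measure_patchCylinder_null (hY : Y ⊆ 𝒮.X) (hYv : ∀ x ∈ Y, ∀ t : Space d, t +ᵥ x ∈ Y)
    (hP : P ∈ patchesOf 𝒮.X) (hne : P.Nonempty) {μ : Measure (Points Y)}
    (hμ : IsInvariantProbability μ) {N : Set (Space d)} (hN : volume N = 0)
    (hb : Bornology.IsBounded N) : μ (patchCylinder Y P N) = 0 := by
  have := hμ.1
  obtain ⟨ρ, hρ⟩ := hb.subset_ball 0
  obtain ⟨n, hn⟩ := exists_positions_bound hP hne (1 + ρ)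
  set B := Metric.closedBall (0 : Space d) 1 with hB
  have hB0 : volume B ≠ 0 := (Metric.measure_closedBall_pos _ _ one_pos).ne'
  have hBtop : volume B ≠ ⊤ := Metric.isBounded_closedBall.measure_lt_top.ne
  have hkey : ∀ δ : ENNReal, 0 < δ → μ (patchCylinder Y P N) * volume B ≤ n * δ := by
    intro δ hδ
    obtain ⟨O', hNO', hO', hlt⟩ := N.exists_isOpen_lt_of_lt δ (hN ▸ hδ)
    set O := O' ∩ Metric.ball 0 ρ with hOdef
    have hO : IsOpen O := hO'.inter Metric.isOpen_ball
    have hOb : Bornology.IsBounded O := Metric.isBounded_ball.subset inter_subset_right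
    have hNO : N ⊆ O := subset_inter hNO' hρ
    have hmeas := measurableSet_setOf_mem_hits hY hP hne (isSigmaCompact_of_isOpen hO hOb)
    have hint := lintegral_volume_rule hYv (hits_vadd P O) hmeas hμ (B := B)
      Metric.isClosed_closedBall.measurableSet
    have hcyl : patchCylinder Y P N ⊆ {x : Points Y | 0 ∈ hits P O x.1} := by
      rintro x ⟨u, hu, h⟩
      exact ⟨u, hNO hu, by rwa [zero_add]⟩
    calc μ (patchCylinder Y P N) * volume B
        ≤ μ {x : Points Y | 0 ∈ hits P O x.1} * volume B := by gcongr
      _ = ∫⁻ x : Points Y, volume (hits P O x.1 ∩ B) ∂μ := hint.symm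
      _ ≤ ∫⁻ _ : Points Y, n * δ ∂μ := by
          refine lintegral_mono fun x => ?_
          obtain ⟨hfin, hcard⟩ := hn x.1 (hY x.2)
          have hsub : hits P O x.1 ∩ B ⊆ ⋃ w ∈ hfin.toFinset, (fun t => w - t) ⁻¹' O := by
            rintro t ⟨⟨u, hu, h⟩, ht⟩
            refine mem_iUnion₂.2 ⟨t + u, hfin.mem_toFinset.2 ⟨?_, h⟩, by simpa using hu⟩
            have h1 := mem_closedBall_zero_iff.1 ht
            have h2 := mem_ball_zero_iff.1 hu.2
            exact (norm_add_le _ _).trans (by linarith)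
          calc volume (hits P O x.1 ∩ B)
              ≤ ∑ w ∈ hfin.toFinset, volume ((fun t => w - t) ⁻¹' O) :=
                (measure_mono hsub).trans (measure_biUnion_finset_le _ _)
            _ = ∑ w ∈ hfin.toFinset, volume O := by
                refine Finset.sum_congr rfl fun w _ => ?_
                exact (Measure.measurePreserving_sub_left volume w).measure_preimage
                  hO.measurableSet.nullMeasurableSet
            _ = (hfin.toFinset.card : ENNReal) * volume O := by
                rw [Finset.sum_const, nsmul_eq_mul]
            _ ≤ n * δ := by
                rw [ncard_eq_toFinset_card _ hfin] at hcard
                exact mul_le_mul' (by exact_mod_cast hcard)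
                  ((measure_mono inter_subset_left).trans hlt.le)
      _ = n * δ := by rw [lintegral_const, measure_univ, mul_one]
  have hzero : μ (patchCylinder Y P N) * volume B = 0 := by
    refine le_antisymm (ge_of_tendsto (x := 𝓝[>] (0 : ENNReal)) (f := fun δ => (n : ENNReal) * δ)
      ?_ ?_) zero_le
    · have := (ENNReal.Tendsto.const_mul (a := (n : ENNReal)) (b := 0) (f := 𝓝 (0 : ENNReal))
        (m := id) tendsto_id (Or.inr (ENNReal.natCast_ne_top n)))
      rw [mul_zero] at this
      exact this.mono_left nhdsWithin_le_nhds
    · filter_upwards [self_mem_nhdsWithin] with δ hδ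
      exact hkey δ hδ
  exact (mul_eq_zero.1 hzero).resolve_right hB0

theorem patchCylinder_ae_eq (hY : Y ⊆ 𝒮.X) (hYv : ∀ x ∈ Y, ∀ t : Space d, t +ᵥ x ∈ Y)
    (hP : P ∈ patchesOf 𝒮.X) (hne : P.Nonempty) {μ : Measure (Points Y)}
    (hμ : IsInvariantProbability μ) {U U' : Set (Space d)} (hU : U' ⊆ U)
    (hb : Bornology.IsBounded U) (h0 : volume (U \ U') = 0) :
    patchCylinder Y P U =ᵐ[μ] patchCylinder Y P U' := by
  have h1 : patchCylinder Y P U = patchCylinder Y P U' ∪ patchCylinder Y P (U \ U') := by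
    ext x
    constructor
    · rintro ⟨u, hu, h⟩
      by_cases hu' : u ∈ U'
      · exact Or.inl ⟨u, hu', h⟩
      · exact Or.inr ⟨u, ⟨hu, hu'⟩, h⟩
    · rintro (⟨u, hu, h⟩ | ⟨u, hu, h⟩)
      · exact ⟨u, hU hu, h⟩
      · exact ⟨u, hu.1, h⟩
  rw [h1]
  exact union_ae_eq_left_of_ae_eq_empty (ae_eq_empty.2
    (measure_patchCylinder_null hY hYv hP hne hμ h0 (hb.subset sdiff_subset)))

end MultiSubstitution

end MultiTiling

/-! ### The rate for cylinder intersections and the final estimate. -/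

namespace MultiTiling

namespace MultiSubstitution

variable {d l : ℕ} {J : Type*}

/-- The measures of the intersections of two cylinder sets for two sequences that agree on their
first `n` letters differ by at most a constant multiple of `τ ^ n`. -/
def CylinderRate (𝒮 : MultiSubstitution d l J) (D : Set (Space d)) (τ : ℝ) (P Q : Collection d)
    (U V : Set (Space d)) : Prop :=
  ∃ C ≥ 0, ∀ (n : ℕ) (a b : ℕ → J), (∀ k < n, a k = b k) →
    ∀ (μa : Measure (Points (𝒮.tilingSpace D a))) (μb : Measure (Points (𝒮.tilingSpace D b))),
      IsInvariantProbability μa → IsInvariantProbability μb →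
      |μa.real (patchCylinder (𝒮.tilingSpace D a) P U ∩ patchCylinder (𝒮.tilingSpace D a) Q V) -
        μb.real (patchCylinder (𝒮.tilingSpace D b) P U ∩ patchCylinder (𝒮.tilingSpace D b) Q V)|
        ≤ C * τ ^ n

variable {𝒮 : MultiSubstitution d l J} {D : Set (Space d)} {P Q : Collection d}
  {U V : Set (Space d)}

theorem CylinderRate.of_eq {τ : ℝ} {P' Q' : Collection d} {U' V' : Set (Space d)}
    (h : 𝒮.CylinderRate D τ P' Q' U' V')
    (heq : ∀ (a : ℕ → J) (μ : Measure (Points (𝒮.tilingSpace D a))), IsInvariantProbability μ →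
      μ.real (patchCylinder (𝒮.tilingSpace D a) P U ∩ patchCylinder (𝒮.tilingSpace D a) Q V) =
      μ.real (patchCylinder (𝒮.tilingSpace D a) P' U' ∩
        patchCylinder (𝒮.tilingSpace D a) Q' V')) :
    𝒮.CylinderRate D τ P Q U V := by
  obtain ⟨C, hC, hrate⟩ := h
  refine ⟨C, hC, fun n a b hab μa μb hμa hμb => ?_⟩
  rw [heq a μa hμa, heq b μb hμb]
  exact hrate n a b hab μa μb hμa hμb

theorem cylinderRate_of_const {τ : ℝ} (r : ℝ)
    (heq : ∀ (a : ℕ → J) (μ : Measure (Points (𝒮.tilingSpace D a))), IsInvariantProbability μ →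
      μ.real (patchCylinder (𝒮.tilingSpace D a) P U ∩
        patchCylinder (𝒮.tilingSpace D a) Q V) = r) :
    𝒮.CylinderRate D τ P Q U V := by
  refine ⟨0, le_rfl, fun n a b _ μa μb hμa hμb => ?_⟩
  rw [heq a μa hμa, heq b μb hμb, sub_self, abs_zero, zero_mul]

theorem patchCylinder_empty_right (Y : Set (Collection d)) (P : Collection d) :
    patchCylinder Y P ∅ = ∅ := by
  simp [patchCylinder]

theorem patchCylinder_empty_left (Y : Set (Collection d)) (hU : U.Nonempty) :
    patchCylinder Y ∅ U = univ := by
  obtain ⟨u, hu⟩ := hU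
  exact eq_univ_of_forall fun x => ⟨u, hu, by simp⟩

variable [Finite J] [Nonempty J] [Nonempty (Fin l)] {θ : ℝ}

theorem cylinderRate_of_isSigmaCompact (hd : 0 < d) (hD : D ∈ tilesOf 𝒮.X)
    (hθ : 𝒮.IsTileFreqRate θ) (hP : P ∈ patchesOf 𝒮.X) (hQ : Q ∈ patchesOf 𝒮.X)
    (hPn : P.Nonempty) (hQn : Q.Nonempty) (hU : IsSigmaCompact U) (hV : IsSigmaCompact V)
    (hUb : Bornology.IsBounded U) (hVb : Bornology.IsBounded V) :
    𝒮.CylinderRate D (𝒮.theta0 θ) P Q U V := by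
  obtain ⟨R, hR, hWU⟩ := isLocalRule_hits hP hPn (measurableSet_of_isSigmaCompact hU) hUb
  obtain ⟨R', -, hWV⟩ := isLocalRule_hits hQ hQn (measurableSet_of_isSigmaCompact hV) hVb
  have hW := hWU.inter hWV
  have hRR : 0 < max R R' := hR.trans_le (le_max_left _ _)
  obtain ⟨F, K, -, q, hq, hB, hF, C, hC, hrate⟩ := exists_ruleFreq_rate hd hθ hRR hW
  have hF0 : ∀ a, 0 ≤ F a := fun a => ge_of_tendsto' (hF a (Classical.arbitrary _))
    fun k => (ruleDensity_mem_Icc a k _).1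
  have hμF : ∀ (a : ℕ → J) (μ : Measure (Points (𝒮.tilingSpace D a))), IsInvariantProbability μ →
      μ.real (patchCylinder (𝒮.tilingSpace D a) P U ∩
        patchCylinder (𝒮.tilingSpace D a) Q V) = F a := by
    intro a μ hμ
    have hY : 𝒮.tilingSpace D a ⊆ 𝒮.X := fun x hx => hx.1
    rw [← measureReal_rule_eq (W := fun x => hits P U x ∩ hits Q V x)
      (fun x hx t => vadd_mem_tilingSpace hx t) hW.vadd
      ((measurableSet_setOf_mem_hits hY hP hPn hU).inter
        (measurableSet_setOf_mem_hits hY hQ hQn hV)) hμ (hF0 a)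
      (fun ε hε => abs_volume_tiling_sub_le hd hRR hW hq hB hD (hF a) hε)]
    congr 1
    ext x
    exact and_congr mem_patchCylinder_iff mem_patchCylinder_iff
  refine ⟨C, hC, fun n a b hab μa μb hμa hμb => ?_⟩
  rw [hμF a μa hμa, hμF b μb hμb]
  exact hrate n a b hab

theorem cylinderRate_of_nonempty (hd : 0 < d) (hD : D ∈ tilesOf 𝒮.X)
    (hθ : 𝒮.IsTileFreqRate θ) (hP : P ∈ patchesOf 𝒮.X) (hQ : Q ∈ patchesOf 𝒮.X)
    (hPn : P.Nonempty) (hQn : Q.Nonempty) (hU : NullMeasurableSet U volume)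
    (hV : NullMeasurableSet V volume) (hUb : Bornology.IsBounded U)
    (hVb : Bornology.IsBounded V) : 𝒮.CylinderRate D (𝒮.theta0 θ) P Q U V := by
  obtain ⟨U', hU', hUc, hU0⟩ := exists_isSigmaCompact_null_diff hU hUb
  obtain ⟨V', hV', hVc, hV0⟩ := exists_isSigmaCompact_null_diff hV hVb
  refine (cylinderRate_of_isSigmaCompact hd hD hθ hP hQ hPn hQn hUc hVc (hUb.subset hU')
    (hVb.subset hV')).of_eq fun a μ hμ => ?_
  have hY : 𝒮.tilingSpace D a ⊆ 𝒮.X := fun x hx => hx.1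
  have hYv : ∀ x ∈ 𝒮.tilingSpace D a, ∀ t : Space d, t +ᵥ x ∈ 𝒮.tilingSpace D a :=
    fun x hx t => vadd_mem_tilingSpace hx t
  exact measureReal_congr ((patchCylinder_ae_eq hY hYv hP hPn hμ hU' hUb hU0).inter
    (patchCylinder_ae_eq hY hYv hQ hQn hμ hV' hVb hV0))

theorem cylinderRate (hd : 0 < d) (hD : D ∈ tilesOf 𝒮.X)
    (hθ : 𝒮.IsTileFreqRate θ) (hP : P ∈ patchesOf 𝒮.X) (hQ : Q ∈ patchesOf 𝒮.X)
    (hU : NullMeasurableSet U volume) (hV : NullMeasurableSet V volume)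
    (hUb : Bornology.IsBounded U) (hVb : Bornology.IsBounded V) :
    𝒮.CylinderRate D (𝒮.theta0 θ) P Q U V := by
  rcases U.eq_empty_or_nonempty with rfl | hUn
  · exact cylinderRate_of_const 0 fun a μ _ => by
      rw [patchCylinder_empty_right, empty_inter, measureReal_empty]
  rcases V.eq_empty_or_nonempty with rfl | hVn
  · exact cylinderRate_of_const 0 fun a μ _ => by
      rw [patchCylinder_empty_right, inter_empty, measureReal_empty]
  rcases P.eq_empty_or_nonempty with rfl | hPn
  · rcases Q.eq_empty_or_nonempty with rfl | hQn
    · refine cylinderRate_of_const 1 fun a μ hμ => ?_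
      have := hμ.1
      rw [patchCylinder_empty_left _ hUn, patchCylinder_empty_left _ hVn, inter_univ,
        measureReal_def, measure_univ, ENNReal.toReal_one]
    -- The cylinder of the empty patch is everything, so the remaining cylinder is intersected with
    -- itself to reuse the nonempty case.
    · refine (cylinderRate_of_nonempty hd hD hθ hQ hQ hQn hQn hV hV hVb hVb).of_eq fun a μ _ => ?_
      rw [patchCylinder_empty_left _ hUn, univ_inter, inter_self]
  · rcases Q.eq_empty_or_nonempty with rfl | hQn
    · refine (cylinderRate_of_nonempty hd hD hθ hP hP hPn hPn hU hU hUb hUb).of_eq fun a μ _ => ?_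
      rw [patchCylinder_empty_left _ hVn, inter_univ, inter_self]
    · exact cylinderRate_of_nonempty hd hD hθ hP hQ hPn hQn hU hV hUb hVb

end MultiSubstitution

/-- The metric counts indices from `1`, so agreement on exactly `n` letters means distance `1 / (n +
1)`. For equal sequences any large `n` serves. -/
theorem exists_agreement {J : Type*} {a b : ℕ → J} {δ : ℝ} (hδ : 0 < δ) (h : seqDist a b < δ) :
    ∃ n : ℕ, (∀ k < n, a k = b k) ∧ 1 / δ ≤ n + 1 := by
  by_cases hne : a = b
  · exact ⟨⌈1 / δ⌉₊, fun k _ => by rw [hne], (Nat.le_ceil _).trans (by linarith)⟩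
  · refine ⟨PiNat.firstDiff a b, fun k hk => PiNat.apply_eq_of_lt_firstDiff hk, ?_⟩
    rw [seqDist, if_neg hne] at h
    exact ((one_div_lt (by positivity) hδ).1 h).le

end MultiTiling

theorem mainTheorem5 {d l : ℕ} (hd : 0 < d) {J : Type*} [Finite J] [Nonempty J]
    (𝒮 : MultiSubstitution d l J) (h𝒮 : 𝒮.IsPrimitive)
    (D : Set (Space d)) (hD : D ∈ tilesOf 𝒮.X) :
    (∃ θ, 𝒮.IsTileFreqRate θ) ∧
    ∀ θ, 𝒮.IsTileFreqRate θ →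
      𝒮.theta0 θ < 1 ∧
      ∀ P ∈ patchesOf 𝒮.X, ∀ Q ∈ patchesOf 𝒮.X, ∀ U V : Set (Space d),
        NullMeasurableSet U volume → NullMeasurableSet V volume →
        Bornology.IsBounded U → Bornology.IsBounded V →
        ∃ C > 0, ∃ δ₀ > 0, ∀ δ, 0 < δ → δ < δ₀ →
          ∀ a b : ℕ → J, seqDist a b < δ →
          ∀ (μa : Measure (Points (𝒮.tilingSpace D a))) (μb : Measure (Points (𝒮.tilingSpace D b))),
            IsInvariantProbability μa → IsInvariantProbability μb →
            |μa.real (patchCylinder (𝒮.tilingSpace D a) P U ∩ patchCylinder (𝒮.tilingSpace D a) Q V) -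
              μb.real (patchCylinder (𝒮.tilingSpace D b) P U ∩ patchCylinder (𝒮.tilingSpace D b) Q V)|
              < C * 𝒮.theta0 θ ^ (1 / δ) := by
  obtain ⟨i, -⟩ := 𝒮.exists_proto D hD
  have : Nonempty (Fin l) := ⟨i⟩
  refine ⟨MultiSubstitution.exists_isTileFreqRate h𝒮, fun θ hθ => ?_⟩
  obtain ⟨h1, h2, -⟩ := MultiSubstitution.theta0_bounds (𝒮 := 𝒮) hd hθ.1 hθ.2.1
  have h0 : 0 < 𝒮.theta0 θ := hθ.1.trans h2
  refine ⟨h1, fun P hP Q hQ U V hU hV hUb hVb => ?_⟩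
  obtain ⟨C, hC, hrate⟩ :=
    MultiSubstitution.cylinderRate (D := D) hd hD hθ hP hQ hU hV hUb hVb
  -- The factor `θ₀⁻¹` pays for `1 / δ ≤ n + 1` in place of `n`, and `C + 1` makes the inequality
  -- strict even when `C = 0`.
  refine ⟨(C + 1) * (𝒮.theta0 θ)⁻¹, by positivity, 1, one_pos, ?_⟩
  intro δ hδ _ a b hab μa μb hμa hμb
  obtain ⟨n, hn, hnδ⟩ := exists_agreement hδ hab
  have hpow : 𝒮.theta0 θ ^ n ≤ (𝒮.theta0 θ)⁻¹ * 𝒮.theta0 θ ^ (1 / δ) := by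
    rw [← Real.rpow_natCast, ← Real.rpow_neg_one, ← Real.rpow_add h0]
    exact Real.rpow_le_rpow_of_exponent_ge h0 h1.le (by linarith)
  have hpos : 0 < (𝒮.theta0 θ)⁻¹ * 𝒮.theta0 θ ^ (1 / δ) :=
    mul_pos (inv_pos.2 h0) (Real.rpow_pos_of_pos h0 _)
  calc _ ≤ C * 𝒮.theta0 θ ^ n := hrate n a b hn μa μb hμa hμb
    _ ≤ C * ((𝒮.theta0 θ)⁻¹ * 𝒮.theta0 θ ^ (1 / δ)) := mul_le_mul_of_nonneg_left hpow hC
    _ < (C + 1) * ((𝒮.theta0 θ)⁻¹ * 𝒮.theta0 θ ^ (1 / δ)) :=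
        mul_lt_mul_of_pos_right (lt_add_one C) hpos
    _ = _ := (mul_assoc _ _ _).symm
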